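/- Let $n\in\mathbb N$ and $\alpha\in(0,1)$. For an open set $O$ in a Euclidean space let $buc^{k+\alpha}(O)$ be the little Hölder space, i.e. the closure of the spaces $BUC^{k+\beta}(O)$, $\beta\in(\alpha,1)$, in the $C^{k+\alpha}$-norm. For $k\ge 1$ let $\mathcal M^{k+\alpha}$ be the set of nonempty compact hypersurfaces $\Gamma\subset\mathbb R^n$ of class $buc^{k+\alpha}$ (locally graphs of $buc^{k+\alpha}$ functions over open parts of hyperplanes) that are oriented as boundaries: $\Gamma=\partial\Omega$ for a bounded open set $\Omega$ with $\Omega=\operatorname{int}\overline\Omega$. Let $\nu_\Gamma$ be the unit normal pointing out of $\Omega$, and let $d_{C^1}(\Gamma,\Gamma')$ be the Hausdorff distance in $\mathbb R^{2n}$ of the sets $N\Gamma=\{(y,\nu_\Gamma(y)) : y\in\Gamma\}$ and $N\Gamma'$. A function on $\Gamma$ is in $buc^{k+\alpha}(\Gamma)$ if it is locally of this class in graph charts of this class. Let $\Gamma_0\in\mathcal M^{j+\alpha}$ with $j\ge 2$. Call $\tilde r_0>0$ a tubular radius if $(y,s)\mapsto y+s\,\nu_{\Gamma_0}(y)$ is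 a bijection from $\Gamma_0\times(-\tilde r_0,\tilde r_0)$ onto $T_{\tilde r_0}(\Gamma_0)=\{x : \operatorname{dist}(x,\Gamma_0)<\tilde r_0\}$. Such a radius exists. Let $\tilde r_0$ be any tubular radius, let $\eta\in C^\infty(\mathbb R,[0,1])$ be $1$ on $[-\tilde r_0/2,\tilde r_0/2]$ and $0$ outside $(-3\tilde r_0/4,3\tilde r_0/4)$, and let $\psi\ge 0$ be a smooth compactly supported function on $\mathbb R^n$ with $\int\psi=1$, $\psi_\delta(x)=\delta^{-n}\psi(x/\delta)$. Let $\tilde\nu$ be the field with $\tilde\nu(y+s\,\nu_{\Gamma_0}(y))=\eta(s)\,\nu_{\Gamma_0}(y)$ for $y\in\Gamma_0$, $|s|<\tilde r_0$, and $\tilde\nu=0$ outside $T_{\tilde r_0}(\Gamma_0)$, and put $\nu^\delta=\psi_\delta*\tilde\nu$. Then there are $\delta_0,r_0,\varepsilon>0$ such that for every $\delta\in(0,\delta_0)$ the following holds. The flow $\varphi^\delta:\Gamma_0\times(-r_0,r_0)\to\mathbb R^n$ of $\nu^\delta$, given by $\partial_r\varphi^\delta(y,r)=\nu^\delta(\varphi^\delta(y,r))$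 and $\varphi^\delta(y,0)=y$, exists, is injective, and has an open image contained in $T_{\tilde r_0}(\Gamma_0)$. Moreover, for every $k$ with $1\le k\le j$ and every $\Gamma\in\mathcal M^{k+\alpha}$ with $d_{C^1}(\Gamma,\Gamma_0)<\varepsilon$, there is a unique function $\rho\in buc^{k+\alpha}(\Gamma_0)$ with values in $(-r_0,r_0)$ such that $$\Gamma=\{\varphi^\delta(y,\rho(y)) : y\in\Gamma_0\},$$ that is, $\Gamma$ is a $\nu^\delta$-graph over $\Gamma_0$. -/

import Mathlib

open Set Filter Topology MeasureTheory

noncomputable section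

namespace NuGraph

section Holder

variable {F : Type*} [NormedAddCommGroup F] [NormedSpace ℝ F]

/-- `f ∈ BUC^k(O)` for an open set `O`: `f` is `C^k` on `O` and all its derivatives up to order `k`
are bounded and uniformly continuous on `O`. -/
structure IsBUC (k : ℕ) (O : Set F) (f : F → ℝ) : Prop where
  contDiffOn : ContDiffOn ℝ k f O
  bounded : ∀ i ≤ k, ∃ C : ℝ, ∀ x ∈ O, ‖iteratedFDerivWithin ℝ i f O x‖ ≤ C
  uniformContinuousOn : ∀ i ≤ k, UniformContinuousOn (iteratedFDerivWithin ℝ i f O) O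

/-- The Hölder seminorm `[D^k f]_β` on `O` is at most `C`. -/
def HolderSeminormLE (k : ℕ) (β : ℝ) (O : Set F) (f : F → ℝ) (C : ℝ) : Prop :=
  ∀ x ∈ O, ∀ y ∈ O,
    ‖iteratedFDerivWithin ℝ k f O x - iteratedFDerivWithin ℝ k f O y‖ ≤ C * dist x y ^ β

/-- The (operator norm version of the) `C^{k+β}` norm of `f` on `O`, taken as the maximum of the
sup norms of the derivatives of order at most `k` and of `[D^k f]_β`, is at most `C`. -/
def HolderNormLE (k : ℕ) (β : ℝ) (O : Set F) (f : F → ℝ) (C : ℝ) : Prop :=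
  (∀ i ≤ k, ∀ x ∈ O, ‖iteratedFDerivWithin ℝ i f O x‖ ≤ C) ∧ HolderSeminormLE k β O f C

/-- `f ∈ BUC^{k+β}(O)`. -/
def IsHolder (k : ℕ) (β : ℝ) (O : Set F) (f : F → ℝ) : Prop :=
  IsBUC k O f ∧ ∃ C : ℝ, HolderSeminormLE k β O f C

/-- `f ∈ buc^{k+α}(O)`, the little Hölder space: the closure of the spaces `BUC^{k+β}(O)`,
`β > α`, in the `C^{k+α}` norm. -/
def IsLittleHolder (k : ℕ) (α : ℝ) (O : Set F) (f : F → ℝ) : Prop :=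
  IsHolder k α O f ∧
    ∀ ε > 0, ∃ β ∈ Ioo α 1, ∃ g : F → ℝ, IsHolder k β O g ∧
      HolderNormLE k α O (fun x => f x - g x) ε

end Holder

variable {n : ℕ}

/-- In the cylinder over the open subset `O` of the hyperplane `e^⊥`, between the heights `a` and
`b` in the direction of the unit vector `e`, the set `Γ` is the graph of the function
`g ∈ buc^{k+α}(O)`. -/
structure IsGraphChart (k : ℕ) (α : ℝ) (Γ : Set (EuclideanSpace ℝ (Fin n)))
    (e : EuclideanSpace ℝ (Fin n)) (O : Set (Submodule.span ℝ {e})ᗮ) (a b : ℝ)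
    (g : (Submodule.span ℝ {e})ᗮ → ℝ) : Prop where
  norm_eq : ‖e‖ = 1
  isOpen : IsOpen O
  littleHolder : IsLittleHolder k α O g
  mapsTo : MapsTo g O (Ioo a b)
  graph : ∀ u ∈ O, ∀ t ∈ Ioo a b, (u : EuclideanSpace ℝ (Fin n)) + t • e ∈ Γ ↔ t = g u

/-- `Γ` is an (embedded) hypersurface of `ℝⁿ` of class `buc^{k+α}`: around each of its points it is
the graph, over an open part of a hyperplane, of a function of that class. -/
def IsHypersurface (k : ℕ) (α : ℝ) (Γ : Set (EuclideanSpace ℝ (Fin n))) : Prop :=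
  ∀ y ∈ Γ, ∃ (e : EuclideanSpace ℝ (Fin n)) (O : Set (Submodule.span ℝ {e})ᗮ) (a b : ℝ)
    (g : (Submodule.span ℝ {e})ᗮ → ℝ), IsGraphChart k α Γ e O a b g ∧
      ∃ u ∈ O, y = (u : EuclideanSpace ℝ (Fin n)) + g u • e

/-- `Ω` is the bounded region enclosed by `Γ`: a bounded open set with boundary `Γ` that equals the
interior of its closure, so that it lies on one side of `Γ` only. A compact hypersurface encloses
at most one such region. -/
structure IsRegionOf (Γ Ω : Set (EuclideanSpace ℝ (Fin n))) : Prop where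
  isOpen : IsOpen Ω
  isBounded : Bornology.IsBounded Ω
  frontier_eq : frontier Ω = Γ
  regular : interior (closure Ω) = Ω

/-- The set `𝓜^{k+α}` of the (nonempty) compact hypersurfaces of `ℝⁿ` of class `buc^{k+α}`, oriented
as boundaries of the regions that they enclose. -/
def hypersurfaces (n k : ℕ) (α : ℝ) : Set (Set (EuclideanSpace ℝ (Fin n))) :=
  {Γ | Γ.Nonempty ∧ IsCompact Γ ∧ IsHypersurface k α Γ ∧ ∃ Ω, IsRegionOf Γ Ω}

/-- The region enclosed by `Γ`. -/
def region (Γ : Set (EuclideanSpace ℝ (Fin n))) : Set (EuclideanSpace ℝ (Fin n)) :=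
  Classical.epsilon fun Ω => IsRegionOf Γ Ω

/-- `v` is a unit vector, orthogonal to the tangent space of `Γ` at `y`, that points out of the
region enclosed by `Γ`. -/
structure IsOutwardUnitNormal (Γ : Set (EuclideanSpace ℝ (Fin n)))
    (y v : EuclideanSpace ℝ (Fin n)) : Prop where
  norm_eq : ‖v‖ = 1
  orthogonal : ∀ τ ∈ tangentConeAt ℝ Γ y, inner ℝ τ v = 0
  outward : ∀ᶠ t in 𝓝[>] (0 : ℝ), y - t • v ∈ region Γ ∧ y + t • v ∉ closure (region Γ)

/-- The outward unit normal `ν_Γ(y)`. -/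
def normal (Γ : Set (EuclideanSpace ℝ (Fin n))) (y : EuclideanSpace ℝ (Fin n)) :
    EuclideanSpace ℝ (Fin n) :=
  Classical.epsilon fun v => IsOutwardUnitNormal Γ y v

/-- `NΓ = {(y, ν_Γ(y)) | y ∈ Γ}`, as a subset of the Euclidean space `ℝ²ⁿ`. -/
def normalGraph (Γ : Set (EuclideanSpace ℝ (Fin n))) :
    Set (WithLp 2 (EuclideanSpace ℝ (Fin n) × EuclideanSpace ℝ (Fin n))) :=
  (fun y => WithLp.toLp 2 (y, normal Γ y)) '' Γ

/-- The distance `d_{C¹}(Γ, Γ')`: the Hausdorff distance of `NΓ` and `NΓ'`. -/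
def distC1 (Γ Γ' : Set (EuclideanSpace ℝ (Fin n))) : ℝ :=
  Metric.hausdorffDist (normalGraph Γ) (normalGraph Γ')

/-- `ρ ∈ buc^{k+α}(Γ)` for a compact hypersurface `Γ` of class at least `buc^{k+α}`: around each point
of `Γ`, the function `ρ` is of this class in a graph chart of this class. -/
def IsLittleHolderOn (k : ℕ) (α : ℝ) (Γ : Set (EuclideanSpace ℝ (Fin n))) (ρ : Γ → ℝ) : Prop :=
  ∀ y ∈ Γ, ∃ (e : EuclideanSpace ℝ (Fin n)) (O : Set (Submodule.span ℝ {e})ᗮ) (a b : ℝ)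
    (g : (Submodule.span ℝ {e})ᗮ → ℝ), IsGraphChart k α Γ e O a b g ∧
      (∃ u ∈ O, y = (u : EuclideanSpace ℝ (Fin n)) + g u • e) ∧
      ∃ f : (Submodule.span ℝ {e})ᗮ → ℝ, IsLittleHolder k α O f ∧
        ∀ u ∈ O, ∀ h : (u : EuclideanSpace ℝ (Fin n)) + g u • e ∈ Γ, ρ ⟨_, h⟩ = f u

/-- `Φ(y, s) = y + s ν_Γ(y)`. -/
def normalMap (Γ : Set (EuclideanSpace ℝ (Fin n))) (p : EuclideanSpace ℝ (Fin n) × ℝ) :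
    EuclideanSpace ℝ (Fin n) :=
  p.1 + p.2 • normal Γ p.1

/-- `r` is the radius of a tubular neighborhood: each point `x` with `dist(x, Γ) < r` is
`y + s ν_Γ(y)` for exactly one pair `(y, s)` with `y ∈ Γ` and `|s| < r`. -/
def IsTubularRadius (Γ : Set (EuclideanSpace ℝ (Fin n))) (r : ℝ) : Prop :=
  0 < r ∧ BijOn (normalMap Γ) (Γ ×ˢ Ioo (-r) r) (Metric.thickening r Γ)

/-- A smooth cut-off function for the tubular radius `r`. -/
structure IsCutoff (r : ℝ) (η : ℝ → ℝ) : Prop where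
  contDiff : ContDiff ℝ (⊤ : ℕ∞) η
  range : ∀ s, η s ∈ Icc (0 : ℝ) 1
  eq_one : ∀ s ∈ Icc (-(r / 2)) (r / 2), η s = 1
  eq_zero : ∀ s ∉ Ioo (-(3 * r / 4)) (3 * r / 4), η s = 0

open Classical in
/-- The field that is `η(s) ν_Γ(y)` at the point `x = y + s ν_Γ(y)` of the tubular neighborhood of
radius `r`, and `0` outside of this neighborhood. -/
def extendedNormal (Γ : Set (EuclideanSpace ℝ (Fin n))) (r : ℝ) (η : ℝ → ℝ)
    (x : EuclideanSpace ℝ (Fin n)) : EuclideanSpace ℝ (Fin n) :=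
  if x ∈ Metric.thickening r Γ then
    let p := Function.invFunOn (normalMap Γ) (Γ ×ˢ Ioo (-r) r) x
    η p.2 • normal Γ p.1
  else 0

/-- A mollifier: a nonnegative smooth function with compact support and integral one. -/
structure IsMollifier (ψ : EuclideanSpace ℝ (Fin n) → ℝ) : Prop where
  contDiff : ContDiff ℝ (⊤ : ℕ∞) ψ
  hasCompactSupport : HasCompactSupport ψ
  nonneg : ∀ x, 0 ≤ ψ x
  integral_eq_one : ∫ x, ψ x = 1

/-- `ψ_δ(x) = δ⁻ⁿ ψ(x / δ)`. -/
def scaled (ψ : EuclideanSpace ℝ (Fin n) → ℝ) (δ : ℝ) (x : EuclideanSpace ℝ (Fin n)) : ℝ :=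
  (δ ^ n)⁻¹ * ψ (δ⁻¹ • x)

/-- The regularized normal field `ν^δ`: the convolution of `ψ_δ` with the extended normal field. -/
def regularizedNormal (Γ : Set (EuclideanSpace ℝ (Fin n))) (r : ℝ) (η : ℝ → ℝ)
    (ψ : EuclideanSpace ℝ (Fin n) → ℝ) (δ : ℝ) :
    EuclideanSpace ℝ (Fin n) → EuclideanSpace ℝ (Fin n) :=
  convolution (scaled ψ δ) (extendedNormal Γ r η) (ContinuousLinearMap.lsmul ℝ ℝ) volume

/-- `φ` is the flow of the vector field `w` on `Γ × (-r, r)`: for `y ∈ Γ`, the curve `φ(y, ·)` solves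
`x' = w(x)`, `x(0) = y` on `(-r, r)`. For a Lipschitz field this determines `φ` there. -/
def IsFlowOn (w : EuclideanSpace ℝ (Fin n) → EuclideanSpace ℝ (Fin n))
    (Γ : Set (EuclideanSpace ℝ (Fin n))) (r : ℝ)
    (φ : EuclideanSpace ℝ (Fin n) → ℝ → EuclideanSpace ℝ (Fin n)) : Prop :=
  ∀ y ∈ Γ, φ y 0 = y ∧ ∀ s ∈ Ioo (-r) r, HasDerivAt (φ y) (w (φ y s)) s

end NuGraph

end

/-! Write `w` for the regularized normal, a smooth compactly supported field with a smooth global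
flow `φ`. The extended normal is uniformly continuous, so for small `δ` the field `w` stays within
`1/8` of the normal of `Γ₀` near `Γ₀` (`exists_forall_norm_regularizedNormal_sub_le`). If `Γ` is
`C¹`-close to `Γ₀`, then `w` has positive inner product with the outward normals of both
hypersurfaces. Hence each trajectory crosses either one only from the enclosed region to the
exterior. Two such crossings would force a crossing in the opposite sense between them, so there is
at most one (`IsRegionOf.eq_of_crossing`). This gives both the injectivity of the flow map on `Γ₀`
and the uniqueness of `ρ`.

Crossings exist because a point near `Γ₀` is carried to opposite sides of `Γ₀` in the times `-s` and
`s` (`IsNormalFlow.sides`). They persist when the starting point moves, by an intermediate value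
argument (`IsNormalFlow.eventually_exists_mem`). This makes the image of the flow map open and `ρ`
continuous. It also makes the set of points of `Γ₀` whose trajectory meets `Γ` open in `Γ₀`. That
set is closed by compactness and meets every small connected piece of `Γ₀`, so it is all of `Γ₀`
(`IsNormalFlow.exists_graph`).

For the regularity, `ρ` solves in a chart `Y` of `Γ₀` the equation `G (φ (Y u) s) = 0`, where `G` is
a local defining function of `Γ`. Its derivative in `s` is `dG(w) > 0`, and the implicit function
theorem is carried out within the little Hölder class (`LocLittleHolder.implicit`). The calculus
uses a local form of the class: the top derivative has increments `o(‖y - z‖ ^ α)` at every point.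
Membership in the closure space implies this (`IsLittleHolder.locLittleHolder`); conversely, cutting
off and mollifying recovers the closure space on small balls
(`LocLittleHolder.exists_isLittleHolder_ball`).

Smoothness of the flow comes from the integral equation on `C([0,1], E)`: in a weighted variable it
is the identity minus a smooth contraction, whose inverse is smooth. -/

set_option linter.unusedSectionVars false

noncomputable section


namespace NuGraph

/-! ### Calculus of pointwise and local little Hölder conditions -/

section LittleHolderCalculus

open Asymptotics

variable {E F G H : Type} [NormedAddCommGroup E] [NormedSpace ℝ E] [NormedAddCommGroup F]
  [NormedSpace ℝ F] [NormedAddCommGroup G] [NormedSpace ℝ G] [NormedAddCommGroup H]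
  [NormedSpace ℝ H] {α : ℝ}

/-- The pointwise little Hölder condition: `f y - f z = o(‖y - z‖ ^ α)` as `y, z → x`. -/
def LittleHolderAt (α : ℝ) (f : E → F) (x : E) : Prop :=
  (fun p : E × E => f p.1 - f p.2) =o[𝓝 (x, x)] fun p => ‖p.1 - p.2‖ ^ α

theorem tendsto_sub_nhds_diag (x : E) :
    Tendsto (fun p : E × E => p.1 - p.2) (𝓝 (x, x)) (𝓝 0) := by
  have h : Continuous fun p : E × E => p.1 - p.2 := by fun_prop
  simpa using h.tendsto (x, x)

theorem tendsto_norm_sub_rpow (hα : 0 < α) (x : E) :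
    Tendsto (fun p : E × E => ‖p.1 - p.2‖ ^ α) (𝓝 (x, x)) (𝓝 0) := by
  have h := (tendsto_sub_nhds_diag x).norm.rpow_const (p := α) (Or.inr hα.le)
  simpa [Real.zero_rpow hα.ne'] using h

theorem LittleHolderAt.continuousAt (hα : 0 < α) {f : E → F} {x : E}
    (h : LittleHolderAt α f x) : ContinuousAt f x := by
  have h1 := h.trans_tendsto (tendsto_norm_sub_rpow hα x)
  have h2 : Tendsto (fun y : E => (y, x)) (𝓝 x) (𝓝 (x, x)) := by
    have : Continuous fun y : E => (y, x) := by fun_prop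
    exact this.tendsto x
  have h3 := h1.comp h2
  exact tendsto_sub_nhds_zero_iff.1 h3

theorem LittleHolderAt.congr {f g : E → F} {x : E} (h : LittleHolderAt α f x)
    (hfg : f =ᶠ[𝓝 x] g) : LittleHolderAt α g x := by
  refine IsLittleO.congr' h ?_ EventuallyEq.rfl
  have h1 : ∀ᶠ p : E × E in 𝓝 (x, x), f p.1 = g p.1 ∧ f p.2 = g p.2 := by
    rw [nhds_prod_eq]
    exact (tendsto_fst.eventually hfg).and (tendsto_snd.eventually hfg)
  filter_upwards [h1] with p hp
  rw [hp.1, hp.2]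

theorem isLittleO_norm_rpow (hα : α < 1) :
    (fun v : E => v) =o[𝓝 0] fun v => ‖v‖ ^ α := by
  rw [isLittleO_iff]
  intro c hc
  have h1 : Tendsto (fun v : E => ‖v‖ ^ (1 - α)) (𝓝 0) (𝓝 0) := by
    have := (tendsto_id (α := E) (x := 𝓝 0)).norm.rpow_const (p := 1 - α) (Or.inr (by linarith))
    simpa [Real.zero_rpow (by linarith : 1 - α ≠ 0)] using this
  filter_upwards [h1.eventually (ge_mem_nhds hc)] with v hv
  rcases eq_or_ne v 0 with rfl | hv0
  · simp; positivity
  have hv1 : 0 < ‖v‖ := norm_pos_iff.2 hv0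
  rw [Real.norm_of_nonneg (by positivity)]
  calc ‖v‖ = ‖v‖ ^ (1 - α) * ‖v‖ ^ α := by
        rw [← Real.rpow_add hv1]; simp
    _ ≤ c * ‖v‖ ^ α := by gcongr

theorem LittleHolderAt.of_isBigO (hα : α < 1) {f : E → F} {x : E}
    (h : (fun p : E × E => f p.1 - f p.2) =O[𝓝 (x, x)] fun p => p.1 - p.2) :
    LittleHolderAt α f x :=
  h.trans_isLittleO ((isLittleO_norm_rpow hα).comp_tendsto (tendsto_sub_nhds_diag x))

theorem isBigO_sub_of_contDiffAt {f : E → F} {x : E} (h : ContDiffAt ℝ 1 f x) :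
    (fun p : E × E => f p.1 - f p.2) =O[𝓝 (x, x)] fun p => p.1 - p.2 :=
  (h.hasStrictFDerivAt one_ne_zero).isBigO_sub

/-- A `C¹` function is strictly differentiable, hence Lipschitz near the point, and `‖v‖ = o(‖v‖ ^
α)` for `α < 1`. -/
theorem LittleHolderAt.of_contDiffAt (hα : α < 1) {f : E → F} {x : E} (h : ContDiffAt ℝ 1 f x) :
    LittleHolderAt α f x :=
  .of_isBigO hα (isBigO_sub_of_contDiffAt h)

theorem LittleHolderAt.prodMk {f : E → F} {g : E → G} {x : E} (hf : LittleHolderAt α f x)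
    (hg : LittleHolderAt α g x) : LittleHolderAt α (fun y => (f y, g y)) x :=
  IsLittleO.prod_left hf hg

theorem tendsto_prodMap_nhds_diag {f : E → F} {x : E} (hf : ContinuousAt f x) :
    Tendsto (fun p : E × E => (f p.1, f p.2)) (𝓝 (x, x)) (𝓝 (f x, f x)) := by
  rw [nhds_prod_eq, nhds_prod_eq]
  exact Filter.Tendsto.prodMap hf hf

/-- Composing two `α`-Hölder maps would only give the exponent `α²`, so one factor must be
Lipschitz. Here it is the outer one; the next lemma treats the inner one. -/
theorem LittleHolderAt.comp_of_contDiffAt_left (hα : 0 < α) {g : F → G} {f : E → F} {x : E}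
    (hg : ContDiffAt ℝ 1 g (f x)) (hf : LittleHolderAt α f x) :
    LittleHolderAt α (fun y => g (f y)) x :=
  ((isBigO_sub_of_contDiffAt hg).comp_tendsto
    (tendsto_prodMap_nhds_diag (hf.continuousAt hα))).trans_isLittleO hf

theorem LittleHolderAt.comp_of_contDiffAt_right (hα : 0 < α) {g : F → G} {f : E → F} {x : E}
    (hg : LittleHolderAt α g (f x)) (hf : ContDiffAt ℝ 1 f x) :
    LittleHolderAt α (fun y => g (f y)) x := by
  refine (IsLittleO.comp_tendsto hg (tendsto_prodMap_nhds_diag hf.continuousAt)).trans_isBigO ?_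
  exact ((isBigO_sub_of_contDiffAt hf).norm_norm).rpow hα.le (Eventually.of_forall fun _ => by
    simp)

theorem LittleHolderAt.clm_comp (hα : 0 < α) (L : F →L[ℝ] G) {f : E → F} {x : E}
    (hf : LittleHolderAt α f x) : LittleHolderAt α (fun y => L (f y)) x :=
  LittleHolderAt.comp_of_contDiffAt_left hα L.contDiff.contDiffAt hf

theorem LittleHolderAt.bilin (hα : 0 < α) (B : F →L[ℝ] G →L[ℝ] H) {f : E → F} {g : E → G} {x : E}
    (hf : LittleHolderAt α f x) (hg : LittleHolderAt α g x) :
    LittleHolderAt α (fun y => B (f y) (g y)) x :=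
  LittleHolderAt.comp_of_contDiffAt_left (g := fun p : F × G => B p.1 p.2) hα
    B.isBoundedBilinearMap.contDiff.contDiffAt (hf.prodMk hg)

/-- `f` is of class `C^k` on the open set `U`, and its derivative of order `k` satisfies the little
Hölder condition at each point of `U`. -/
def LocLittleHolder (α : ℝ) : ℕ → ∀ {F : Type} [NormedAddCommGroup F] [NormedSpace ℝ F],
    (E → F) → Set E → Prop
  | 0, _, _, _, f, U => ∀ x ∈ U, LittleHolderAt α f x
  | k + 1, _, _, _, f, U =>
    (∀ x ∈ U, DifferentiableAt ℝ f x) ∧ LocLittleHolder α k (fderiv ℝ f) U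

namespace LocLittleHolder

theorem mono {k : ℕ} {f : E → F} {U V : Set E} (h : LocLittleHolder α k f U) (hV : V ⊆ U) :
    LocLittleHolder α k f V := by
  induction k generalizing F with
  | zero => exact fun x hx => h x (hV hx)
  | succ k ih => exact ⟨fun x hx => h.1 x (hV hx), ih h.2⟩

theorem union {k : ℕ} {f : E → F} {U V : Set E} (hU : LocLittleHolder α k f U)
    (hV : LocLittleHolder α k f V) : LocLittleHolder α k f (U ∪ V) := by
  induction k generalizing F with
  | zero => exact fun x hx => hx.elim (hU x) (hV x)
  | succ k ih => exact ⟨fun x hx => hx.elim (hU.1 x) (hV.1 x), ih hU.2 hV.2⟩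

theorem congr {k : ℕ} {f g : E → F} {U : Set E} (hU : IsOpen U) (h : LocLittleHolder α k f U)
    (hfg : EqOn f g U) : LocLittleHolder α k g U := by
  induction k generalizing F with
  | zero =>
    exact fun x hx => (h x hx).congr (hfg.eventuallyEq_of_mem (hU.mem_nhds hx))
  | succ k ih =>
    refine ⟨fun x hx => (h.1 x hx).congr_of_eventuallyEq
      (hfg.symm.eventuallyEq_of_mem (hU.mem_nhds hx)), ih h.2 fun x hx => ?_⟩
    exact (hfg.eventuallyEq_of_mem (hU.mem_nhds hx)).fderiv_eq

theorem continuousOn (hα : 0 < α) {k : ℕ} {f : E → F} {U : Set E}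
    (h : LocLittleHolder α k f U) : ContinuousOn f U := by
  cases k with
  | zero => exact fun x hx => ((h x hx).continuousAt hα).continuousWithinAt
  | succ k => exact fun x hx => (h.1 x hx).continuousAt.continuousWithinAt

theorem contDiffOn (hα : 0 < α) {k : ℕ} {f : E → F} {U : Set E} (hU : IsOpen U)
    (h : LocLittleHolder α k f U) : ContDiffOn ℝ k f U := by
  induction k generalizing F with
  | zero => exact contDiffOn_zero.2 (h.continuousOn hα)
  | succ k ih =>
    rw [Nat.cast_add, Nat.cast_one, contDiffOn_succ_iff_fderiv_of_isOpen hU]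
    exact ⟨fun x hx => (h.1 x hx).differentiableWithinAt, by simp, ih h.2⟩

theorem of_contDiffOn (hα : α < 1) {k : ℕ} {f : E → F} {U : Set E} (hU : IsOpen U)
    (h : ContDiffOn ℝ (k + 1) f U) : LocLittleHolder α k f U := by
  induction k generalizing F with
  | zero =>
    intro x hx
    exact LittleHolderAt.of_contDiffAt hα ((by simpa using h : ContDiffOn ℝ 1 f U).contDiffAt
      (hU.mem_nhds hx))
  | succ k ih =>
    rw [contDiffOn_succ_iff_fderiv_of_isOpen hU] at h
    exact ⟨fun x hx => (h.1 x hx).differentiableAt (hU.mem_nhds hx), ih (by simpa using h.2.2)⟩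

theorem of_contDiff (hα : α < 1) (k : ℕ) {f : E → F} {U : Set E} (hU : IsOpen U)
    (h : ContDiff ℝ (⊤ : ℕ∞) f) : LocLittleHolder α k f U :=
  of_contDiffOn hα hU (h.of_le (by exact_mod_cast le_top)).contDiffOn

theorem of_succ (hα : α ∈ Ioo (0 : ℝ) 1) {k : ℕ} {f : E → F} {U : Set E} (hU : IsOpen U)
    (h : LocLittleHolder α (k + 1) f U) : LocLittleHolder α k f U :=
  of_contDiffOn hα.2 hU (by simpa using h.contDiffOn hα.1 hU)

theorem of_le (hα : α ∈ Ioo (0 : ℝ) 1) {k m : ℕ} (hkm : k ≤ m) {f : E → F} {U : Set E}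
    (hU : IsOpen U) (h : LocLittleHolder α m f U) : LocLittleHolder α k f U := by
  induction hkm with
  | refl => exact h
  | step _ ih => exact ih (h.of_succ hα hU)

theorem clm_comp (hα : 0 < α) {k : ℕ} (L : F →L[ℝ] G) {f : E → F} {U : Set E} (hU : IsOpen U)
    (h : LocLittleHolder α k f U) : LocLittleHolder α k (fun x => L (f x)) U := by
  induction k generalizing F G with
  | zero => exact fun x hx => (h x hx).clm_comp hα L
  | succ k ih =>
    refine ⟨fun x hx => L.differentiableAt.comp x (h.1 x hx), ?_⟩
    -- Differentiation turns the map `L` into composition with `L` on a space of operators; this is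
    -- why the inductions run over all codomains.
    refine congr hU (ih (ContinuousLinearMap.compL ℝ E F G L) h.2) fun x hx => ?_
    exact ((L.hasFDerivAt.comp x (h.1 x hx).hasFDerivAt).fderiv).symm

theorem prodMk (hα : 0 < α) {k : ℕ} {f : E → F} {g : E → G} {U : Set E} (hU : IsOpen U)
    (hf : LocLittleHolder α k f U) (hg : LocLittleHolder α k g U) :
    LocLittleHolder α k (fun x => (f x, g x)) U := by
  induction k generalizing F G with
  | zero => exact fun x hx => (hf x hx).prodMk (hg x hx)
  | succ k ih =>
    refine ⟨fun x hx => (hf.1 x hx).prodMk (hg.1 x hx), ?_⟩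
    refine congr hU (clm_comp hα ((ContinuousLinearMap.prodₗᵢ (𝕜 := ℝ) (E := E) (F := F) (G := G)
      ℝ).toContinuousLinearEquiv : _ →L[ℝ] _) hU (ih hf.2 hg.2)) fun x hx => ?_
    exact ((hf.1 x hx).hasFDerivAt.prodMk (hg.1 x hx).hasFDerivAt).fderiv.symm

theorem add (hα : 0 < α) {k : ℕ} {f g : E → F} {U : Set E} (hU : IsOpen U)
    (hf : LocLittleHolder α k f U) (hg : LocLittleHolder α k g U) :
    LocLittleHolder α k (fun x => f x + g x) U :=
  clm_comp hα (ContinuousLinearMap.fst ℝ F F + ContinuousLinearMap.snd ℝ F F) hU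
    (prodMk hα hU hf hg)

theorem bilin (hα : α ∈ Ioo (0 : ℝ) 1) {k : ℕ} (B : F →L[ℝ] G →L[ℝ] H) {f : E → F} {g : E → G}
    {U : Set E} (hU : IsOpen U) (hf : LocLittleHolder α k f U) (hg : LocLittleHolder α k g U) :
    LocLittleHolder α k (fun x => B (f x) (g x)) U := by
  induction k generalizing F G H with
  | zero => exact fun x hx => (hf x hx).bilin hα.1 B (hg x hx)
  | succ k ih =>
    have hd : ∀ x ∈ U, HasFDerivAt (fun x => B (f x) (g x))
        (B.precompR E (f x) (fderiv ℝ g x) + B.precompL E (fderiv ℝ f x) (g x)) x := fun x hx =>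
      B.hasFDerivAt_of_bilinear (hf.1 x hx).hasFDerivAt (hg.1 x hx).hasFDerivAt
    refine ⟨fun x hx => (hd x hx).differentiableAt, ?_⟩
    refine congr hU (add hα.1 hU (ih (B.precompR E) (hf.of_succ hα hU) hg.2)
      (ih (B.precompL E) hf.2 (hg.of_succ hα hU))) fun x hx => ?_
    exact (hd x hx).fderiv.symm

/-- The alternative in `h` supplies the Lipschitz factor at the bottom of the induction. Each step
differentiates `g` once, so the first option needs one order more than `k`, whereas `f` being `C¹`
passes unchanged through all steps. -/
theorem comp (hα : α ∈ Ioo (0 : ℝ) 1) {k : ℕ} {g : F → G} {f : E → F} {U : Set E} {V : Set F}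
    (hU : IsOpen U) (hV : IsOpen V) (hg : LocLittleHolder α k g V) (hf : LocLittleHolder α k f U)
    (hUV : MapsTo f U V) (h : ContDiffOn ℝ (k + 1) g V ∨ ContDiffOn ℝ 1 f U) :
    LocLittleHolder α k (fun x => g (f x)) U := by
  induction k generalizing G with
  | zero =>
    intro x hx
    rcases h with h | h
    · exact LittleHolderAt.comp_of_contDiffAt_left hα.1
        ((by simpa using h : ContDiffOn ℝ 1 g V).contDiffAt (hV.mem_nhds (hUV hx))) (hf x hx)
    · exact LittleHolderAt.comp_of_contDiffAt_right hα.1 (hg _ (hUV hx))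
        (h.contDiffAt (hU.mem_nhds hx))
  | succ k ih =>
    have hd : ∀ x ∈ U, HasFDerivAt (fun x => g (f x))
        ((fderiv ℝ g (f x)).comp (fderiv ℝ f x)) x := fun x hx =>
      (hg.1 _ (hUV hx)).hasFDerivAt.comp x (hf.1 x hx).hasFDerivAt
    refine ⟨fun x hx => (hd x hx).differentiableAt, ?_⟩
    have h' : ContDiffOn ℝ (k + 1) (fderiv ℝ g) V ∨ ContDiffOn ℝ 1 f U := by
      refine h.imp_left fun h => ?_
      rw [contDiffOn_succ_iff_fderiv_of_isOpen hV] at h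
      simpa using h.2.2
    refine congr hU (bilin hα (ContinuousLinearMap.compL ℝ E F G) hU
      (ih hg.2 (hf.of_succ hα hU) h') hf.2) fun x hx => ?_
    exact (hd x hx).fderiv.symm

/-- Functions of class `C^k` with little Hölder derivatives, `k ≥ 1`, are closed under
composition. -/
theorem comp_of_pos (hα : α ∈ Ioo (0 : ℝ) 1) {k : ℕ} (hk : 1 ≤ k) {g : F → G} {f : E → F}
    {U : Set E} {V : Set F} (hU : IsOpen U) (hV : IsOpen V) (hg : LocLittleHolder α k g V)
    (hf : LocLittleHolder α k f U) (hUV : MapsTo f U V) :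
    LocLittleHolder α k (fun x => g (f x)) U :=
  comp hα hU hV hg hf hUV (Or.inr ((hf.of_le hα hk hU).contDiffOn hα.1 hU |>.of_le (by simp)))

theorem comp_contDiff (hα : α ∈ Ioo (0 : ℝ) 1) {k : ℕ} {g : F → G} {f : E → F} {U : Set E}
    (hU : IsOpen U) (hg : ContDiff ℝ (⊤ : ℕ∞) g) (hf : LocLittleHolder α k f U) :
    LocLittleHolder α k (fun x => g (f x)) U :=
  comp hα hU isOpen_univ (of_contDiff hα.2 k isOpen_univ hg) hf (mapsTo_univ _ _)
    (Or.inl (hg.of_le (by exact_mod_cast le_top)).contDiffOn)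

end LocLittleHolder

end LittleHolderCalculus

end NuGraph

end

noncomputable section


namespace NuGraph

/-! ### Passage between the local condition and the closure of the Hölder spaces -/

section Mollification

open Asymptotics ContinuousLinearMap

variable {E F : Type} [NormedAddCommGroup E] [NormedSpace ℝ E] [NormedAddCommGroup F]
  [NormedSpace ℝ F] {α : ℝ}

/-- The pointwise condition becomes uniform through a Lebesgue number for a cover of the compact
support. If neither point lies in the support, both values vanish. -/
theorem exists_forall_dist_lt_of_littleHolderAt {f : E → F} (hf : HasCompactSupport f)
    (h : ∀ x, LittleHolderAt α f x) {ε : ℝ} (hε : 0 < ε) :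
    ∃ η > 0, ∀ x y, dist x y < η → ‖f x - f y‖ ≤ ε * dist x y ^ α := by
  have h1 : ∀ x, ∃ r > 0, ∀ y ∈ Metric.ball x r, ∀ z ∈ Metric.ball x r,
      ‖f y - f z‖ ≤ ε * dist y z ^ α := by
    intro x
    obtain ⟨r, hr, hr'⟩ := Metric.eventually_nhds_iff_ball.1 (isLittleO_iff.1 (h x) hε)
    refine ⟨r, hr, fun y hy z hz => ?_⟩
    have := hr' (y, z) (by rw [← ball_prod_same]; exact ⟨hy, hz⟩)
    rwa [Real.norm_of_nonneg (by positivity), ← dist_eq_norm y z] at this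
  choose r hr h1 using h1
  obtain ⟨η, hη, h2⟩ := lebesgue_number_lemma_of_metric (s := tsupport f)
    (c := fun x => Metric.ball x (r x)) hf (fun x => Metric.isOpen_ball)
    (fun x _ => mem_iUnion.2 ⟨x, Metric.mem_ball_self (hr x)⟩)
  have h3 : ∀ x ∈ tsupport f, ∀ y, dist x y < η → ‖f x - f y‖ ≤ ε * dist x y ^ α := by
    intro x hx y hxy
    obtain ⟨z, hz⟩ := h2 x hx
    exact h1 z x (hz (Metric.mem_ball_self hη)) y (hz (Metric.mem_ball'.2 hxy))
  refine ⟨η, hη, fun x y hxy => ?_⟩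
  by_cases hx : x ∈ tsupport f
  · exact h3 x hx y hxy
  by_cases hy : y ∈ tsupport f
  · rw [norm_sub_rev, dist_comm]
    exact h3 y hy x (by rwa [dist_comm])
  · rw [image_eq_zero_of_notMem_tsupport hx, image_eq_zero_of_notMem_tsupport hy]
    simp only [sub_self, norm_zero]
    positivity

/-- The derivatives of `f` of order at most `k` are bounded by `C`, and the derivative of order `k`
has Hölder seminorm at most `C`. -/
def HolderBound (α C : ℝ) : ℕ → ∀ {F : Type} [NormedAddCommGroup F] [NormedSpace ℝ F],
    (E → F) → Prop
  | 0, _, _, _, f => (∀ x, ‖f x‖ ≤ C) ∧ ∀ x y, ‖f x - f y‖ ≤ C * dist x y ^ α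
  | k + 1, _, _, _, f => (∀ x, ‖f x‖ ≤ C) ∧ HolderBound α C k (fderiv ℝ f)

theorem HolderBound.norm_iteratedFDeriv_le {C : ℝ} {k : ℕ} {f : E → F} (h : HolderBound α C k f)
    {i : ℕ} (hi : i ≤ k) (x : E) : ‖iteratedFDeriv ℝ i f x‖ ≤ C := by
  induction k generalizing F i with
  | zero =>
    obtain rfl : i = 0 := by omega
    rw [norm_iteratedFDeriv_zero]
    exact h.1 x
  | succ k ih =>
    cases i with
    | zero =>
      rw [norm_iteratedFDeriv_zero]
      exact h.1 x
    | succ i =>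
      rw [← norm_iteratedFDeriv_fderiv]
      exact ih h.2 (by omega)

/-- Currying is an isometry, so iterated derivatives and repeated `fderiv` have increments of the
same norm. This links the recursive definitions here to the spaces defined by
`iteratedFDerivWithin`. -/
theorem norm_iteratedFDeriv_succ_sub (k : ℕ) (f : E → F) (x y : E) :
    ‖iteratedFDeriv ℝ (k + 1) f x - iteratedFDeriv ℝ (k + 1) f y‖ =
      ‖iteratedFDeriv ℝ k (fderiv ℝ f) x - iteratedFDeriv ℝ k (fderiv ℝ f) y‖ := by
  rw [iteratedFDeriv_succ_eq_comp_right, iteratedFDeriv_succ_eq_comp_right, ← dist_eq_norm,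
    ← dist_eq_norm]
  exact (continuousMultilinearCurryRightEquiv' ℝ k E F).symm.dist_map _ _

theorem norm_iteratedFDeriv_zero_sub (f : E → F) (x y : E) :
    ‖iteratedFDeriv ℝ 0 f x - iteratedFDeriv ℝ 0 f y‖ = ‖f x - f y‖ := by
  rw [iteratedFDeriv_zero_eq_comp]
  simp only [Function.comp_apply]
  rw [← map_sub, LinearIsometryEquiv.norm_map]

theorem HolderBound.norm_iteratedFDeriv_sub_le {C : ℝ} {k : ℕ} {f : E → F}
    (h : HolderBound α C k f) (x y : E) :
    ‖iteratedFDeriv ℝ k f x - iteratedFDeriv ℝ k f y‖ ≤ C * dist x y ^ α := by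
  induction k generalizing F with
  | zero =>
    rw [norm_iteratedFDeriv_zero_sub]
    exact h.2 x y
  | succ k ih =>
    rw [norm_iteratedFDeriv_succ_sub]
    exact ih h.2

theorem littleHolderAt_iff_of_norm_sub {G : Type} [NormedAddCommGroup G] {f : E → F} {g : E → G}
    {x : E} (h : ∀ y z, ‖f y - f z‖ = ‖g y - g z‖) :
    LittleHolderAt α f x ↔ LittleHolderAt α g x := by
  unfold LittleHolderAt
  rw [← isLittleO_norm_left, ← isLittleO_norm_left (f' := fun p : E × E => g p.1 - g p.2)]
  simp_rw [h]

theorem LocLittleHolder.of_iteratedFDeriv {k : ℕ} {f : E → F} {U : Set E} (hU : IsOpen U)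
    (hf : ContDiffOn ℝ k f U) (h : ∀ x ∈ U, LittleHolderAt α (iteratedFDeriv ℝ k f) x) :
    LocLittleHolder α k f U := by
  induction k generalizing F with
  | zero =>
    exact fun x hx => (littleHolderAt_iff_of_norm_sub (norm_iteratedFDeriv_zero_sub f)).1 (h x hx)
  | succ k ih =>
    rw [Nat.cast_add, Nat.cast_one, contDiffOn_succ_iff_fderiv_of_isOpen hU] at hf
    exact ⟨fun x hx => (hf.1 x hx).differentiableAt (hU.mem_nhds hx), ih hf.2.2 fun x hx =>
      (littleHolderAt_iff_of_norm_sub (norm_iteratedFDeriv_succ_sub k f)).1 (h x hx)⟩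

section Convolution

variable [FiniteDimensional ℝ E] [MeasurableSpace E] [BorelSpace E] [CompleteSpace F]
  {μ : Measure E} [μ.IsAddHaarMeasure]

theorem ContDiffBump.norm_convolution_le (φ : ContDiffBump (0 : E)) {f : E → F}
    (hf : Continuous f) {C : ℝ} {x : E} (h : ∀ t, ‖f t‖ ≤ C) :
    ‖convolution (φ.normed μ) f (lsmul ℝ ℝ) μ x‖ ≤ C := by
  have := dist_convolution_le (μ := μ) (f := φ.normed μ) (g := f) (x₀ := x) (z₀ := 0)
    (R := φ.rOut) ((norm_nonneg _).trans (h x)) φ.support_normed_eq.subset φ.nonneg_normed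
    φ.integral_normed hf.aestronglyMeasurable (fun t _ => by simpa using h t)
  simpa using this

/-- Since increments of the mollification are mollified increments, it inherits the modulus of
continuity of `f`. -/
theorem ContDiffBump.convolution_sub_convolution (φ : ContDiffBump (0 : E)) {f : E → F}
    (hf : Continuous f) (x v : E) :
    convolution (φ.normed μ) f (lsmul ℝ ℝ) μ x - convolution (φ.normed μ) f (lsmul ℝ ℝ) μ (x + v) =
      convolution (φ.normed μ) (fun y => f y - f (y + v)) (lsmul ℝ ℝ) μ x := by
  have hc : Continuous (φ.normed μ) := φ.continuous_normed
  have hi : ∀ z : E, Integrable (fun t => φ.normed μ t • f (z - t)) μ := fun z =>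
    (by fun_prop : Continuous fun t => φ.normed μ t • f (z - t)).integrable_of_hasCompactSupport
      φ.hasCompactSupport_normed.smul_right
  simp only [convolution_def, lsmul_apply]
  rw [← integral_sub (hi x) (hi (x + v))]
  refine integral_congr_ae (Eventually.of_forall fun t => ?_)
  simp only [smul_sub]
  congr 3
  abel

theorem ContDiffBump.fderiv_convolution (φ : ContDiffBump (0 : E)) {f : E → F}
    (hf : ContDiff ℝ 1 f) (hfc : HasCompactSupport f) (x : E) :
    HasFDerivAt (convolution (φ.normed μ) f (lsmul ℝ ℝ) μ)
      (convolution (φ.normed μ) (fderiv ℝ f) (lsmul ℝ ℝ) μ x) x := by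
  have h := hfc.hasFDerivAt_convolution_right (lsmul ℝ ℝ : ℝ →L[ℝ] F →L[ℝ] F)
    (φ.continuous_normed (μ := μ)).locallyIntegrable (μ := μ) hf x
  convert h using 1
  refine integral_congr_ae (Eventually.of_forall fun t => ?_)
  ext v
  simp [precompR_apply]

/-- The mollifications of a compactly supported function of class `C^k` whose derivative of order
`k` is little Hölder converge to it in the `C^{k+α}` norm. -/
theorem exists_forall_holderBound_sub_convolution (hα : 0 < α) {k : ℕ} {f : E → F}
    (hf : HasCompactSupport f) (h : LocLittleHolder α k f univ) {ε : ℝ} (hε : 0 < ε) :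
    ∃ d > 0, ∀ φ : ContDiffBump (0 : E), φ.rOut < d →
      HolderBound α ε k fun x => f x - convolution (φ.normed μ) f (lsmul ℝ ℝ) μ x := by
  induction k generalizing F with
  | zero =>
    have hc : Continuous f := continuousOn_univ.1 (h.continuousOn hα)
    obtain ⟨η, hη, hη'⟩ := exists_forall_dist_lt_of_littleHolderAt hf (fun x => h x (mem_univ x))
      (half_pos hε)
    -- Increments over distances below `η` are controlled by `ε / 2` for `f` and again for its
    -- mollification. Over larger distances twice the sup norm of the difference suffices, because
    -- `2 * c ≤ ε * η ^ α`.
    set c := min ε (ε / 2 * η ^ α) with hcdef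
    have hcpos : 0 < c := by positivity
    obtain ⟨d, hd, hd'⟩ := Metric.uniformContinuous_iff.1 (hf.uniformContinuous_of_continuous hc)
      c hcpos
    refine ⟨d, hd, fun φ hφ => ?_⟩
    have hsup : ∀ x, ‖f x - convolution (φ.normed μ) f (lsmul ℝ ℝ) μ x‖ ≤ c := by
      intro x
      rw [← dist_eq_norm, dist_comm]
      refine φ.dist_normed_convolution_le hc.aestronglyMeasurable fun y hy => ?_
      exact (hd' ((Metric.mem_ball.1 hy).trans hφ)).le
    refine ⟨fun x => (hsup x).trans (min_le_left _ _), fun x y => ?_⟩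
    rcases lt_or_ge (dist x y) η with hxy | hxy
    · obtain ⟨v, rfl⟩ : ∃ v, y = x + v := ⟨y - x, by simp⟩
      have h1 : ‖convolution (φ.normed μ) f (lsmul ℝ ℝ) μ x -
          convolution (φ.normed μ) f (lsmul ℝ ℝ) μ (x + v)‖ ≤ ε / 2 * dist x (x + v) ^ α := by
        rw [ContDiffBump.convolution_sub_convolution φ hc]
        refine ContDiffBump.norm_convolution_le φ (by fun_prop) fun t => ?_
        have := hη' t (t + v) (by simpa using hxy)
        simpa using this
      have h2 := hη' x (x + v) hxy
      calc _ = ‖(f x - f (x + v)) - (convolution (φ.normed μ) f (lsmul ℝ ℝ) μ x -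
            convolution (φ.normed μ) f (lsmul ℝ ℝ) μ (x + v))‖ := by rw [sub_sub_sub_comm]
        _ ≤ _ := norm_sub_le _ _
        _ ≤ ε * dist x (x + v) ^ α := by linarith
    · calc _ ≤ c + c := (norm_sub_le _ _).trans (add_le_add (hsup x) (hsup y))
        _ ≤ ε * η ^ α := by linarith [min_le_right ε (ε / 2 * η ^ α)]
        _ ≤ ε * dist x y ^ α := by gcongr
  | succ k ih =>
    have hc : Continuous f := continuousOn_univ.1 (h.continuousOn hα)
    have hc1 : ContDiff ℝ 1 f := (contDiffOn_univ.1 (h.contDiffOn hα isOpen_univ)).of_le (by simp)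
    obtain ⟨d, hd, hd'⟩ := ih (hf.fderiv ℝ) h.2
    obtain ⟨d₂, hd₂, hd₂'⟩ := Metric.uniformContinuous_iff.1
      (hf.uniformContinuous_of_continuous hc) ε hε
    refine ⟨min d d₂, lt_min hd hd₂, fun φ hφ => ⟨fun x => ?_, ?_⟩⟩
    · rw [← dist_eq_norm, dist_comm]
      refine φ.dist_normed_convolution_le hc.aestronglyMeasurable fun y hy => ?_
      exact (hd₂' ((Metric.mem_ball.1 hy).trans (hφ.trans_le (min_le_right _ _)))).le
    · have h1 := hd' φ (hφ.trans_le (min_le_left _ _))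
      convert h1 using 2 with x
      exact ((h.1 x (mem_univ x)).hasFDerivAt.sub
        (ContDiffBump.fderiv_convolution φ hc1 hf x)).fderiv

end Convolution

theorem exists_contDiff_holderBound_sub [FiniteDimensional ℝ E] [CompleteSpace F] (hα : 0 < α)
    {k : ℕ} {f : E → F} (hf : HasCompactSupport f) (h : LocLittleHolder α k f univ) {ε : ℝ}
    (hε : 0 < ε) : ∃ g : E → F, ContDiff ℝ (⊤ : ℕ∞) g ∧ HasCompactSupport g ∧
      HolderBound α ε k fun x => f x - g x := by
  borelize E
  obtain ⟨d, hd, hd'⟩ := exists_forall_holderBound_sub_convolution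
    (μ := (Measure.addHaar : Measure E)) hα hf h hε
  let φ : ContDiffBump (0 : E) := ⟨d / 4, d / 2, by positivity, by linarith⟩
  have hc : Continuous f := continuousOn_univ.1 (h.continuousOn hα)
  refine ⟨_, ?_, ?_, hd' φ (by simp only [φ]; linarith)⟩
  · exact φ.hasCompactSupport_normed.contDiff_convolution_left _ φ.contDiff_normed
      hc.locallyIntegrable
  · exact φ.hasCompactSupport_normed.convolution _ hf

variable {O : Set E}

theorem isBUC_of_hasCompactSupport {k : ℕ} {f : E → ℝ} (hO : IsOpen O) (hf : ContDiff ℝ k f)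
    (hfc : HasCompactSupport f) : IsBUC k O f := by
  have hc : ∀ i ≤ k, Continuous (iteratedFDeriv ℝ i f) := fun i hi =>
    hf.continuous_iteratedFDeriv (by exact_mod_cast hi)
  refine ⟨hf.contDiffOn, fun i hi => ?_, fun i hi => ?_⟩
  · obtain ⟨C, hC⟩ := (hfc.iteratedFDeriv (𝕜 := ℝ) i).exists_bound_of_continuous (hc i hi)
    exact ⟨C, fun x hx => by rw [iteratedFDerivWithin_of_isOpen i hO hx]; exact hC x⟩
  · exact ((hfc.iteratedFDeriv (𝕜 := ℝ) i).uniformContinuous_of_continuous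
      (hc i hi)).uniformContinuousOn.congr fun x hx => (iteratedFDerivWithin_of_isOpen i hO hx).symm

theorem exists_norm_sub_le_of_hasCompactSupport {g : E → F} (hg : ContDiff ℝ 1 g)
    (hgc : HasCompactSupport g) {β : ℝ} (hβ : β ∈ Ioo (0 : ℝ) 1) :
    ∃ C, 0 ≤ C ∧ ∀ x y, ‖g x - g y‖ ≤ C * dist x y ^ β := by
  obtain ⟨L, hL⟩ := hg.lipschitzWith_of_hasCompactSupport hgc one_ne_zero
  obtain ⟨M, hM⟩ := hgc.exists_bound_of_continuous hg.continuous
  have hM0 : 0 ≤ M := (norm_nonneg _).trans (hM 0)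
  refine ⟨L + 2 * M, by positivity, fun x y => ?_⟩
  have h0 : (0 : ℝ) ≤ dist x y ^ β := by positivity
  rcases le_or_gt (dist x y) 1 with h | h
  · have h1 : dist x y ≤ dist x y ^ β := by
      simpa using Real.rpow_le_rpow_of_exponent_ge' dist_nonneg h hβ.1.le hβ.2.le
    have h2 : ‖g x - g y‖ ≤ L * dist x y := by rw [← dist_eq_norm]; exact hL.dist_le_mul x y
    have h3 : L * dist x y ≤ L * dist x y ^ β := by gcongr
    nlinarith
  · have h1 : 1 ≤ dist x y ^ β := Real.one_le_rpow h.le hβ.1.le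
    have h2 : ‖g x - g y‖ ≤ M + M := (norm_sub_le _ _).trans (add_le_add (hM x) (hM y))
    have h3 : (0 : ℝ) ≤ L * dist x y ^ β := by positivity
    nlinarith

theorem isHolder_of_hasCompactSupport {k : ℕ} {g : E → ℝ} (hO : IsOpen O)
    (hg : ContDiff ℝ (⊤ : ℕ∞) g) (hgc : HasCompactSupport g) {β : ℝ} (hβ : β ∈ Ioo (0 : ℝ) 1) :
    IsHolder k β O g := by
  have h1 : ContDiff ℝ 1 (iteratedFDeriv ℝ k g) :=
    hg.iteratedFDeriv_right (by exact_mod_cast le_top)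
  obtain ⟨C, -, hC⟩ := exists_norm_sub_le_of_hasCompactSupport h1 (hgc.iteratedFDeriv k) hβ
  refine ⟨isBUC_of_hasCompactSupport hO (hg.of_le (by exact_mod_cast le_top)) hgc, C,
    fun x hx y hy => ?_⟩
  rw [iteratedFDerivWithin_of_isOpen k hO hx, iteratedFDerivWithin_of_isOpen k hO hy]
  exact hC x y

/-- The mollifications are smooth with compact support, so they lie in every `BUC^{k+β}`, and they
approximate `f` in the `C^{k+α}` norm. One of them at distance `1` already shows that the seminorm
of `f` itself is finite. -/
theorem isLittleHolder_of_hasCompactSupport [FiniteDimensional ℝ E] (hα : α ∈ Ioo (0 : ℝ) 1)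
    {k : ℕ} {f : E → ℝ} (hO : IsOpen O) (hf : HasCompactSupport f)
    (h : LocLittleHolder α k f univ) : IsLittleHolder k α O f := by
  have hfk : ContDiff ℝ k f := contDiffOn_univ.1 (h.contDiffOn hα.1 isOpen_univ)
  refine ⟨⟨isBUC_of_hasCompactSupport hO hfk hf, ?_⟩, fun ε hε => ?_⟩
  · obtain ⟨g, hg, hgc, hfg⟩ := exists_contDiff_holderBound_sub hα.1 hf h one_pos
    have h1 : ContDiff ℝ 1 (iteratedFDeriv ℝ k g) :=
      hg.iteratedFDeriv_right (by exact_mod_cast le_top)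
    obtain ⟨C, hC0, hC⟩ := exists_norm_sub_le_of_hasCompactSupport h1 (hgc.iteratedFDeriv k) hα
    refine ⟨1 + C, fun x hx y hy => ?_⟩
    rw [iteratedFDerivWithin_of_isOpen k hO hx, iteratedFDerivWithin_of_isOpen k hO hy]
    have h2 := hfg.norm_iteratedFDeriv_sub_le x y
    have hs : ∀ z, iteratedFDeriv ℝ k (fun x => f x - g x) z =
        iteratedFDeriv ℝ k f z - iteratedFDeriv ℝ k g z := fun z =>
      iteratedFDeriv_sub_apply hfk.contDiffAt
        (hg.of_le (by exact_mod_cast le_top)).contDiffAt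
    rw [hs, hs] at h2
    calc _ = ‖(iteratedFDeriv ℝ k f x - iteratedFDeriv ℝ k g x -
          (iteratedFDeriv ℝ k f y - iteratedFDeriv ℝ k g y)) +
          (iteratedFDeriv ℝ k g x - iteratedFDeriv ℝ k g y)‖ := by congr 1; abel
      _ ≤ _ := norm_add_le _ _
      _ ≤ (1 + C) * dist x y ^ α := by linarith [hC x y]
  · obtain ⟨g, hg, hgc, hfg⟩ := exists_contDiff_holderBound_sub hα.1 hf h hε
    refine ⟨(α + 1) / 2, ⟨by linarith [hα.2], by linarith [hα.2]⟩, g,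
      isHolder_of_hasCompactSupport hO hg hgc ⟨by linarith [hα.1], by linarith [hα.2]⟩,
      fun i hi x hx => ?_, fun x hx y hy => ?_⟩
    · rw [iteratedFDerivWithin_of_isOpen i hO hx]
      exact hfg.norm_iteratedFDeriv_le hi x
    · rw [iteratedFDerivWithin_of_isOpen k hO hx, iteratedFDerivWithin_of_isOpen k hO hy]
      exact hfg.norm_iteratedFDeriv_sub_le x y

theorem IsBUC.congr {k : ℕ} {f g : E → ℝ} (h : IsBUC k O f) (hfg : EqOn g f O) : IsBUC k O g :=
  ⟨h.contDiffOn.congr hfg,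
    fun i hi => (h.bounded i hi).imp fun _ hC x hx => by
      rw [iteratedFDerivWithin_congr hfg hx]; exact hC x hx,
    fun i hi => (h.uniformContinuousOn i hi).congr fun _ hx =>
      (iteratedFDerivWithin_congr hfg hx i).symm⟩

theorem HolderSeminormLE.congr {k : ℕ} {f g : E → ℝ} {C : ℝ} (h : HolderSeminormLE k α O f C)
    (hfg : EqOn g f O) : HolderSeminormLE k α O g C := fun x hx y hy => by
  rw [iteratedFDerivWithin_congr hfg hx, iteratedFDerivWithin_congr hfg hy]; exact h x hx y hy

theorem IsLittleHolder.congr {k : ℕ} {f g : E → ℝ} (h : IsLittleHolder k α O f)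
    (hfg : EqOn g f O) : IsLittleHolder k α O g := by
  refine ⟨⟨h.1.1.congr hfg, h.1.2.imp fun _ hC => hC.congr hfg⟩, fun ε hε => ?_⟩
  obtain ⟨β, hβ, u, hu, h1, h2⟩ := h.2 ε hε
  have he : EqOn (fun x => g x - u x) (fun x => f x - u x) O := fun x hx => by simp [hfg hx]
  exact ⟨β, hβ, u, hu, fun i hi x hx => by
    rw [iteratedFDerivWithin_congr he hx]; exact h1 i hi x hx, h2.congr he⟩

/-- A function whose derivative of order `k` is locally little Hölder belongs to the little Hölder
space on all small balls. -/
theorem LocLittleHolder.exists_isLittleHolder_ball [FiniteDimensional ℝ E]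
    (hα : α ∈ Ioo (0 : ℝ) 1) {k : ℕ} {f : E → ℝ} {U : Set E} (hU : IsOpen U)
    (h : LocLittleHolder α k f U) {x : E} (hx : x ∈ U) :
    ∃ κ > 0, ∀ κ' ≤ κ, IsLittleHolder k α (Metric.ball x κ') f := by
  obtain ⟨r, hr, hrU⟩ := Metric.isOpen_iff.1 hU x hx
  let χ : ContDiffBump x := ⟨r / 4, r / 2, by positivity, by linarith⟩
  have hχU : tsupport χ ⊆ U := by
    rw [χ.tsupport_eq]
    exact (Metric.closedBall_subset_ball (by simp only [χ]; linarith)).trans hrU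
  -- The cut-off product is regular on `U` and vanishes on the complement of the support of `χ`;
  -- these two open sets cover the space.
  have h1 : LocLittleHolder α k (fun y => χ y * f y) univ := by
    have hUo : LocLittleHolder α k (fun y => χ y * f y) U :=
      bilin hα (ContinuousLinearMap.mul ℝ ℝ) hU (of_contDiff hα.2 k hU χ.contDiff) h
    have hVo : LocLittleHolder α k (fun y => χ y * f y) (tsupport χ)ᶜ := by
      have hV : IsOpen (tsupport χ)ᶜ := (isClosed_tsupport _).isOpen_compl
      refine congr (f := fun _ => (0 : ℝ)) hV (of_contDiff hα.2 k hV contDiff_const) fun y hy => ?_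
      simp [image_eq_zero_of_notMem_tsupport hy]
    have hun : U ∪ (tsupport χ)ᶜ = univ := by
      refine eq_univ_of_forall fun y => ?_
      by_cases hy : y ∈ tsupport χ
      · exact Or.inl (hχU hy)
      · exact Or.inr hy
    rw [← hun]
    exact hUo.union hVo
  refine ⟨r / 4, by positivity, fun κ' hκ' => ?_⟩
  refine (isLittleHolder_of_hasCompactSupport hα Metric.isOpen_ball
    (χ.hasCompactSupport.mul_right) h1).congr fun y hy => ?_
  have : χ y = 1 := χ.one_of_mem_closedBall
    (Metric.ball_subset_closedBall (Metric.ball_subset_ball hκ' hy))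
  simp [this]

/-- Split `f = (f - g) + g` with `g` of exponent `β > α`: the first part has seminorm at most `c /
2`, and the increments of the second are `O(‖y - z‖ ^ β) = o(‖y - z‖ ^ α)`. -/
theorem IsLittleHolder.littleHolderAt {k : ℕ} {f : E → ℝ} (hO : IsOpen O)
    (h : IsLittleHolder k α O f) {x : E} (hx : x ∈ O) :
    LittleHolderAt α (iteratedFDeriv ℝ k f) x := by
  rw [LittleHolderAt, isLittleO_iff]
  intro c hc
  obtain ⟨β, hβ, g, ⟨hg, C, hC⟩, -, h2⟩ := h.2 (c / 2) (half_pos hc)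
  have hs : ∀ z ∈ O, iteratedFDerivWithin ℝ k (fun x => f x - g x) O z =
      iteratedFDerivWithin ℝ k f O z - iteratedFDerivWithin ℝ k g O z := fun z hz =>
    iteratedFDerivWithin_sub_apply (h.1.1.contDiffOn z hz) (hg.contDiffOn z hz)
      hO.uniqueDiffOn hz
  have h3 : Tendsto (fun p : E × E => C * ‖p.1 - p.2‖ ^ (β - α)) (𝓝 (x, x)) (𝓝 0) := by
    simpa using (tendsto_norm_sub_rpow (sub_pos.2 hβ.1) x).const_mul C
  have hO2 : ∀ᶠ p : E × E in 𝓝 (x, x), p.1 ∈ O ∧ p.2 ∈ O := by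
    rw [nhds_prod_eq]
    exact (tendsto_fst.eventually (hO.mem_nhds hx)).and (tendsto_snd.eventually (hO.mem_nhds hx))
  filter_upwards [h3.eventually (ge_mem_nhds (half_pos hc)), hO2] with p hp ⟨hp1, hp2⟩
  rw [← iteratedFDerivWithin_of_isOpen k hO hp1, ← iteratedFDerivWithin_of_isOpen k hO hp2,
    Real.norm_of_nonneg (by positivity)]
  rcases eq_or_ne p.1 p.2 with he | hne
  · rw [he]; simp; positivity
  have hpos : 0 < ‖p.1 - p.2‖ := norm_pos_iff.2 (sub_ne_zero.2 hne)
  have h4 := h2 p.1 hp1 p.2 hp2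
  have h5 := hC p.1 hp1 p.2 hp2
  rw [hs _ hp1, hs _ hp2] at h4
  rw [dist_eq_norm] at h4 h5
  have h6 : C * ‖p.1 - p.2‖ ^ β ≤ c / 2 * ‖p.1 - p.2‖ ^ α := by
    calc C * ‖p.1 - p.2‖ ^ β = C * ‖p.1 - p.2‖ ^ (β - α) * ‖p.1 - p.2‖ ^ α := by
          rw [mul_assoc, ← Real.rpow_add hpos, sub_add_cancel]
      _ ≤ c / 2 * ‖p.1 - p.2‖ ^ α := by gcongr
  calc _ = ‖(iteratedFDerivWithin ℝ k f O p.1 - iteratedFDerivWithin ℝ k g O p.1 -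
        (iteratedFDerivWithin ℝ k f O p.2 - iteratedFDerivWithin ℝ k g O p.2)) +
        (iteratedFDerivWithin ℝ k g O p.1 - iteratedFDerivWithin ℝ k g O p.2)‖ := by
        congr 1; abel
    _ ≤ _ := norm_add_le _ _
    _ ≤ c * ‖p.1 - p.2‖ ^ α := by linarith

theorem IsLittleHolder.locLittleHolder {k : ℕ} {f : E → ℝ} (hO : IsOpen O)
    (h : IsLittleHolder k α O f) : LocLittleHolder α k f O :=
  .of_iteratedFDeriv hO h.1.1.contDiffOn fun _ hx => h.littleHolderAt hO hx

end Mollification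

end NuGraph

end

noncomputable section


namespace NuGraph

/-! ### Smooth dependence for the integral equation of an autonomous field -/

section Nemytskii

open ContinuousLinearMap

variable {E F : Type} [NormedAddCommGroup E] [NormedSpace ℝ E] [NormedAddCommGroup F]
  [NormedSpace ℝ F]

/-- The superposition operator `b ↦ (s ↦ V (s, b s))` on continuous curves. -/
def superposition (V : ℝ × E → F) (hV : Continuous V) (b : C(Icc (0 : ℝ) 1, E)) :
    C(Icc (0 : ℝ) 1, F) :=
  ⟨fun s => V (s, b s), by fun_prop⟩

/-- Pointwise application of a curve of continuous linear maps to a curve of vectors. -/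
def pointwiseApply :
    C(Icc (0 : ℝ) 1, E →L[ℝ] F) →L[ℝ] C(Icc (0 : ℝ) 1, E) →L[ℝ] C(Icc (0 : ℝ) 1, F) :=
  LinearMap.mkContinuous₂
    (LinearMap.mk₂ ℝ (fun (A : C(Icc (0 : ℝ) 1, E →L[ℝ] F)) (h : C(Icc (0 : ℝ) 1, E)) =>
      (⟨fun s => A s (h s), by fun_prop⟩ : C(Icc (0 : ℝ) 1, F)))
      (fun _ _ _ => by ext; simp) (fun _ _ _ => by ext; simp) (fun _ _ _ => by ext; simp)
      (fun _ _ _ => by ext; simp)) 1 (fun A h => by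
        rw [ContinuousMap.norm_le _ (by positivity)]
        intro s
        rw [one_mul]
        exact (A s).le_of_opNorm_le_of_le (A.norm_coe_le_norm s) (h.norm_coe_le_norm s))

/-- The partial derivative with respect to the second variable. -/
def fderivSnd (V : ℝ × E → F) (p : ℝ × E) : E →L[ℝ] F :=
  (fderiv ℝ V p).comp (ContinuousLinearMap.inr ℝ ℝ E)

theorem contDiff_fderivSnd {V : ℝ × E → F} (hV : ContDiff ℝ (⊤ : ℕ∞) V) :
    ContDiff ℝ (⊤ : ℕ∞) (fderivSnd V) :=
  (hV.fderiv_right (m := (⊤ : ℕ∞)) (by simp)).clm_comp contDiff_const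

theorem hasFDerivAt_fderivSnd {V : ℝ × E → F} (hV : Differentiable ℝ V) (s : ℝ) (y : E) :
    HasFDerivAt (fun y => V (s, y)) (fderivSnd V (s, y)) y :=
  (hV (s, y)).hasFDerivAt.comp y (hasFDerivAt_prodMk_right s y)

/-- The graph of `b` is compact, so `fderivSnd V` varies by at most `ε` within a uniform distance
`δ` of it. The mean value inequality then bounds the remainder at all times simultaneously. -/
theorem hasFDerivAt_superposition {V : ℝ × E → F} (hV : ContDiff ℝ (⊤ : ℕ∞) V)
    (b : C(Icc (0 : ℝ) 1, E)) :
    HasFDerivAt (superposition V hV.continuous)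
      (pointwiseApply (superposition (fderivSnd V) (contDiff_fderivSnd hV).continuous b)) b := by
  have hVd : Differentiable ℝ V := hV.differentiable (by simp)
  rw [hasFDerivAt_iff_isLittleO, Asymptotics.isLittleO_iff]
  intro ε hε
  have hK : IsCompact (range fun s : Icc (0 : ℝ) 1 => ((s : ℝ), b s)) :=
    isCompact_range (by fun_prop)
  have hu := hK.uniformContinuousAt_of_continuousAt (fderivSnd V)
    (fun _ _ => (contDiff_fderivSnd hV).continuous.continuousAt) (Metric.dist_mem_uniformity hε)
  obtain ⟨δ, hδ, hδ'⟩ := Metric.mem_uniformity_dist.1 hu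
  filter_upwards [Metric.ball_mem_nhds b hδ] with c hc
  rw [ContinuousMap.norm_le _ (by positivity)]
  intro s
  have hcs : c s ∈ Metric.ball (b s) δ :=
    (ContinuousMap.dist_apply_le_dist s).trans_lt hc
  have h1 := (convex_ball (b s) δ).norm_image_sub_le_of_norm_hasFDerivWithin_le'
    (f := fun y => V (s, y)) (f' := fun y => fderivSnd V (s, y)) (φ := fderivSnd V (s, b s))
    (C := ε) (fun y _ => (hasFDerivAt_fderivSnd hVd s y).hasFDerivWithinAt)
    (fun y hy => by
      have := @hδ' ((s : ℝ), b s) ((s : ℝ), y) (by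
        rw [Prod.dist_eq]
        simpa [hδ] using (Metric.mem_ball'.1 hy))
      have := this (mem_range_self s)
      rw [← dist_eq_norm, dist_comm]
      exact le_of_lt this)
    (Metric.mem_ball_self hδ) hcs
  refine h1.trans ?_
  gcongr
  exact (c - b).norm_coe_le_norm s

/-- The derivative is again a superposition operator, followed by the bounded linear
`pointwiseApply`; hence the induction on the order, for all `F`. -/
theorem contDiff_superposition {V : ℝ × E → F} (hV : ContDiff ℝ (⊤ : ℕ∞) V) :
    ContDiff ℝ (⊤ : ℕ∞) (superposition V hV.continuous) := by
  rw [contDiff_infty]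
  intro n
  induction n generalizing F with
  | zero =>
    exact contDiff_zero.2 (continuous_iff_continuousAt.2 fun b =>
      (hasFDerivAt_superposition hV b).continuousAt)
  | succ n ih =>
    rw [Nat.cast_add, Nat.cast_one, contDiff_succ_iff_hasFDerivAt]
    have hp : ContDiff ℝ n fun A : C(Icc (0 : ℝ) 1, E →L[ℝ] F) => pointwiseApply A := by
      fun_prop
    exact ⟨fun b => pointwiseApply (superposition (fderivSnd V)
      (contDiff_fderivSnd hV).continuous b),
      hp.comp (ih (contDiff_fderivSnd hV)),
      hasFDerivAt_superposition hV⟩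

variable [CompleteSpace E]

/-- The exponentially weighted Volterra operator `f ↦ (t ↦ e^{-Mt} ∫₀ᵗ e^{Ms} f(s) ds)`. -/
def volterra (M : ℝ) (f : C(Icc (0 : ℝ) 1, E)) : C(Icc (0 : ℝ) 1, E) :=
  ⟨fun t => Real.exp (-(M * t)) • ∫ s in (0 : ℝ)..t, Real.exp (M * s) • f (projIcc 0 1 zero_le_one s),
    by
      have : Continuous fun t : ℝ =>
          ∫ s in (0 : ℝ)..t, Real.exp (M * s) • f (projIcc 0 1 zero_le_one s) :=
        intervalIntegral.continuous_primitive
          (fun _ _ => Continuous.intervalIntegrable (by fun_prop) _ _) 0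
      fun_prop⟩

theorem volterra_apply (M : ℝ) (f : C(Icc (0 : ℝ) 1, E)) (t : Icc (0 : ℝ) 1) :
    volterra M f t = Real.exp (-(M * t)) •
      ∫ s in (0 : ℝ)..t, Real.exp (M * s) • f (projIcc 0 1 zero_le_one s) := rfl

/-- The weight makes the operator norm as small as desired, so the whole interval `[0, 1]` is
treated at once without shortening the time. -/
theorem norm_volterra_le {M : ℝ} (hM : 0 < M) (f : C(Icc (0 : ℝ) 1, E)) :
    ‖volterra M f‖ ≤ M⁻¹ * ‖f‖ := by
  rw [ContinuousMap.norm_le _ (by positivity)]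
  intro t
  rw [volterra_apply, norm_smul, Real.norm_of_nonneg (by positivity)]
  have h1 : ‖∫ s in (0 : ℝ)..t, Real.exp (M * s) • f (projIcc 0 1 zero_le_one s)‖ ≤
      ∫ s in (0 : ℝ)..t, Real.exp (M * s) * ‖f‖ := by
    refine intervalIntegral.norm_integral_le_of_norm_le t.2.1
      (Eventually.of_forall fun s _ => ?_)
      (Continuous.intervalIntegrable (by fun_prop) _ _)
    rw [norm_smul, Real.norm_of_nonneg (by positivity)]
    gcongr
    exact f.norm_coe_le_norm _
  have h2 : ∫ s in (0 : ℝ)..t, Real.exp (M * s) * ‖f‖ =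
      M⁻¹ * (Real.exp (M * t) - 1) * ‖f‖ := by
    rw [intervalIntegral.integral_mul_const, intervalIntegral.integral_comp_mul_left _ hM.ne']
    simp
  calc _ ≤ Real.exp (-(M * t)) * (M⁻¹ * (Real.exp (M * t) - 1) * ‖f‖) := by
        rw [← h2]; gcongr
    _ = M⁻¹ * ‖f‖ * (Real.exp (-(M * t)) * Real.exp (M * t)) -
        Real.exp (-(M * t)) * (M⁻¹ * ‖f‖) := by ring
    _ ≤ M⁻¹ * ‖f‖ := by
        rw [← Real.exp_add]
        simp only [neg_add_cancel, Real.exp_zero, mul_one]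
        have : 0 ≤ Real.exp (-(M * t)) * (M⁻¹ * ‖f‖) := by positivity
        linarith

/-- The Volterra operator as a continuous linear map. -/
def volterraL {M : ℝ} (hM : 0 < M) : C(Icc (0 : ℝ) 1, E) →L[ℝ] C(Icc (0 : ℝ) 1, E) :=
  LinearMap.mkContinuous
    { toFun := volterra M
      map_add' := fun f g => by
        ext t
        simp only [volterra_apply, ContinuousMap.add_apply, smul_add]
        rw [intervalIntegral.integral_add
          (Continuous.intervalIntegrable (by fun_prop) _ _)
          (Continuous.intervalIntegrable (by fun_prop) _ _), smul_add]
      map_smul' := fun c f => by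
        ext t
        simp only [volterra_apply, ContinuousMap.smul_apply, RingHom.id_apply]
        simp_rw [smul_comm _ c]
        rw [intervalIntegral.integral_smul, smul_comm] } M⁻¹ (norm_volterra_le hM)

theorem norm_volterraL_le {M : ℝ} (hM : 0 < M) : ‖volterraL (E := E) hM‖ ≤ M⁻¹ :=
  LinearMap.mkContinuous_norm_le _ (by positivity) _

/-- The curves `t ↦ e^{-Mt} x`. -/
def expCurve (M : ℝ) (hM : 0 < M) : E →L[ℝ] C(Icc (0 : ℝ) 1, E) :=
  LinearMap.mkContinuous
    { toFun := fun x => ⟨fun t => Real.exp (-(M * t)) • x, by fun_prop⟩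
      map_add' := fun x y => by ext; simp
      map_smul' := fun c x => by ext t; exact smul_comm _ _ _ } 1 (fun x => by
        rw [ContinuousMap.norm_le _ (by positivity)]
        intro t
        have h : Real.exp (-(M * t)) ≤ 1 := by
          rw [Real.exp_le_one_iff]
          have := mul_nonneg hM.le t.2.1
          linarith
        simp only [LinearMap.coe_mk, AddHom.coe_mk, ContinuousMap.coe_mk]
        rw [norm_smul, Real.norm_of_nonneg (by positivity)]
        gcongr)

theorem expCurve_apply (M : ℝ) (hM : 0 < M) (x : E) (t : Icc (0 : ℝ) 1) :
    expCurve M hM x t = Real.exp (-(M * t)) • x := rfl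

open scoped NNReal in
/-- A perturbation of the identity by a smooth contraction is a diffeomorphism. -/
theorem exists_homeomorph_sub_contDiff {X : Type*} [NormedAddCommGroup X] [NormedSpace ℝ X]
    [CompleteSpace X] {K : X → X} (hK : ContDiff ℝ (⊤ : ℕ∞) K) {c : ℝ≥0} (hc : c < 1)
    (hL : LipschitzWith c K) :
    ∃ S : X → X, ContDiff ℝ (⊤ : ℕ∞) S ∧ ∀ x, S x - K (S x) = x := by
  have h1 : ApproximatesLinearOn (fun x => x - K x)
      ((ContinuousLinearEquiv.refl ℝ X : X ≃L[ℝ] X) : X →L[ℝ] X) univ c := by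
    intro x _ y _
    have : x - K x - (y - K y) - (x - y) = -(K x - K y) := by abel
    simp only [ContinuousLinearEquiv.coe_refl, ContinuousLinearMap.id_apply]
    rw [this, norm_neg, ← dist_eq_norm, ← dist_eq_norm]
    exact hL.dist_le_mul x y
  have h2 : Subsingleton X ∨ c < ‖((ContinuousLinearEquiv.refl ℝ X).symm : X →L[ℝ] X)‖₊⁻¹ := by
    rcases subsingleton_or_nontrivial X with h | h
    · exact Or.inl h
    · right
      have : ((ContinuousLinearEquiv.refl ℝ X).symm : X →L[ℝ] X) = ContinuousLinearMap.id ℝ X := rfl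
      rw [this, ContinuousLinearMap.nnnorm_id]
      simpa using hc
  let H := h1.toHomeomorph _ h2
  have hH : ∀ x, H x = x - K x := fun x => rfl
  have hd : ∀ x, ‖fderiv ℝ K x‖ < 1 := fun x =>
    (norm_fderiv_le_of_lipschitz ℝ hL).trans_lt (by exact_mod_cast hc)
  refine ⟨H.symm, ?_, fun x => ?_⟩
  -- The derivative `1 - K'` is invertible by the Neumann series, so the inverse function theorem
  -- makes the global inverse smooth.
  · refine H.contDiff_symm (f₀' := fun x => ContinuousLinearEquiv.unitsEquiv ℝ X
      (Units.oneSub (fderiv ℝ K x) (hd x))) (fun x => ?_) ?_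
    · have h3 : HasFDerivAt (fun x => x - K x) (ContinuousLinearMap.id ℝ X - fderiv ℝ K x) x :=
        (hasFDerivAt_id x).sub (hK.differentiable (by simp) x).hasFDerivAt
      exact h3
    · exact contDiff_id.sub hK
  · rw [← hH, H.apply_symm_apply]

/-- The vector field `W` in the weighted variable `e^{-Mt} x`. -/
def weightedField (M : ℝ) (W : E → E) (p : ℝ × E) : E :=
  Real.exp (-(M * p.1)) • W (Real.exp (M * p.1) • p.2)

theorem contDiff_weightedField (M : ℝ) {W : E → E} (hW : ContDiff ℝ (⊤ : ℕ∞) W) :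
    ContDiff ℝ (⊤ : ℕ∞) (weightedField M W) := by
  refine ContDiff.smul (by fun_prop) (hW.comp ?_)
  exact ContDiff.smul (by fun_prop) (by fun_prop)

open scoped NNReal in
-- The inner factor `e^{Ms}` and the outer factor `e^{-Ms}` cancel, so the Lipschitz constant does
-- not depend on `M`.
theorem lipschitzWith_superposition_weightedField (M : ℝ) {W : E → E}
    (hV : Continuous (weightedField M W)) {L : ℝ≥0} (hL : LipschitzWith L W) :
    LipschitzWith L (superposition (weightedField M W) hV) := by
  refine LipschitzWith.of_dist_le_mul fun b c => ?_
  rw [ContinuousMap.dist_le (by positivity)]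
  intro s
  change dist (weightedField M W (s, b s)) (weightedField M W (s, c s)) ≤ _
  simp only [weightedField]
  rw [dist_smul₀, Real.norm_of_nonneg (by positivity)]
  calc _ ≤ Real.exp (-(M * s)) * (L * dist (Real.exp (M * s) • b s) (Real.exp (M * s) • c s)) := by
        gcongr; exact hL.dist_le_mul _ _
    _ = L * dist (b s) (c s) * (Real.exp (-(M * s)) * Real.exp (M * s)) := by
        rw [dist_smul₀, Real.norm_of_nonneg (by positivity)]; ring
    _ = L * dist (b s) (c s) := by rw [← Real.exp_add]; simp
    _ ≤ L * dist b c := by gcongr; exact ContinuousMap.dist_apply_le_dist s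

open scoped NNReal in
-- The equation reads `b - K b = expCurve M hM x`, where `K` has Lipschitz constant at most `L / M <
-- 1`. Its solution is the smooth inverse of `id - K` applied to a curve depending linearly on `x`.
theorem exists_contDiff_eq_expCurve_add_volterra {W : E → E} (hW : ContDiff ℝ (⊤ : ℕ∞) W)
    {L : ℝ≥0} (hL : LipschitzWith L W) {M : ℝ} (hM : 0 < M) (hLM : L < M) :
    ∃ S : E → C(Icc (0 : ℝ) 1, E), ContDiff ℝ (⊤ : ℕ∞) S ∧ ∀ x, S x = expCurve M hM x +
      volterra M (superposition (weightedField M W) (contDiff_weightedField M hW).continuous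
        (S x)) := by
  have hV := contDiff_weightedField M hW
  have hK : ContDiff ℝ (⊤ : ℕ∞)
      (volterraL hM ∘ superposition (weightedField M W) hV.continuous) :=
    (volterraL (E := E) hM).contDiff.comp (contDiff_superposition hV)
  have hKL : LipschitzWith (‖volterraL (E := E) hM‖₊ * L)
      (volterraL hM ∘ superposition (weightedField M W) hV.continuous) :=
    (volterraL (E := E) hM).lipschitz.comp
      (lipschitzWith_superposition_weightedField M hV.continuous hL)
  have hlt : ‖volterraL (E := E) hM‖₊ * L < 1 := by
    have : ‖volterraL (E := E) hM‖ * L < 1 := by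
      calc _ ≤ M⁻¹ * L := by gcongr; exact norm_volterraL_le hM
        _ < 1 := by rw [inv_mul_lt_iff₀ hM]; linarith
    exact_mod_cast this
  obtain ⟨S, hS, hS'⟩ := exists_homeomorph_sub_contDiff hK hlt hKL
  refine ⟨S ∘ expCurve M hM, hS.comp (expCurve (E := E) M hM).contDiff, fun x => ?_⟩
  exact sub_eq_iff_eq_add.1 (hS' (expCurve M hM x))

theorem exp_smul_eq_integral {W : E → E} {M : ℝ} (hM : 0 < M)
    (hV : Continuous (weightedField M W)) {x : E} {b : C(Icc (0 : ℝ) 1, E)}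
    (hb : b = expCurve M hM x + volterra M (superposition (weightedField M W) hV b))
    (t : Icc (0 : ℝ) 1) :
    Real.exp (M * t) • b t = x + ∫ s in (0 : ℝ)..t,
      W (Real.exp (M * s) • b (projIcc 0 1 zero_le_one s)) := by
  have h1 := DFunLike.congr_fun hb t
  have h2 : volterra M (superposition (weightedField M W) hV b) t =
      Real.exp (-(M * t)) • ∫ s in (0 : ℝ)..t,
        W (Real.exp (M * s) • b (projIcc 0 1 zero_le_one s)) := by
    rw [volterra_apply]
    congr 1
    refine intervalIntegral.integral_congr fun s hs => ?_
    rw [uIcc_of_le t.2.1] at hs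
    have hs1 : s ∈ Icc (0 : ℝ) 1 := ⟨hs.1, hs.2.trans t.2.2⟩
    change Real.exp (M * s) • weightedField M W ((projIcc 0 1 zero_le_one s : Icc (0 : ℝ) 1),
      b (projIcc 0 1 zero_le_one s)) = _
    simp only [weightedField]
    rw [projIcc_of_mem _ hs1, smul_smul, ← Real.exp_add]
    simp
  rw [h1, ContinuousMap.add_apply, h2, expCurve_apply, ← smul_add, smul_smul, ← Real.exp_add]
  simp

open scoped NNReal in
/-- The time-one map of a smooth, globally Lipschitz vector field is smooth. -/
theorem exists_contDiff_timeOne {W : E → E} (hW : ContDiff ℝ (⊤ : ℕ∞) W) {L : ℝ≥0}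
    (hL : LipschitzWith L W) :
    ∃ Θ : E → E, ContDiff ℝ (⊤ : ℕ∞) Θ ∧ ∀ x, ∃ c : ℝ → E, c 0 = x ∧ c 1 = Θ x ∧
      ∀ t ∈ Icc (0 : ℝ) 1, HasDerivAt c (W (c t)) t := by
  obtain ⟨M, hM, hLM⟩ : ∃ M : ℝ, 0 < M ∧ L < M := ⟨L + 1, by positivity, by linarith⟩
  obtain ⟨S, hS, hS'⟩ := exists_contDiff_eq_expCurve_add_volterra hW hL hM hLM
  let one : Icc (0 : ℝ) 1 := ⟨1, by simp⟩
  refine ⟨fun x => Real.exp M • S x one, ?_, fun x => ?_⟩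
  · exact ContDiff.const_smul _ ((ContinuousLinearMap.contDiff (E := C(Icc (0 : ℝ) 1, E)) (F := E)
      (ContinuousMap.evalCLM ℝ one)).comp hS)
  have hbeq := exp_smul_eq_integral hM (contDiff_weightedField M hW).continuous (hS' x)
  -- Freezing the integrand outside `[0, 1]` by `projIcc` defines the curve on all of `ℝ`, so it has
  -- two-sided derivatives at the endpoints too.
  refine ⟨fun t => x + ∫ s in (0 : ℝ)..t,
      W (Real.exp (M * s) • S x (projIcc 0 1 zero_le_one s)), by simp, ?_, fun t ht => ?_⟩
  · have := hbeq one
    simp only [one, mul_one] at this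
    exact this.symm
  · have hWc : Continuous W := hW.continuous
    have hc : Continuous fun s : ℝ => W (Real.exp (M * s) • S x (projIcc 0 1 zero_le_one s)) := by
      fun_prop
    have h3 := (hc.integral_hasStrictDerivAt 0 t).hasDerivAt.const_add x
    have h4 := hbeq ⟨t, ht⟩
    rw [← projIcc_of_mem zero_le_one ht] at h4
    rw [projIcc_of_mem zero_le_one ht] at h4
    convert h3 using 2
    rw [projIcc_of_mem _ ht]
    exact h4.symm

end Nemytskii

end NuGraph

end

noncomputable section


namespace NuGraph

/-! ### The global flow of a smooth compactly supported field -/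

section Flow

open scoped NNReal

variable {E : Type} [NormedAddCommGroup E] [NormedSpace ℝ E] [CompleteSpace E]

/-- The time-`τ` map of `w` is the time-one map of `τ • w`. Adding `τ` to the state as a coordinate
with zero velocity makes the result jointly smooth, and the cut-off in `τ` keeps the enlarged field
compactly supported, hence globally Lipschitz. -/
theorem exists_contDiff_scaled_timeOne {w : E → E} (hw : ContDiff ℝ (⊤ : ℕ∞) w)
    (hwc : HasCompactSupport w) {R : ℝ} (hR : 0 < R) :
    ∃ φ : E × ℝ → E, ContDiff ℝ (⊤ : ℕ∞) φ ∧ ∀ x τ, |τ| ≤ R → ∃ c : ℝ → E, c 0 = x ∧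
      c 1 = φ (x, τ) ∧ ∀ t ∈ Icc (0 : ℝ) 1, HasDerivAt c (τ • w (c t)) t := by
  let χ : ContDiffBump (0 : ℝ) := ⟨R, R + 1, hR, by linarith⟩
  let W : E × ℝ → E × ℝ := fun p => ((χ p.2 * p.2) • w p.1, 0)
  have hW : ContDiff ℝ (⊤ : ℕ∞) W := by
    refine ContDiff.prodMk (ContDiff.smul ?_ (hw.comp contDiff_fst)) contDiff_const
    exact (χ.contDiff.comp contDiff_snd).mul contDiff_snd
  have hWc : HasCompactSupport W := by
    refine HasCompactSupport.intro (K := tsupport w ×ˢ tsupport χ)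
      (hwc.isCompact.prod χ.hasCompactSupport.isCompact) fun p hp => ?_
    rw [mem_prod, not_and_or] at hp
    rcases hp with hp | hp
    · simp [W, image_eq_zero_of_notMem_tsupport hp]
    · simp [W, image_eq_zero_of_notMem_tsupport hp]
  obtain ⟨L, hL⟩ := hW.lipschitzWith_of_hasCompactSupport hWc (by simp)
  obtain ⟨Θ, hΘ, hΘ'⟩ := exists_contDiff_timeOne hW hL
  refine ⟨fun p => (Θ p).1, contDiff_fst.comp hΘ, fun x τ hτ => ?_⟩
  obtain ⟨c, h0, h1, hc⟩ := hΘ' (x, τ)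
  have hc1 : ∀ t ∈ Icc (0 : ℝ) 1, HasDerivAt (fun t => (c t).1)
      ((χ (c t).2 * (c t).2) • w (c t).1) t := fun t ht => (hc t ht).fst
  have hc2 : ∀ t ∈ Icc (0 : ℝ) 1, HasDerivAt (fun t => (c t).2) 0 t := fun t ht => (hc t ht).snd
  have hconst : ∀ t ∈ Icc (0 : ℝ) 1, (c t).2 = τ := by
    intro t ht
    have := constant_of_has_deriv_right_zero (f := fun t => (c t).2) (a := 0) (b := 1)
      (fun s hs => (hc2 s hs).continuousAt.continuousWithinAt)
      (fun s hs => (hc2 s (Ico_subset_Icc_self hs)).hasDerivWithinAt) t ht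
    rw [this, h0]
  refine ⟨fun t => (c t).1, by simp [h0], by simp [h1], fun t ht => ?_⟩
  have := hc1 t ht
  rwa [hconst t ht, χ.one_of_mem_closedBall (by simpa using hτ), one_mul] at this

theorem exists_contDiff_flow_of_abs_lt {w : E → E} (hw : ContDiff ℝ (⊤ : ℕ∞) w)
    (hwc : HasCompactSupport w) {R : ℝ} (hR : 0 < R) :
    ∃ φ : E × ℝ → E, ContDiff ℝ (⊤ : ℕ∞) φ ∧ (∀ x, φ (x, 0) = x) ∧
      ∀ x t, |t| < R → HasDerivAt (fun t => φ (x, t)) (w (φ (x, t))) t := by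
  obtain ⟨φ, hφ, hφ'⟩ := exists_contDiff_scaled_timeOne hw hwc hR
  obtain ⟨L, hL⟩ := hw.lipschitzWith_of_hasCompactSupport hwc (by simp)
  have key : ∀ x τ, |τ| ≤ R → ∀ c : ℝ → E, c 0 = x →
      (∀ t ∈ Icc (0 : ℝ) 1, HasDerivAt c (τ • w (c t)) t) →
      ∀ s ∈ Icc (0 : ℝ) 1, c s = φ (x, τ * s) := by
    intro x τ hτ c hc0 hc s hs
    have hτs : |τ * s| ≤ R := by
      rw [abs_mul, abs_of_nonneg hs.1]
      exact (mul_le_of_le_one_right (abs_nonneg _) hs.2).trans hτ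
    obtain ⟨d, hd0, hd1, hd⟩ := hφ' x (τ * s) hτs
    have hc' : ∀ t ∈ Icc (0 : ℝ) 1, HasDerivAt (fun t => c (s * t)) ((τ * s) • w (c (s * t))) t := by
      intro t ht
      have h1 : HasDerivAt (fun t => c (s * t)) ((s * 1) • τ • w (c (s * t))) t :=
        (hc (s * t) ⟨mul_nonneg hs.1 ht.1, mul_le_one₀ hs.2 ht.1 ht.2⟩).scomp t
          ((hasDerivAt_id t).const_mul s)
      rwa [smul_smul, mul_one, mul_comm] at h1
    have hu := ODE_solution_unique (v := fun _ y => (τ * s) • w y) (K := ‖τ * s‖₊ * L)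
      (f := fun t => c (s * t)) (g := d) (a := 0) (b := 1)
      (fun _ => (lipschitzWith_smul (τ * s)).comp hL)
      (fun t ht => (hc' t ht).continuousAt.continuousWithinAt)
      (fun t ht => (hc' t (Ico_subset_Icc_self ht)).hasDerivWithinAt)
      (fun t ht => (hd t ht).continuousAt.continuousWithinAt)
      (fun t ht => (hd t (Ico_subset_Icc_self ht)).hasDerivWithinAt)
      (by simp [hc0, hd0]) (right_mem_Icc.2 zero_le_one)
    rw [← hd1, ← hu]
    simp only [mul_one]
  have h0 : ∀ x, φ (x, 0) = x := by
    intro x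
    obtain ⟨c, hc0, -, hc⟩ := hφ' x 0 (by simpa using hR.le)
    have := key x 0 (by simpa using hR.le) c hc0 hc 0 (by simp)
    rw [mul_zero] at this
    rw [← this, hc0]
  have hne : ∀ x t, |t| < R → t ≠ 0 →
      HasDerivAt (fun t => φ (x, t)) (w (φ (x, t))) t := by
    intro x t ht ht0
    -- With `τ = ±R` of the sign of `t`, the point `t / τ` is interior to `[0, 1]`, so the
    -- time-rescaled curve through `x` can be differentiated there.
    obtain ⟨τ, hτ, hτ0, hs⟩ : ∃ τ : ℝ, |τ| ≤ R ∧ τ ≠ 0 ∧ t / τ ∈ Ioo (0 : ℝ) 1 := by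
      rcases lt_or_gt_of_ne ht0 with h | h
      · refine ⟨-R, by simp [abs_of_pos hR], by simpa using hR.ne', ?_, ?_⟩
        · exact div_pos_of_neg_of_neg h (by linarith)
        · rw [div_neg, ← neg_div, div_lt_one hR]
          linarith [neg_abs_le t]
      · exact ⟨R, by simp [abs_of_pos hR], hR.ne', div_pos h hR,
          (div_lt_one hR).2 ((le_abs_self t).trans_lt ht)⟩
    obtain ⟨c, hc0, -, hc⟩ := hφ' x τ hτ
    have hk := key x τ hτ c hc0 hc
    have h1 : HasDerivAt (fun t' => c (t' / τ)) (w (c (t / τ))) t := by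
      have : HasDerivAt (fun t' => c (t' / τ)) ((1 / τ) • τ • w (c (t / τ))) t :=
        (hc (t / τ) (Ioo_subset_Icc_self hs)).scomp t ((hasDerivAt_id t).div_const τ)
      rwa [smul_smul, one_div, inv_mul_cancel₀ hτ0, one_smul] at this
    have h2 : (fun t' => φ (x, t')) =ᶠ[𝓝 t] fun t' => c (t' / τ) := by
      have : ∀ᶠ t' in 𝓝 t, t' / τ ∈ Ioo (0 : ℝ) 1 :=
        (continuous_id.div_const τ).continuousAt.eventually (isOpen_Ioo.mem_nhds hs)
      filter_upwards [this] with t' ht'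
      rw [hk _ (Ioo_subset_Icc_self ht'), mul_div_cancel₀ _ hτ0]
    have h3 := h1.congr_of_eventuallyEq h2
    rwa [← h2.eq_of_nhds] at h3
  refine ⟨φ, hφ, h0, fun x t ht => ?_⟩
  rcases eq_or_ne t 0 with rfl | ht0
  -- Time zero is always an endpoint of the rescaled curves. There the equation follows by
  -- continuity, `φ` being already known to be smooth.
  · have hf : ContDiff ℝ (⊤ : ℕ∞) fun t => φ (x, t) := hφ.comp (contDiff_const.prodMk contDiff_id)
    have hd : Continuous (deriv fun t => φ (x, t)) := hf.continuous_deriv (by simp)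
    have hwf : Continuous fun t => w (φ (x, t)) := hw.continuous.comp hf.continuous
    have he : (deriv fun t => φ (x, t)) =ᶠ[𝓝[≠] 0] fun t => w (φ (x, t)) := by
      have : ∀ᶠ t : ℝ in 𝓝[≠] 0, |t| < R := by
        exact nhdsWithin_le_nhds (continuous_abs.isOpen_preimage _ isOpen_Iio |>.mem_nhds
          (by simpa using hR))
      filter_upwards [this, self_mem_nhdsWithin] with t h1 h2
      exact (hne x t h1 h2).deriv
    have h1 : Tendsto (deriv fun t => φ (x, t)) (𝓝[≠] 0) (𝓝 ((deriv fun t => φ (x, t)) 0)) :=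
      hd.continuousAt.mono_left nhdsWithin_le_nhds
    have h2 : Tendsto (fun t => w (φ (x, t))) (𝓝[≠] 0) (𝓝 (w (φ (x, 0)))) :=
      hwf.continuousAt.mono_left nhdsWithin_le_nhds
    rw [← tendsto_nhds_unique (h1.congr' he) h2]
    exact (hf.differentiable (by simp) 0).hasDerivAt
  · exact hne x t ht ht0

/-- A smooth compactly supported vector field has a smooth global flow. -/
theorem exists_contDiff_flow {w : E → E} (hw : ContDiff ℝ (⊤ : ℕ∞) w)
    (hwc : HasCompactSupport w) :
    ∃ φ : E → ℝ → E, ContDiff ℝ (⊤ : ℕ∞) (Function.uncurry φ) ∧ (∀ x, φ x 0 = x) ∧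
      ∀ x t, HasDerivAt (φ x) (w (φ x t)) t := by
  have hN : ∀ N : ℕ, (0 : ℝ) < N + 1 := fun N => by positivity
  choose φ hφ h0 hφ' using fun N : ℕ => exists_contDiff_flow_of_abs_lt hw hwc (hN N)
  obtain ⟨L, hL⟩ := hw.lipschitzWith_of_hasCompactSupport hwc (by simp)
  have huniq : ∀ (N M : ℕ) (x : E) (t : ℝ), |t| < (N : ℝ) + 1 →
      |t| < (M : ℝ) + 1 → φ N (x, t) = φ M (x, t) := by
    intro N M x t h1 h2
    set R : ℝ := min (N + 1) (M + 1)
    have hR : 0 < R := lt_min (hN N) (hN M)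
    exact ODE_solution_unique_of_mem_Ioo (v := fun _ => w) (K := L) (s := fun _ => univ)
      (a := -R) (b := R) (t₀ := 0) (f := fun t => φ N (x, t)) (g := fun t => φ M (x, t))
      (fun _ _ => hL.lipschitzOnWith) ⟨by linarith, hR⟩
      (fun t ht => ⟨hφ' N x t ((abs_lt.2 ht).trans_le (min_le_left _ _)), mem_univ _⟩)
      (fun t ht => ⟨hφ' M x t ((abs_lt.2 ht).trans_le (min_le_right _ _)), mem_univ _⟩)
      (by simp [h0]) (abs_lt.1 (lt_min h1 h2))
  -- Near a time `t`, this agrees with the single local flow of index `⌈|t|⌉₊`, because local flows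
  -- coincide wherever both are defined.
  let ψ : E → ℝ → E := fun x t => φ ⌈|t|⌉₊ (x, t)
  have hψ : ∀ N : ℕ, ∀ x t, |t| < (N : ℝ) + 1 → ψ x t = φ N (x, t) := fun N x t ht =>
    huniq _ _ x t ((Nat.le_ceil _).trans_lt (lt_add_one _)) ht
  have hev : ∀ t : ℝ, ∀ᶠ t' in 𝓝 t, |t'| < (⌈|t|⌉₊ : ℝ) + 1 := fun t =>
    continuous_abs.continuousAt.eventually
      (Iio_mem_nhds ((Nat.le_ceil _).trans_lt (lt_add_one _)))
  refine ⟨ψ, ?_, fun x => ?_, fun x t => ?_⟩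
  · rw [contDiff_iff_contDiffAt]
    rintro ⟨x, t⟩
    refine (hφ ⌈|t|⌉₊).contDiffAt.congr_of_eventuallyEq ?_
    have : ∀ᶠ p : E × ℝ in 𝓝 (x, t), |p.2| < (⌈|t|⌉₊ : ℝ) + 1 :=
      continuous_snd.tendsto (x, t) |>.eventually (hev t)
    filter_upwards [this] with p hp
    exact hψ _ p.1 p.2 hp
  · simp [ψ, h0]
  · have h1 : ψ x =ᶠ[𝓝 t] fun t' => φ ⌈|t|⌉₊ (x, t') := by
      filter_upwards [hev t] with t' ht'
      exact hψ _ x t' ht'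
    exact (hφ' _ x t (hev t).self_of_nhds).congr_of_eventuallyEq h1

theorem flow_flow {w : E → E} {L : ℝ≥0} (hL : LipschitzWith L w) {φ : E → ℝ → E}
    (h0 : ∀ x, φ x 0 = x) (hφ : ∀ x t, HasDerivAt (φ x) (w (φ x t)) t) (x : E) (s t : ℝ) :
    φ (φ x s) t = φ x (s + t) := by
  have := ODE_solution_unique_univ (v := fun _ => w) (K := L) (s := fun _ => univ) (t₀ := 0)
    (f := φ (φ x s)) (g := fun t => φ x (s + t)) (fun _ => hL.lipschitzOnWith)
    (fun t => ⟨hφ _ t, mem_univ _⟩) (fun t => ⟨(hφ x (s + t)).comp_const_add s t, mem_univ _⟩)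
    (by simp [h0])
  exact congrFun this t

end Flow

end NuGraph

end

noncomputable section


namespace NuGraph

/-! ### Separation of space by a hypersurface -/

section Region

variable {n : ℕ} {Γ Ω : Set (EuclideanSpace ℝ (Fin n))}

namespace IsRegionOf

theorem disjoint (h : IsRegionOf Γ Ω) : Disjoint Ω Γ := by
  rw [disjoint_iff_inter_eq_empty, ← h.frontier_eq, h.isOpen.inter_frontier_eq]

theorem boundary_subset (h : IsRegionOf Γ Ω) : Γ ⊆ closure Ω := by
  rw [← h.frontier_eq]; exact frontier_subset_closure

theorem mem_or (h : IsRegionOf Γ Ω) (x : EuclideanSpace ℝ (Fin n)) :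
    x ∈ Ω ∨ x ∈ Γ ∨ x ∉ closure Ω := by
  by_cases hx : x ∈ closure Ω
  · rw [closure_eq_self_union_frontier, h.frontier_eq] at hx
    exact hx.imp_right Or.inl
  · exact Or.inr (Or.inr hx)

/-- The region and its exterior are disjoint open sets that cover the complement of `Γ`. -/
theorem subset_or_subset (h : IsRegionOf Γ Ω) {S : Set (EuclideanSpace ℝ (Fin n))}
    (hS : IsPreconnected S) (hSΓ : ∀ x ∈ S, x ∉ Γ) : S ⊆ Ω ∨ S ⊆ (closure Ω)ᶜ := by
  refine IsPreconnected.subset_or_subset h.isOpen isClosed_closure.isOpen_compl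
    (disjoint_compl_right.mono_left subset_closure) (fun x hx => ?_) hS
  rcases h.mem_or x with hx' | hx' | hx'
  · exact Or.inl hx'
  · exact absurd hx' (hSΓ x hx)
  · exact Or.inr hx'

/-- A curve from the region to its exterior meets the boundary. -/
theorem exists_mem_of_curve (h : IsRegionOf Γ Ω) {c : ℝ → EuclideanSpace ℝ (Fin n)}
    (hc : Continuous c) {a b : ℝ} (ha : c a ∈ Ω) (hb : c b ∉ closure Ω) (hab : a ≤ b) :
    ∃ t ∈ Icc a b, c t ∈ Γ := by
  by_contra! hcon
  have hS : IsPreconnected (c '' Icc a b) := isPreconnected_Icc.image _ hc.continuousOn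
  rcases h.subset_or_subset hS (by rintro _ ⟨t, ht, rfl⟩; exact hcon t ht) with h1 | h1
  · exact hb (subset_closure (h1 (mem_image_of_mem c (right_mem_Icc.2 hab))))
  · exact h1 (mem_image_of_mem c (left_mem_Icc.2 hab)) (subset_closure ha)

/-- A curve that crosses the boundary only from the region to its exterior crosses it at most
once. -/
theorem eq_of_crossing (h : IsRegionOf Γ Ω) {c : ℝ → EuclideanSpace ℝ (Fin n)}
    (hc : Continuous c)
    (hcross : ∀ t, c t ∈ Γ → (∀ᶠ s in 𝓝[<] t, c s ∈ Ω) ∧ ∀ᶠ s in 𝓝[>] t, c s ∉ closure Ω)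
    {t₁ t₂ : ℝ} (h₁ : c t₁ ∈ Γ) (h₂ : c t₂ ∈ Γ) : t₁ = t₂ := by
  by_contra hne
  wlog hlt : t₁ < t₂ generalizing t₁ t₂
  · exact this h₂ h₁ (Ne.symm hne) (lt_of_le_of_ne (not_lt.1 hlt) (Ne.symm hne))
  have hcl : IsClosed Γ := by rw [← h.frontier_eq]; exact isClosed_frontier
  obtain ⟨u, hu, hu'⟩ := mem_nhdsGT_iff_exists_Ioo_subset.1 (hcross t₁ h₁).2
  have hu1 : t₁ < u := hu
  obtain ⟨m, hm1, hm2⟩ := exists_between (lt_min hu1 hlt)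
  have hm : c m ∉ closure Ω := hu' ⟨hm1, hm2.trans_le (min_le_left _ _)⟩
  have hmt : m < t₂ := hm2.trans_le (min_le_right _ _)
  -- Take the first meeting time `s` after the exterior time `m`. Just before `s` the curve is in
  -- the region, yet it has not met `Γ` since `m`: a contradiction.
  have hK : IsCompact (Icc m t₂ ∩ c ⁻¹' Γ) := isCompact_Icc.inter_right (hcl.preimage hc)
  obtain ⟨s, ⟨⟨hs1, hs2⟩, hsΓ⟩, hmin⟩ := hK.exists_isLeast ⟨t₂, ⟨hmt.le, le_rfl⟩, h₂⟩
  have hms : m < s := by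
    refine lt_of_le_of_ne hs1 fun he => hm ?_
    rw [he]; exact h.boundary_subset hsΓ
  obtain ⟨l, hl, hl'⟩ := mem_nhdsLT_iff_exists_Ioo_subset.1 (hcross s hsΓ).1
  have hl1 : l < s := hl
  obtain ⟨p, hp1, hp2⟩ := exists_between (max_lt hl1 hms)
  have hp : c p ∈ Ω := hl' ⟨(le_max_left _ _).trans_lt hp1, hp2⟩
  have hmp : m < p := (le_max_right _ _).trans_lt hp1
  have hS : IsPreconnected (c '' Icc m p) := isPreconnected_Icc.image _ hc.continuousOn
  rcases h.subset_or_subset hS (by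
    rintro _ ⟨t, ht, rfl⟩ htΓ
    have := hmin ⟨⟨ht.1, ht.2.trans (hp2.le.trans hs2)⟩, htΓ⟩
    linarith [ht.2]) with h3 | h3
  · exact hm (subset_closure (h3 (mem_image_of_mem c (left_mem_Icc.2 hmp.le))))
  · exact h3 (mem_image_of_mem c (right_mem_Icc.2 hmp.le)) (subset_closure hp)

end IsRegionOf

theorem isRegionOf_region {k : ℕ} {α : ℝ} (h : Γ ∈ hypersurfaces n k α) :
    IsRegionOf Γ (region Γ) :=
  Classical.epsilon_spec h.2.2.2

end Region

theorem eventually_sign_of_hasDerivAt {f : ℝ → ℝ} {f' x : ℝ} (hf : HasDerivAt f f' x)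
    (hx : f x = 0) (hf' : 0 < f') :
    (∀ᶠ t in 𝓝[<] x, f t < 0) ∧ ∀ᶠ t in 𝓝[>] x, 0 < f t := by
  have h := (hasDerivAt_iff_tendsto_slope.1 hf).eventually (lt_mem_nhds hf')
  constructor
  · filter_upwards [nhdsLT_le_nhdsNE x h, self_mem_nhdsWithin] with t ht htx
    rw [slope_def_field, hx, sub_zero] at ht
    have hneg : t - x < 0 := sub_neg.2 htx
    by_contra! hc
    exact absurd ht (not_lt.2 (div_nonpos_of_nonneg_of_nonpos hc hneg.le))
  · filter_upwards [nhdsGT_le_nhdsNE x h, self_mem_nhdsWithin] with t ht htx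
    rw [slope_def_field, hx, sub_zero] at ht
    have hpos : 0 < t - x := sub_pos.2 htx
    by_contra! hc
    exact absurd ht (not_lt.2 (div_nonpos_of_nonpos_of_nonneg hc hpos.le))

/-! ### Local defining functions from graph charts -/

section DefiningFunction

variable {n : ℕ}

/-- On the open set `U`, the function `G` defines the hypersurface `Γ`, the region `Ω` and its
exterior by its sign, and has no critical points. -/
structure IsDefiningFunction (k : ℕ) (α : ℝ) (Γ Ω : Set (EuclideanSpace ℝ (Fin n)))
    (G : EuclideanSpace ℝ (Fin n) → ℝ) (U : Set (EuclideanSpace ℝ (Fin n))) : Prop where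
  isOpen : IsOpen U
  locLittleHolder : LocLittleHolder α k G U
  mem_iff : ∀ z ∈ U, z ∈ Γ ↔ G z = 0
  mem_region : ∀ z ∈ U, G z < 0 → z ∈ Ω
  notMem_closure : ∀ z ∈ U, 0 < G z → z ∉ closure Ω
  fderiv_ne_zero : ∀ z ∈ U, fderiv ℝ G z ≠ 0
  exists_curve : ∀ z ∈ U, z ∈ Γ → ∀ τ, fderiv ℝ G z τ = 0 →
    ∃ c : ℝ → EuclideanSpace ℝ (Fin n), c 0 = z ∧ HasDerivAt c τ 0 ∧ ∀ᶠ t in 𝓝 0, c t ∈ Γ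
  isPreconnected : IsPreconnected (Γ ∩ U)

section Chart

variable (e : EuclideanSpace ℝ (Fin n))

/-- The orthogonal projection to the hyperplane `e^⊥`. -/
abbrev hyperplaneProj : EuclideanSpace ℝ (Fin n) →L[ℝ] (Submodule.span ℝ {e})ᗮ :=
  (Submodule.span ℝ {e})ᗮ.orthogonalProjectionOnto

/-- The height over the hyperplane `e^⊥`. -/
abbrev height : EuclideanSpace ℝ (Fin n) →L[ℝ] ℝ := innerSL ℝ e

variable {e}

theorem hyperplaneProj_add_height_smul (he : ‖e‖ = 1) (z : EuclideanSpace ℝ (Fin n)) :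
    (hyperplaneProj e z : EuclideanSpace ℝ (Fin n)) + height e z • e = z := by
  have h1 : (hyperplaneProj e z : EuclideanSpace ℝ (Fin n)) =
      (Submodule.span ℝ {e})ᗮ.starProjection z := rfl
  rw [h1, Submodule.starProjection_orthogonal]
  simp [Submodule.starProjection_unit_singleton ℝ he]

theorem inner_coe_orthogonal (u : (Submodule.span ℝ {e})ᗮ) :
    inner ℝ e (u : EuclideanSpace ℝ (Fin n)) = 0 :=
  Submodule.mem_orthogonal_singleton_iff_inner_right.1 u.2

theorem height_add_smul (he : ‖e‖ = 1) (u : (Submodule.span ℝ {e})ᗮ) (t : ℝ) :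
    height e ((u : EuclideanSpace ℝ (Fin n)) + t • e) = t := by
  simp [inner_add_right, inner_coe_orthogonal, inner_smul_right, he]

theorem hyperplaneProj_add_smul (u : (Submodule.span ℝ {e})ᗮ) (t : ℝ) :
    hyperplaneProj e ((u : EuclideanSpace ℝ (Fin n)) + t • e) = u := by
  rw [map_add, map_smul, Submodule.orthogonalProjectionOnto_orthogonalComplement_singleton_eq_zero,
    smul_zero, add_zero, Submodule.orthogonalProjectionOnto_mem_subspace_eq_self]

end Chart

theorem isPreconnected_image_between {e : EuclideanSpace ℝ (Fin n)}
    {B : Set (Submodule.span ℝ {e})ᗮ} (hB : IsPreconnected B) {p q : (Submodule.span ℝ {e})ᗮ → ℝ}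
    (hp : ContinuousOn p B) (hq : ContinuousOn q B) :
    IsPreconnected ((fun x : (Submodule.span ℝ {e})ᗮ × ℝ =>
      (x.1 : EuclideanSpace ℝ (Fin n)) + (p x.1 + x.2 * (q x.1 - p x.1)) • e) ''
        (B ×ˢ Ioo (0 : ℝ) 1)) := by
  refine (hB.prod isPreconnected_Ioo).image _ ?_
  have h1 : ContinuousOn (fun x : (Submodule.span ℝ {e})ᗮ × ℝ => p x.1) (B ×ˢ Ioo (0 : ℝ) 1) :=
    hp.comp continuousOn_fst fun x hx => hx.1
  have h2 : ContinuousOn (fun x : (Submodule.span ℝ {e})ᗮ × ℝ => q x.1) (B ×ˢ Ioo (0 : ℝ) 1) :=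
    hq.comp continuousOn_fst fun x hx => hx.1
  have h3 : Continuous fun x : (Submodule.span ℝ {e})ᗮ × ℝ => (x.1 : EuclideanSpace ℝ (Fin n)) :=
    continuous_subtype_val.comp continuous_fst
  exact h3.continuousOn.add ((h1.add (continuousOn_snd.mul (h2.sub h1))).smul continuousOn_const)

theorem mem_image_between {e z : EuclideanSpace ℝ (Fin n)} (he : ‖e‖ = 1)
    {B : Set (Submodule.span ℝ {e})ᗮ} {p q : (Submodule.span ℝ {e})ᗮ → ℝ} :
    z ∈ ((fun x : (Submodule.span ℝ {e})ᗮ × ℝ =>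
      (x.1 : EuclideanSpace ℝ (Fin n)) + (p x.1 + x.2 * (q x.1 - p x.1)) • e) ''
        (B ×ˢ Ioo (0 : ℝ) 1)) ↔
    hyperplaneProj e z ∈ B ∧ ∃ s ∈ Ioo (0 : ℝ) 1, height e z =
      p (hyperplaneProj e z) + s * (q (hyperplaneProj e z) - p (hyperplaneProj e z)) := by
  constructor
  · rintro ⟨⟨u, s⟩, ⟨hu, hs⟩, rfl⟩
    simp only [hyperplaneProj_add_smul, height_add_smul he]
    exact ⟨hu, s, hs, rfl⟩
  · rintro ⟨hu, s, hs, h⟩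
    refine ⟨(hyperplaneProj e z, s), ⟨hu, hs⟩, ?_⟩
    simp only
    rw [← h, hyperplaneProj_add_height_smul he]

/-- Up to sign, `G` is the height minus the graph function. The parts of the cylinder below and
above the graph are connected and avoid `Γ`, so each lies in `Ω` or in its exterior. They lie on
different sides, and this fixes the sign. -/
theorem exists_isDefiningFunction {k : ℕ} {α : ℝ} (hα : α ∈ Ioo (0 : ℝ) 1) (hk : 1 ≤ k)
    {Γ Ω : Set (EuclideanSpace ℝ (Fin n))} (hΓ : IsHypersurface k α Γ) (hΩ : IsRegionOf Γ Ω)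
    {y : EuclideanSpace ℝ (Fin n)} (hy : y ∈ Γ) :
    ∃ G U, IsDefiningFunction k α Γ Ω G U ∧ y ∈ U := by
  obtain ⟨e, O, a, b, g, hg, u₀, hu₀, rfl⟩ := hΓ y hy
  have he := hg.norm_eq
  obtain ⟨κ, hκ, hκO⟩ := Metric.isOpen_iff.1 hg.isOpen u₀ hu₀
  set B := Metric.ball u₀ κ with hB
  have hgB : LocLittleHolder α k g B := (hg.littleHolder.locLittleHolder hg.isOpen).mono hκO
  have hgc : ContinuousOn g B := hgB.continuousOn hα.1
  have hBc : IsPreconnected B := (convex_ball u₀ κ).isPreconnected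
  have hgd : ∀ u ∈ B, DifferentiableAt ℝ g u := by
    obtain ⟨m, rfl⟩ : ∃ m, k = m + 1 := ⟨k - 1, by omega⟩
    exact hgB.1
  set U : Set (EuclideanSpace ℝ (Fin n)) :=
    hyperplaneProj e ⁻¹' B ∩ height e ⁻¹' Ioo a b with hU
  have hUo : IsOpen U :=
    (Metric.isOpen_ball.preimage (hyperplaneProj e).continuous).inter
      (isOpen_Ioo.preimage (height e).continuous)
  let G₀ : EuclideanSpace ℝ (Fin n) → ℝ := fun z => height e z - g (hyperplaneProj e z)
  have hG₀ : LocLittleHolder α k G₀ U := by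
    have h1 : LocLittleHolder α k (fun z => g (hyperplaneProj e z)) U :=
      LocLittleHolder.comp_of_pos hα hk hUo Metric.isOpen_ball hgB
        (LocLittleHolder.of_contDiff hα.2 k hUo (hyperplaneProj e).contDiff) fun z hz => hz.1
    have h2 := LocLittleHolder.add hα.1 hUo
      (LocLittleHolder.of_contDiff hα.2 k hUo (height e).contDiff)
      (h1.clm_comp hα.1 (-ContinuousLinearMap.id ℝ ℝ) hUo)
    exact h2.congr hUo fun z _ => by simp [G₀, sub_eq_add_neg]
  have hmem : ∀ z ∈ U, z ∈ Γ ↔ G₀ z = 0 := by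
    intro z hz
    have := hg.graph _ (hκO hz.1) _ hz.2
    rw [hyperplaneProj_add_height_smul he] at this
    rw [this, sub_eq_zero]
  have hu₀B : u₀ ∈ B := Metric.mem_ball_self hκ
  have hyU : (u₀ : EuclideanSpace ℝ (Fin n)) + g u₀ • e ∈ U := by
    refine ⟨?_, ?_⟩
    · rw [mem_preimage, hyperplaneProj_add_smul]; exact hu₀B
    · rw [mem_preimage, height_add_smul he]; exact hg.mapsTo hu₀
  have hminus : ∀ z ∈ U, G₀ z < 0 → z ∈ ((fun x : (Submodule.span ℝ {e})ᗮ × ℝ =>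
      (x.1 : EuclideanSpace ℝ (Fin n)) + (a + x.2 * (g x.1 - a)) • e) ''
        (B ×ˢ Ioo (0 : ℝ) 1)) := by
    intro z hz hz0
    rw [mem_image_between (p := fun _ => a) (q := g) he]
    have h1 : height e z < g (hyperplaneProj e z) := sub_neg.1 hz0
    have h2 : a < height e z := hz.2.1
    refine ⟨hz.1, (height e z - a) / (g (hyperplaneProj e z) - a), ⟨?_, ?_⟩, ?_⟩
    · exact div_pos (by linarith) (by linarith)
    · rw [div_lt_one (by linarith)]; linarith
    · rw [div_mul_cancel₀ _ (by linarith : g (hyperplaneProj e z) - a ≠ 0)]; ring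
  have hplus : ∀ z ∈ U, 0 < G₀ z → z ∈ ((fun x : (Submodule.span ℝ {e})ᗮ × ℝ =>
      (x.1 : EuclideanSpace ℝ (Fin n)) + (g x.1 + x.2 * (b - g x.1)) • e) ''
        (B ×ˢ Ioo (0 : ℝ) 1)) := by
    intro z hz hz0
    rw [mem_image_between (p := g) (q := fun _ => b) he]
    have h1 : g (hyperplaneProj e z) < height e z := sub_pos.1 hz0
    have h2 : height e z < b := hz.2.2
    refine ⟨hz.1, (height e z - g (hyperplaneProj e z)) / (b - g (hyperplaneProj e z)),
      ⟨?_, ?_⟩, ?_⟩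
    · exact div_pos (by linarith) (by linarith)
    · rw [div_lt_one (by linarith)]; linarith
    · rw [div_mul_cancel₀ _ (by linarith : b - g (hyperplaneProj e z) ≠ 0)]; ring
  have hcm := hΩ.subset_or_subset
    (isPreconnected_image_between (p := fun _ => a) (q := g) hBc continuousOn_const hgc) (by
      rintro _ ⟨⟨u, s⟩, ⟨hu, hs0, hs1⟩, rfl⟩
      have hgu := hg.mapsTo (hκO hu)
      rw [hg.graph u (hκO hu) _ ⟨by nlinarith [hgu.1], by nlinarith [hgu.1, hgu.2]⟩]
      nlinarith [hgu.1])
  have hcp := hΩ.subset_or_subset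
    (isPreconnected_image_between (p := g) (q := fun _ => b) hBc hgc continuousOn_const) (by
      rintro _ ⟨⟨u, s⟩, ⟨hu, hs0, hs1⟩, rfl⟩
      have hgu := hg.mapsTo (hκO hu)
      rw [hg.graph u (hκO hu) _ ⟨by nlinarith [hgu.2, hgu.1], by nlinarith [hgu.2]⟩]
      nlinarith [hgu.2])
  have hpre : IsPreconnected (Γ ∩ U) := by
    have : Γ ∩ U = (fun u : (Submodule.span ℝ {e})ᗮ =>
        (u : EuclideanSpace ℝ (Fin n)) + g u • e) '' B := by
      ext z
      constructor
      · rintro ⟨hz, hzU⟩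
        refine ⟨hyperplaneProj e z, hzU.1, ?_⟩
        simp only
        rw [← sub_eq_zero.1 ((hmem z hzU).1 hz), hyperplaneProj_add_height_smul he]
      · rintro ⟨u, hu, rfl⟩
        refine ⟨(hg.graph u (hκO hu) _ (hg.mapsTo (hκO hu))).2 rfl, ?_, ?_⟩
        · rw [mem_preimage, hyperplaneProj_add_smul]; exact hu
        · rw [mem_preimage, height_add_smul he]; exact hg.mapsTo (hκO hu)
    rw [this]
    refine hBc.image _ (ContinuousOn.add (by fun_prop) (hgc.smul continuousOn_const))
  obtain ⟨σ, hσ, hin, hout⟩ : ∃ σ : ℝ, σ ≠ 0 ∧ (∀ z ∈ U, σ * G₀ z < 0 → z ∈ Ω) ∧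
      ∀ z ∈ U, 0 < σ * G₀ z → z ∉ closure Ω := by
    rcases hcm with hcm | hcm <;> rcases hcp with hcp | hcp
    -- If both parts were in `Ω`, the point `y` would be interior to `closure Ω`, hence in `Ω` by
    -- `regular`.
    · exfalso
      have hsub : U ⊆ closure Ω := by
        intro z hz
        rcases lt_trichotomy (G₀ z) 0 with h | h | h
        · exact subset_closure (hcm (hminus z hz h))
        · exact hΩ.boundary_subset ((hmem z hz).2 h)
        · exact subset_closure (hcp (hplus z hz h))
      have := interior_maximal hsub hUo hyU
      rw [hΩ.regular] at this
      exact disjoint_left.1 hΩ.disjoint this hy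
    · exact ⟨1, one_ne_zero, fun z hz h => hcm (hminus z hz (by linarith)),
        fun z hz h => hcp (hplus z hz (by linarith))⟩
    · exact ⟨-1, by norm_num, fun z hz h => hcp (hplus z hz (by linarith)),
        fun z hz h => hcm (hminus z hz (by linarith))⟩
    -- If both parts were exterior, `Ω` would have no points in `U`, although `y` belongs to its
    -- closure.
    · exfalso
      obtain ⟨z, hzU, hzΩ⟩ := mem_closure_iff.1 (hΩ.boundary_subset hy) U hUo hyU
      rcases lt_trichotomy (G₀ z) 0 with h | h | h
      · exact hcm (hminus z hzU h) (subset_closure hzΩ)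
      · exact disjoint_left.1 hΩ.disjoint hzΩ ((hmem z hzU).2 h)
      · exact hcp (hplus z hzU h) (subset_closure hzΩ)
  have hd : ∀ z ∈ U, HasFDerivAt (fun z => σ * G₀ z) (σ • (height e -
      (fderiv ℝ g (hyperplaneProj e z)).comp (hyperplaneProj e))) z := fun z hz =>
    ((height e).hasFDerivAt.sub
      ((hgd _ hz.1).hasFDerivAt.comp z (hyperplaneProj e).hasFDerivAt)).const_mul σ
  refine ⟨fun z => σ * G₀ z, U, ⟨hUo, ?_, fun z hz => ?_, hin, hout, fun z hz h0 => ?_,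
    fun z hz hzΓ τ hτ => ?_, hpre⟩, hyU⟩
  · exact hG₀.clm_comp hα.1 (σ • ContinuousLinearMap.id ℝ ℝ) hUo
  · rw [hmem z hz, mul_eq_zero, or_iff_right hσ]
  · have h1 := DFunLike.congr_fun h0 e
    rw [(hd z hz).fderiv] at h1
    have hPe : hyperplaneProj e e = 0 :=
      Submodule.orthogonalProjectionOnto_orthogonalComplement_singleton_eq_zero e
    simp [hPe, he, hσ] at h1
  -- The curve is the lift to the graph of the straight line through `u` in the direction of the
  -- projection of `τ`.
  · set u := hyperplaneProj e z with hu
    have hz1 : (u : EuclideanSpace ℝ (Fin n)) + g u • e = z := by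
      rw [← sub_eq_zero.1 ((hmem z hz).1 hzΓ), hyperplaneProj_add_height_smul he]
    have hτ' : height e τ = fderiv ℝ g u (hyperplaneProj e τ) := by
      rw [(hd z hz).fderiv] at hτ
      simpa [hσ, sub_eq_zero] using hτ
    have hγ : HasDerivAt (fun t : ℝ => u + t • hyperplaneProj e τ) (hyperplaneProj e τ) 0 := by
      simpa using ((hasDerivAt_id (0 : ℝ)).smul_const (hyperplaneProj e τ)).const_add u
    have hu0 : u + (0 : ℝ) • hyperplaneProj e τ = u := by simp
    refine ⟨fun t => ((u + t • hyperplaneProj e τ : (Submodule.span ℝ {e})ᗮ) :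
      EuclideanSpace ℝ (Fin n)) + g (u + t • hyperplaneProj e τ) • e, ?_, ?_, ?_⟩
    · simp only [hu0]; exact hz1
    · have h1 : HasDerivAt (fun t : ℝ => g (u + t • hyperplaneProj e τ))
          (fderiv ℝ g u (hyperplaneProj e τ)) 0 := by
        have hgu : HasFDerivAt g (fderiv ℝ g u) (u + (0 : ℝ) • hyperplaneProj e τ) := by
          rw [hu0]; exact (hgd u hz.1).hasFDerivAt
        exact hgu.comp_hasDerivAt (0 : ℝ) hγ
      have h2 := ((Submodule.subtypeL (Submodule.span ℝ {e})ᗮ).hasFDerivAt.comp_hasDerivAt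
        (0 : ℝ) hγ).add (h1.smul_const e)
      have h3 : (Submodule.span ℝ {e})ᗮ.subtypeL (hyperplaneProj e τ) +
          fderiv ℝ g u (hyperplaneProj e τ) • e = τ := by
        rw [← hτ']
        exact hyperplaneProj_add_height_smul he τ
      rw [h3] at h2
      exact h2
    · have h1 : ∀ᶠ t in 𝓝 (0 : ℝ), u + t • hyperplaneProj e τ ∈ B := by
        refine hγ.continuousAt.eventually (Metric.isOpen_ball.mem_nhds ?_)
        simp only [hu0]; exact hz.1
      filter_upwards [h1] with t ht
      exact (hg.graph _ (hκO ht) _ (hg.mapsTo (hκO ht))).2 rfl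

end DefiningFunction

end NuGraph

end

noncomputable section


namespace NuGraph

/-! ### The outward unit normal, and its bounds for class `C²` -/

section Normal

variable {n k : ℕ} {α : ℝ} {Γ : Set (EuclideanSpace ℝ (Fin n))}

theorem inner_gradient {G : EuclideanSpace ℝ (Fin n) → ℝ} (z v : EuclideanSpace ℝ (Fin n)) :
    inner ℝ (gradient G z) v = fderiv ℝ G z v := by
  rw [gradient, InnerProductSpace.toDual_symm_apply]

theorem gradient_ne_zero {G : EuclideanSpace ℝ (Fin n) → ℝ} {z : EuclideanSpace ℝ (Fin n)}
    (h : fderiv ℝ G z ≠ 0) : gradient G z ≠ 0 := by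
  rw [gradient, Ne, map_eq_zero_iff _ (LinearIsometryEquiv.injective _)]
  exact h

namespace IsDefiningFunction

variable {Ω U : Set (EuclideanSpace ℝ (Fin n))} {G : EuclideanSpace ℝ (Fin n) → ℝ}

theorem differentiableAt (h : IsDefiningFunction k α Γ Ω G U) (hk : 1 ≤ k)
    {z : EuclideanSpace ℝ (Fin n)} (hz : z ∈ U) : DifferentiableAt ℝ G z := by
  obtain ⟨m, rfl⟩ : ∃ m, k = m + 1 := ⟨k - 1, by omega⟩
  exact h.locLittleHolder.1 z hz

/-- A curve whose velocity points to the side where the defining function is positive crosses the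
hypersurface from the region to its exterior. -/
theorem eventually_crossing (h : IsDefiningFunction k α Γ Ω G U) (hk : 1 ≤ k)
    {c : ℝ → EuclideanSpace ℝ (Fin n)} {w : EuclideanSpace ℝ (Fin n)} {t : ℝ}
    (hc : HasDerivAt c w t) (hU : c t ∈ U) (hΓ : c t ∈ Γ) (hw : 0 < fderiv ℝ G (c t) w) :
    (∀ᶠ s in 𝓝[<] t, c s ∈ Ω) ∧ ∀ᶠ s in 𝓝[>] t, c s ∉ closure Ω := by
  have h1 : HasDerivAt (fun s => G (c s)) (fderiv ℝ G (c t) w) t :=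
    (h.differentiableAt hk hU).hasFDerivAt.comp_hasDerivAt t hc
  obtain ⟨h2, h3⟩ := eventually_sign_of_hasDerivAt h1 ((h.mem_iff _ hU).1 hΓ) hw
  have h4 : ∀ᶠ s in 𝓝 t, c s ∈ U := hc.continuousAt.eventually (h.isOpen.mem_nhds hU)
  constructor
  · filter_upwards [h2, nhdsWithin_le_nhds h4] with s hs hsU
    exact h.mem_region _ hsU hs
  · filter_upwards [h3, nhdsWithin_le_nhds h4] with s hs hsU
    exact h.notMem_closure _ hsU hs

/-- Kernel vectors are velocities of curves in `Γ`. Conversely, `fderiv ℝ G z` sends the tangent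
cone of `Γ` into that of the singleton `{0}`, which is trivial. -/
theorem fderiv_eq_zero_iff (h : IsDefiningFunction k α Γ Ω G U) (hk : 1 ≤ k)
    {z : EuclideanSpace ℝ (Fin n)} (hz : z ∈ U) (hzΓ : z ∈ Γ) {τ : EuclideanSpace ℝ (Fin n)} :
    fderiv ℝ G z τ = 0 ↔ τ ∈ tangentConeAt ℝ Γ z := by
  constructor
  · intro hτ
    obtain ⟨c, hc0, hc, hcΓ⟩ := h.exists_curve z hz hzΓ τ hτ
    have h1 := (hc.hasFDerivAt.hasFDerivWithinAt (s := {t | c t ∈ Γ})).mapsTo_tangent_cone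
    rw [tangentConeAt_of_mem_nhds hcΓ, hc0] at h1
    have h2 := h1 (mem_univ (1 : ℝ))
    simp only [ContinuousLinearMap.toSpanSingleton_apply, one_smul] at h2
    refine tangentConeAt_mono ?_ h2
    rintro _ ⟨t, ht, rfl⟩
    exact ht
  · intro hτ
    rw [← tangentConeAt_inter_nhds (h.isOpen.mem_nhds hz)] at hτ
    have h1 := ((h.differentiableAt hk hz).hasFDerivAt.hasFDerivWithinAt
      (s := Γ ∩ U)).mapsTo_tangent_cone hτ
    have h2 : G '' (Γ ∩ U) ⊆ {0} := by
      rintro _ ⟨x, hx, rfl⟩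
      exact (h.mem_iff x hx.2).1 hx.1
    have h3 := tangentConeAt_mono h2 h1
    have h4 : ¬AccPt (G z) (𝓟 ({0} : Set ℝ)) := fun hacc => by
      obtain ⟨y, hy1, hy2⟩ := (accPt_iff_frequently.1 hacc).exists
      exact hy1 (hy2.trans ((h.mem_iff z hz).1 hzΓ).symm)
    exact tangentConeAt_subset_zero h4 h3

theorem eventually_normalCurve (h : IsDefiningFunction k α Γ Ω G U) (hk : 1 ≤ k)
    {z : EuclideanSpace ℝ (Fin n)} (hz : z ∈ U) (hzΓ : z ∈ Γ) {v : EuclideanSpace ℝ (Fin n)}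
    (hv : 0 < fderiv ℝ G z v) :
    ∀ᶠ t in 𝓝[>] (0 : ℝ), z - t • v ∈ Ω ∧ z + t • v ∉ closure Ω := by
  have h1 : HasDerivAt (fun t : ℝ => z + t • v) v 0 := by
    simpa using ((hasDerivAt_id (0 : ℝ)).smul_const v).const_add z
  obtain ⟨h2, h3⟩ := h.eventually_crossing hk h1 (by simpa using hz) (by simpa using hzΓ)
    (by simpa using hv)
  have h4 : Tendsto (fun t : ℝ => -t) (𝓝[>] 0) (𝓝[<] 0) := by
    simpa using tendsto_neg_nhdsGT (a := (0 : ℝ))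
  filter_upwards [h4.eventually h2, h3] with t ht1 ht2
  refine ⟨?_, ht2⟩
  rwa [neg_smul, ← sub_eq_add_neg] at ht1

theorem isOutwardUnitNormal_gradient (h : IsDefiningFunction k α Γ (region Γ) G U) (hk : 1 ≤ k)
    {z : EuclideanSpace ℝ (Fin n)} (hz : z ∈ U) (hzΓ : z ∈ Γ) :
    IsOutwardUnitNormal Γ z (‖gradient G z‖⁻¹ • gradient G z) := by
  have h0 : 0 < ‖gradient G z‖ := norm_pos_iff.2 (gradient_ne_zero (h.fderiv_ne_zero z hz))
  refine ⟨?_, fun τ hτ => ?_, h.eventually_normalCurve hk hz hzΓ ?_⟩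
  · rw [norm_smul, norm_inv, norm_norm, inv_mul_cancel₀ h0.ne']
  · rw [inner_smul_right, real_inner_comm, inner_gradient, (h.fderiv_eq_zero_iff hk hz hzΓ).2 hτ,
      mul_zero]
  · rw [← inner_gradient, inner_smul_right, real_inner_self_eq_norm_sq]
    positivity

/-- Orthogonality to the kernel of `dG` forces any outward unit normal to be a multiple of the
gradient; unit length and the outward condition determine the multiple. Thus the choice made by
`Classical.epsilon` is harmless. -/
theorem normal_eq (h : IsDefiningFunction k α Γ (region Γ) G U) (hk : 1 ≤ k)
    {z : EuclideanSpace ℝ (Fin n)} (hz : z ∈ U) (hzΓ : z ∈ Γ) :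
    normal Γ z = ‖gradient G z‖⁻¹ • gradient G z := by
  have hv : IsOutwardUnitNormal Γ z (normal Γ z) :=
    Classical.epsilon_spec ⟨_, h.isOutwardUnitNormal_gradient hk hz hzΓ⟩
  set v := normal Γ z with hvdef
  set N := gradient G z with hN
  have h0 : 0 < ‖N‖ := norm_pos_iff.2 (gradient_ne_zero (h.fderiv_ne_zero z hz))
  set c : ℝ := inner ℝ N v / ‖N‖ ^ 2 with hc
  have hNN : inner ℝ N (v - c • N) = 0 := by
    rw [inner_sub_right, inner_smul_right, real_inner_self_eq_norm_sq, hc]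
    field_simp
    ring
  have hcv : v = c • N := by
    have h1 : fderiv ℝ G z (v - c • N) = 0 := by rw [← inner_gradient]; exact hNN
    have h2 := hv.orthogonal _ ((h.fderiv_eq_zero_iff hk hz hzΓ).1 h1)
    have h3 : inner ℝ (v - c • N) (v - c • N) = 0 := by
      rw [inner_sub_right, h2, inner_smul_right, real_inner_comm, hNN]
      simp
    exact sub_eq_zero.1 (inner_self_eq_zero.1 h3)
  have hnorm : |c| * ‖N‖ = 1 := by
    rw [← Real.norm_eq_abs, ← norm_smul, ← hcv]
    exact hv.norm_eq
  have hcpos : 0 < c := by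
    by_contra! hc0
    have hcne : c ≠ 0 := by
      intro hc1
      rw [hc1] at hnorm
      simp at hnorm
    have h1 : 0 < fderiv ℝ G z (-v) := by
      rw [← inner_gradient, ← hN, inner_neg_right, hcv, inner_smul_right,
        real_inner_self_eq_norm_sq]
      have : c < 0 := lt_of_le_of_ne hc0 hcne
      have : 0 < ‖N‖ ^ 2 := by positivity
      nlinarith
    obtain ⟨t, ht1, ht2⟩ := ((h.eventually_normalCurve hk hz hzΓ h1).and hv.outward).exists
    refine ht2.2 (subset_closure ?_)
    simpa using ht1.1
  rw [abs_of_pos hcpos] at hnorm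
  rw [hcv, eq_inv_of_mul_eq_one_left hnorm]

theorem fderiv_pos_of_inner_normal_pos (h : IsDefiningFunction k α Γ (region Γ) G U)
    (hk : 1 ≤ k) {z : EuclideanSpace ℝ (Fin n)} (hz : z ∈ U) (hzΓ : z ∈ Γ)
    {w : EuclideanSpace ℝ (Fin n)} (hw : 0 < inner ℝ w (normal Γ z)) : 0 < fderiv ℝ G z w := by
  rw [h.normal_eq hk hz hzΓ, inner_smul_right, real_inner_comm, inner_gradient] at hw
  exact pos_of_mul_pos_right hw (by positivity)

end IsDefiningFunction

theorem exists_isDefiningFunction_region (hα : α ∈ Ioo (0 : ℝ) 1) (hk : 1 ≤ k)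
    (hΓ : Γ ∈ hypersurfaces n k α) {y : EuclideanSpace ℝ (Fin n)} (hy : y ∈ Γ) :
    ∃ G U, IsDefiningFunction k α Γ (region Γ) G U ∧ y ∈ U :=
  exists_isDefiningFunction hα hk hΓ.2.2.1 (isRegionOf_region hΓ) hy

theorem isOutwardUnitNormal_normal (hα : α ∈ Ioo (0 : ℝ) 1) (hk : 1 ≤ k)
    (hΓ : Γ ∈ hypersurfaces n k α) {y : EuclideanSpace ℝ (Fin n)} (hy : y ∈ Γ) :
    IsOutwardUnitNormal Γ y (normal Γ y) := by
  obtain ⟨G, U, hG, hyU⟩ := exists_isDefiningFunction_region hα hk hΓ hy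
  rw [hG.normal_eq hk hyU hy]
  exact hG.isOutwardUnitNormal_gradient hk hyU hy

theorem eventually_crossing (hα : α ∈ Ioo (0 : ℝ) 1) (hk : 1 ≤ k) (hΓ : Γ ∈ hypersurfaces n k α)
    {c : ℝ → EuclideanSpace ℝ (Fin n)} {w : EuclideanSpace ℝ (Fin n)} {t : ℝ}
    (hc : HasDerivAt c w t) (ht : c t ∈ Γ) (hw : 0 < inner ℝ w (normal Γ (c t))) :
    (∀ᶠ s in 𝓝[<] t, c s ∈ region Γ) ∧ ∀ᶠ s in 𝓝[>] t, c s ∉ closure (region Γ) := by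
  obtain ⟨G, U, hG, hU⟩ := exists_isDefiningFunction_region hα hk hΓ ht
  exact hG.eventually_crossing hk hc hU ht (hG.fderiv_pos_of_inner_normal_pos hk hU ht hw)

theorem exists_curve_of_inner_normal_eq_zero (hα : α ∈ Ioo (0 : ℝ) 1) (hk : 1 ≤ k)
    (hΓ : Γ ∈ hypersurfaces n k α) {y : EuclideanSpace ℝ (Fin n)} (hy : y ∈ Γ)
    {τ : EuclideanSpace ℝ (Fin n)} (hτ : inner ℝ τ (normal Γ y) = 0) :
    ∃ c : ℝ → EuclideanSpace ℝ (Fin n), c 0 = y ∧ HasDerivAt c τ 0 ∧ ∀ᶠ t in 𝓝 0, c t ∈ Γ := by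
  obtain ⟨G, U, hG, hU⟩ := exists_isDefiningFunction_region hα hk hΓ hy
  refine hG.exists_curve y hU hy τ ?_
  have h0 : 0 < ‖gradient G y‖ := norm_pos_iff.2 (gradient_ne_zero (hG.fderiv_ne_zero y hU))
  rw [hG.normal_eq hk hU hy, inner_smul_right, real_inner_comm, inner_gradient] at hτ
  exact (mul_eq_zero.1 hτ).resolve_left (by positivity)

/-- A nearest point on the hypersurface is the foot of a normal. -/
theorem sub_eq_smul_normal (hα : α ∈ Ioo (0 : ℝ) 1) (hk : 1 ≤ k) (hΓ : Γ ∈ hypersurfaces n k α)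
    {x y : EuclideanSpace ℝ (Fin n)} (hy : y ∈ Γ) (hmin : ∀ z ∈ Γ, dist x y ≤ dist x z) :
    x - y = inner ℝ (x - y) (normal Γ y) • normal Γ y := by
  have hν := (isOutwardUnitNormal_normal hα hk hΓ hy).norm_eq
  set ν := normal Γ y with hνdef
  set v := x - y - inner ℝ (x - y) ν • ν with hv
  have hvν : inner ℝ v ν = 0 := by
    rw [hv, inner_sub_left, inner_smul_left, real_inner_self_eq_norm_sq, hν]
    simp
  -- Along a curve in `Γ` with velocity `v`, the tangential part of `x - y`, the squared distance to
  -- `x` has a minimum at `0`. Hence `v` is orthogonal to `x - y`, and so `v = 0`.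
  obtain ⟨c, hc0, hc, hcΓ⟩ := exists_curve_of_inner_normal_eq_zero hα hk hΓ hy hvν
  have h1 : HasDerivAt (fun t => ‖x - c t‖ ^ 2) (2 * inner ℝ (x - c 0) (-v)) 0 :=
    (hc.const_sub x).norm_sq
  have h2 : IsLocalMin (fun t => ‖x - c t‖ ^ 2) 0 := by
    filter_upwards [hcΓ] with t ht
    rw [hc0, ← dist_eq_norm, ← dist_eq_norm]
    have := hmin _ ht
    gcongr
  have h3 := h2.hasDerivAt_eq_zero h1
  rw [hc0, inner_neg_right] at h3
  have h4 : inner ℝ v v = 0 := by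
    nth_rewrite 1 [hv]
    rw [inner_sub_left, inner_smul_left, real_inner_comm v ν, hvν]
    simp only [mul_zero, sub_zero]
    linarith
  exact sub_eq_zero.1 (inner_self_eq_zero.1 h4)

theorem continuousOn_normal (hα : α ∈ Ioo (0 : ℝ) 1) (hk : 1 ≤ k) (hΓ : Γ ∈ hypersurfaces n k α) :
    ContinuousOn (normal Γ) Γ := by
  intro y hy
  obtain ⟨G, U, hG, hU⟩ := exists_isDefiningFunction_region hα hk hΓ hy
  have hC1 : ContDiffOn ℝ 1 G U :=
    (hG.locLittleHolder.of_le hα hk hG.isOpen).contDiffOn hα.1 hG.isOpen |>.of_le (by simp)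
  have hg : ContinuousAt (gradient G) y := by
    have h1 : ContinuousAt (fderiv ℝ G) y :=
      (hC1.continuousOn_fderiv_of_isOpen hG.isOpen le_rfl).continuousAt (hG.isOpen.mem_nhds hU)
    exact (LinearIsometryEquiv.continuous _).continuousAt.comp h1
  have h2 : ContinuousAt (fun z => ‖gradient G z‖⁻¹ • gradient G z) y :=
    (hg.norm.inv₀ (norm_ne_zero_iff.2 (gradient_ne_zero (hG.fderiv_ne_zero y hU)))).smul hg
  refine h2.continuousWithinAt.congr_of_eventuallyEq ?_ (hG.normal_eq hk hU hy)
  filter_upwards [self_mem_nhdsWithin, nhdsWithin_le_nhds (hG.isOpen.mem_nhds hU)] with z hz hzU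
  exact hG.normal_eq hk hzU hz

/-- The derivative is Lipschitz near `y`, so the mean value inequality gives a second-order
remainder uniform in the base point `z`. -/
theorem exists_quadratic_bound {E : Type*} [NormedAddCommGroup E] [NormedSpace ℝ E] {G : E → ℝ}
    {y : E} (h : ContDiffAt ℝ 2 G y) : ∃ r > 0, ∃ C ≥ 0, ∀ z ∈ Metric.ball y r,
      ∀ z' ∈ Metric.ball y r, |G z' - G z - fderiv ℝ G z (z' - z)| ≤ C * ‖z' - z‖ ^ 2 := by
  have h1 : ContDiffAt ℝ 1 (fderiv ℝ G) y := h.fderiv_right (by norm_num)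
  obtain ⟨K, t, ht, hK⟩ := h1.exists_lipschitzOnWith
  have hd : ∀ᶠ z in 𝓝 y, DifferentiableAt ℝ G z :=
    (h.eventually (by simp)).mono fun z hz => hz.differentiableAt (by norm_num)
  obtain ⟨r, hr, hrt⟩ := Metric.mem_nhds_iff.1 (inter_mem ht hd)
  refine ⟨r, hr, K, K.2, fun z hz z' hz' => ?_⟩
  have hseg : segment ℝ z z' ⊆ Metric.ball y r := (convex_ball y r).segment_subset hz hz'
  have h2 := (convex_segment z z').norm_image_sub_le_of_norm_hasFDerivWithin_le' (f := G)
    (f' := fderiv ℝ G) (φ := fderiv ℝ G z) (C := K * ‖z' - z‖)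
    (fun x hx => (hrt (hseg hx)).2.hasFDerivAt.hasFDerivWithinAt)
    (fun x hx => by
      rw [← dist_eq_norm]
      refine (hK.dist_le_mul x (hrt (hseg hx)).1 z (hrt hz).1).trans ?_
      gcongr
      rw [dist_eq_norm]
      obtain ⟨a, ha, rfl⟩ := (segment_eq_image' ℝ z z').subset hx
      simp only [add_sub_cancel_left, norm_smul]
      rw [Real.norm_of_nonneg ha.1]
      exact mul_le_of_le_one_left (norm_nonneg _) ha.2)
    (left_mem_segment ℝ z z') (right_mem_segment ℝ z z')
  rw [Real.norm_eq_abs] at h2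
  calc _ ≤ _ := h2
    _ = _ := by ring

/-- On a compact hypersurface of class `C²`, the normal is Lipschitz, and the tangent space deviates
quadratically from the hypersurface. -/
theorem exists_forall_normal_bounds (hα : α ∈ Ioo (0 : ℝ) 1) (hk : 2 ≤ k)
    (hΓ : Γ ∈ hypersurfaces n k α) : ∃ r > 0, ∃ C > 0, ∀ y ∈ Γ, ∀ z ∈ Γ, dist y z < r →
      ‖normal Γ z - normal Γ y‖ ≤ C * ‖z - y‖ ∧
      |inner ℝ (z - y) (normal Γ y)| ≤ C * ‖z - y‖ ^ 2 := by
  -- Only the base point `y` is confined to `S`, while `z` ranges over all of `Γ`; this lets the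
  -- property pass to unions.
  have key := hΓ.2.1.induction_on (p := fun S => ∃ r > 0, ∃ C > 0, ∀ y ∈ S, y ∈ Γ → ∀ z ∈ Γ,
      dist y z < r → ‖normal Γ z - normal Γ y‖ ≤ C * ‖z - y‖ ∧
      |inner ℝ (z - y) (normal Γ y)| ≤ C * ‖z - y‖ ^ 2) ⟨1, one_pos, 1, one_pos, by simp⟩
    (fun S T hST ⟨r, hr, C, hC, h⟩ => ⟨r, hr, C, hC, fun y hy => h y (hST hy)⟩) ?_ ?_
  · obtain ⟨r, hr, C, hC, h⟩ := key
    exact ⟨r, hr, C, hC, fun y hy => h y hy hy⟩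
  · rintro S T ⟨r, hr, C, hC, h⟩ ⟨r', hr', C', hC', h'⟩
    refine ⟨min r r', lt_min hr hr', max C C', lt_max_of_lt_left hC, fun y hy hyΓ z hz hd => ?_⟩
    rcases hy with hy | hy
    · obtain ⟨h1, h2⟩ := h y hy hyΓ z hz (hd.trans_le (min_le_left _ _))
      have : C ≤ max C C' := le_max_left _ _
      exact ⟨h1.trans (by gcongr), h2.trans (by gcongr)⟩
    · obtain ⟨h1, h2⟩ := h' y hy hyΓ z hz (hd.trans_le (min_le_right _ _))
      have : C' ≤ max C C' := le_max_right _ _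
      exact ⟨h1.trans (by gcongr), h2.trans (by gcongr)⟩
  · intro y₀ hy₀
    have hk1 : 1 ≤ k := by omega
    obtain ⟨G, U, hG, hU⟩ := exists_isDefiningFunction_region hα hk1 hΓ hy₀
    have hC2 : ContDiffAt ℝ 2 G y₀ :=
      ((hG.locLittleHolder.of_le hα hk hG.isOpen).contDiffOn hα.1 hG.isOpen).contDiffAt
        (hG.isOpen.mem_nhds hU)
    have hgrad : ContDiffAt ℝ 1 (gradient G) y₀ := by
      have h1 : ContDiffAt ℝ 1 (fderiv ℝ G) y₀ := hC2.fderiv_right (by norm_num)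
      exact (InnerProductSpace.toDual ℝ (EuclideanSpace ℝ (Fin n))).symm.contDiff.contDiffAt.comp
        y₀ h1
    have hne : gradient G y₀ ≠ 0 := gradient_ne_zero (hG.fderiv_ne_zero y₀ hU)
    have hinv : ContDiffAt ℝ 1 (fun z => ‖gradient G z‖⁻¹) y₀ :=
      (hgrad.norm ℝ hne).inv (norm_ne_zero_iff.2 hne)
    obtain ⟨K, t, ht, hK⟩ := (hinv.smul hgrad).exists_lipschitzOnWith
    obtain ⟨r₁, hr₁, C₁, hC₁, hquad⟩ := exists_quadratic_bound hC2
    set A := ‖gradient G y₀‖⁻¹ + 1 with hA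
    have hA' : ∀ᶠ z in 𝓝 y₀, ‖gradient G z‖⁻¹ < A :=
      hinv.continuousAt.eventually (gt_mem_nhds (lt_add_one _))
    obtain ⟨r, hr, hrs⟩ := Metric.mem_nhds_iff.1 (inter_mem (inter_mem ht (hG.isOpen.mem_nhds hU))
      (inter_mem hA' (Metric.ball_mem_nhds y₀ hr₁)))
    refine ⟨Metric.ball y₀ (r / 2), mem_nhdsWithin_of_mem_nhds
      (Metric.ball_mem_nhds y₀ (by positivity)), r / 2, by positivity, K + A * C₁ + 1,
      by positivity, fun y hy hyΓ z hz hd => ?_⟩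
    have hyr : y ∈ Metric.ball y₀ r := Metric.ball_subset_ball (by linarith) hy
    have hzr : z ∈ Metric.ball y₀ r := by
      rw [Metric.mem_ball] at hy ⊢
      calc dist z y₀ ≤ dist z y + dist y y₀ := dist_triangle _ _ _
        _ < r := by rw [dist_comm z y]; linarith
    obtain ⟨⟨hyt, hyU⟩, hyA, hy1⟩ := hrs hyr
    obtain ⟨⟨hzt, hzU⟩, hzA, hz1⟩ := hrs hzr
    rw [hG.normal_eq hk1 hyU hyΓ, hG.normal_eq hk1 hzU hz]
    constructor
    · have := hK.dist_le_mul z hzt y hyt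
      rw [dist_eq_norm, dist_eq_norm] at this
      refine this.trans ?_
      gcongr
      have : 0 ≤ A * C₁ := by positivity
      linarith
    · have h2 := hquad y hy1 z hz1
      rw [(hG.mem_iff z hzU).1 hz, (hG.mem_iff y hyU).1 hyΓ, sub_zero, zero_sub, abs_neg,
        ← inner_gradient, real_inner_comm] at h2
      have hyA' : ‖gradient G y‖⁻¹ ≤ A := le_of_lt hyA
      rw [inner_smul_right, abs_mul, abs_of_nonneg (by positivity)]
      calc _ ≤ A * (C₁ * ‖z - y‖ ^ 2) := by gcongr
        _ = A * C₁ * ‖z - y‖ ^ 2 := by ring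
        _ ≤ _ := by
          gcongr
          have : (0 : ℝ) ≤ K := K.2
          linarith

end Normal

end NuGraph

end

noncomputable section


namespace NuGraph

/-! ### Tubular neighborhoods and the extended normal field -/

section Tubular

variable {n k : ℕ} {α : ℝ} {Γ : Set (EuclideanSpace ℝ (Fin n))} {r : ℝ}

theorem norm_normal (hα : α ∈ Ioo (0 : ℝ) 1) (hk : 1 ≤ k) (hΓ : Γ ∈ hypersurfaces n k α)
    {y : EuclideanSpace ℝ (Fin n)} (hy : y ∈ Γ) : ‖normal Γ y‖ = 1 :=
  (isOutwardUnitNormal_normal hα hk hΓ hy).norm_eq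

theorem exists_eq_normalMap (hα : α ∈ Ioo (0 : ℝ) 1) (hk : 1 ≤ k) (hΓ : Γ ∈ hypersurfaces n k α)
    (x : EuclideanSpace ℝ (Fin n)) :
    ∃ y ∈ Γ, ∃ s, x = normalMap Γ (y, s) ∧ |s| = Metric.infDist x Γ := by
  obtain ⟨y, hy, hd⟩ := hΓ.2.1.exists_infDist_eq_dist hΓ.1 x
  have h1 := sub_eq_smul_normal hα hk hΓ hy fun z hz => hd ▸ Metric.infDist_le_dist_of_mem hz
  refine ⟨y, hy, inner ℝ (x - y) (normal Γ y), ?_, ?_⟩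
  · rw [normalMap, ← h1]; abel
  · rw [hd, dist_eq_norm, h1, norm_smul, norm_normal hα hk hΓ hy, mul_one, Real.norm_eq_abs, ← h1]

theorem dist_normalMap (hα : α ∈ Ioo (0 : ℝ) 1) (hk : 1 ≤ k) (hΓ : Γ ∈ hypersurfaces n k α)
    {y : EuclideanSpace ℝ (Fin n)} (hy : y ∈ Γ) (s : ℝ) : dist (normalMap Γ (y, s)) y = |s| := by
  simp [normalMap, dist_eq_norm, norm_smul, norm_normal hα hk hΓ hy]

/-- Surjectivity comes from nearest points. Suppose that two feet at distance `d` give the same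
point. Pairing their difference with each normal yields two bounds `C * d ^ 2`, whose sum gives `|s₂
- s₁| ≤ 2 * C * d ^ 2`. With the Lipschitz bound for the normal, `d ≤ d * (2 * C * d + r * C)`
follows, which forces `d = 0` for small `r`. -/
theorem exists_isTubularRadius (hα : α ∈ Ioo (0 : ℝ) 1) (hk : 2 ≤ k)
    (hΓ : Γ ∈ hypersurfaces n k α) : ∃ r, IsTubularRadius Γ r := by
  have hk1 : 1 ≤ k := by omega
  obtain ⟨r₁, hr₁, C, hC, hb⟩ := exists_forall_normal_bounds hα hk hΓ
  -- The feet satisfy `d < 2 * r ≤ r₁`, so the local bounds apply, and the last factor is at most `5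
  -- * C * r ≤ 5 / 6`.
  set r := min (r₁ / 2) (1 / (6 * C)) with hr
  have hr0 : 0 < r := by positivity
  have hrr₁ : 2 * r ≤ r₁ := by linarith [min_le_left (r₁ / 2) (1 / (6 * C))]
  have hrC : 6 * (C * r) ≤ 1 := by
    have h1 : r ≤ 1 / (6 * C) := min_le_right _ _
    rw [le_div_iff₀ (by positivity)] at h1
    linarith
  refine ⟨r, hr0, fun p hp => ?_, ?_, fun x hx => ?_⟩
  · rw [Metric.mem_thickening_iff]
    refine ⟨p.1, hp.1, ?_⟩
    rw [dist_normalMap hα hk1 hΓ hp.1]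
    exact abs_lt.2 hp.2
  · rintro ⟨y₁, s₁⟩ ⟨hy₁, hs₁⟩ ⟨y₂, s₂⟩ ⟨hy₂, hs₂⟩ heq
    simp only at hy₁ hs₁ hy₂ hs₂
    have hν₁ := norm_normal hα hk1 hΓ hy₁
    have hν₂ := norm_normal hα hk1 hΓ hy₂
    have hd : dist y₂ y₁ < 2 * r := by
      calc dist y₂ y₁ ≤ dist (normalMap Γ (y₂, s₂)) y₂ + dist (normalMap Γ (y₁, s₁)) y₁ := by
            rw [heq, dist_comm _ y₂]; exact dist_triangle _ _ _
        _ < 2 * r := by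
            rw [dist_normalMap hα hk1 hΓ hy₁, dist_normalMap hα hk1 hΓ hy₂]
            linarith [abs_lt.2 hs₁, abs_lt.2 hs₂]
    obtain ⟨h1, h2⟩ := hb y₂ hy₂ y₁ hy₁ (hd.trans_le hrr₁)
    obtain ⟨-, h3⟩ := hb y₁ hy₁ y₂ hy₂ (by rw [dist_comm]; exact hd.trans_le hrr₁)
    simp only [normalMap] at heq
    rw [dist_comm, dist_eq_norm] at hd
    set ν₁ := normal Γ y₁
    set ν₂ := normal Γ y₂
    set d := ‖y₁ - y₂‖ with hddef
    have hd0 : 0 ≤ d := norm_nonneg _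
    have hD : y₁ - y₂ = s₂ • ν₂ - s₁ • ν₁ := by
      rw [sub_eq_sub_iff_add_eq_add, heq, add_comm]
    rw [← neg_sub y₁ y₂, inner_neg_left, abs_neg, norm_neg, hD, inner_sub_left, inner_smul_left,
      inner_smul_left, real_inner_self_eq_norm_sq, hν₁] at h3
    rw [hD, inner_sub_left, inner_smul_left, inner_smul_left, real_inner_self_eq_norm_sq, hν₂,
      real_inner_comm] at h2
    simp only [conj_trivial, one_pow, mul_one] at h2 h3
    rw [← hD] at h3
    set p : ℝ := inner ℝ ν₂ ν₁ with hp
    have hpn : ‖ν₁ - ν₂‖ ^ 2 = 2 - 2 * p := by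
      rw [@norm_sub_sq_real, hν₁, hν₂, real_inner_comm]; ring
    have hCd : C * d ≤ 1 := by nlinarith
    have hp0 : 0 ≤ p := by
      have : ‖ν₁ - ν₂‖ ^ 2 ≤ 1 := by
        have := h1.trans hCd
        nlinarith [norm_nonneg (ν₁ - ν₂)]
      linarith
    have hs : |s₂ - s₁| ≤ 2 * C * d ^ 2 := by
      have h4 : |(s₂ - s₁) * (1 + p)| ≤ 2 * C * d ^ 2 := by
        rw [show (s₂ - s₁) * (1 + p) = (s₂ - s₁ * p) + (s₂ * p - s₁) by ring]
        exact (abs_add_le _ _).trans (by linarith)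
      rw [abs_mul, abs_of_nonneg (by linarith : (0 : ℝ) ≤ 1 + p)] at h4
      nlinarith [abs_nonneg (s₂ - s₁)]
    have hd1 : d ≤ 2 * C * d ^ 2 + r * (C * d) := by
      have h5 : y₁ - y₂ = (s₂ - s₁) • ν₂ - s₁ • (ν₁ - ν₂) := by
        rw [hD, sub_smul, smul_sub]; abel
      calc d ≤ ‖(s₂ - s₁) • ν₂‖ + ‖s₁ • (ν₁ - ν₂)‖ := by
            rw [hddef, h5]; exact norm_sub_le _ _
        _ = |s₂ - s₁| + |s₁| * ‖ν₁ - ν₂‖ := by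
            rw [norm_smul, norm_smul, hν₂, mul_one, Real.norm_eq_abs, Real.norm_eq_abs]
        _ ≤ _ := by
            have := abs_lt.2 hs₁
            gcongr
    have hd2 : d = 0 := by
      by_contra hne
      have hdpos : 0 < d := lt_of_le_of_ne hd0 (Ne.symm hne)
      have h6 : d * (2 * C * d + r * C) < d * 1 := by
        refine mul_lt_mul_of_pos_left ?_ hdpos
        nlinarith
      nlinarith
    have hy : y₁ = y₂ := sub_eq_zero.1 (norm_eq_zero.1 hd2)
    rw [hd2] at hs
    have hs' : s₂ - s₁ = 0 := abs_eq_zero.1 (le_antisymm (by simpa using hs) (abs_nonneg _))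
    rw [hy, sub_eq_zero.1 hs']
  · obtain ⟨y, hy, s, rfl, hs⟩ := exists_eq_normalMap hα hk1 hΓ x
    refine ⟨(y, s), ⟨hy, abs_lt.1 ?_⟩, rfl⟩
    rw [hs]
    exact (Metric.mem_thickening_iff_infDist_lt hΓ.1).1 hx

/-- A nearest foot has parameter at most `|s| < r` in absolute value, so injectivity on the tube
identifies it with the given foot. This holds for every tubular radius, however large. -/
theorem IsTubularRadius.infDist_normalMap (hr : IsTubularRadius Γ r) (hα : α ∈ Ioo (0 : ℝ) 1)
    (hk : 1 ≤ k) (hΓ : Γ ∈ hypersurfaces n k α) {y : EuclideanSpace ℝ (Fin n)} (hy : y ∈ Γ) {s : ℝ}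
    (hs : |s| < r) : Metric.infDist (normalMap Γ (y, s)) Γ = |s| := by
  obtain ⟨y', hy', s', heq, hs'⟩ := exists_eq_normalMap hα hk hΓ (normalMap Γ (y, s))
  have h1 : |s'| ≤ |s| := by
    rw [hs', ← dist_normalMap hα hk hΓ hy s]
    exact Metric.infDist_le_dist_of_mem hy
  have h2 := hr.2.injOn (mk_mem_prod hy (abs_lt.1 hs))
    (mk_mem_prod hy' (abs_lt.1 (h1.trans_lt hs))) heq
  rw [← hs', (Prod.mk.inj h2).2]

theorem extendedNormal_normalMap (hr : IsTubularRadius Γ r) (η : ℝ → ℝ)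
    {y : EuclideanSpace ℝ (Fin n)} (hy : y ∈ Γ) {s : ℝ} (hs : |s| < r) :
    extendedNormal Γ r η (normalMap Γ (y, s)) = η s • normal Γ y := by
  have hmem : (y, s) ∈ Γ ×ˢ Ioo (-r) r := mk_mem_prod hy (abs_lt.1 hs)
  rw [extendedNormal, if_pos (hr.2.mapsTo hmem)]
  simp only
  rw [hr.2.injOn.leftInvOn_invFunOn hmem]

theorem extendedNormal_eq_zero (hα : α ∈ Ioo (0 : ℝ) 1) (hk : 1 ≤ k)
    (hΓ : Γ ∈ hypersurfaces n k α) (hr : IsTubularRadius Γ r) {η : ℝ → ℝ} (hη : IsCutoff r η)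
    {x : EuclideanSpace ℝ (Fin n)} (hx : 3 * r / 4 ≤ Metric.infDist x Γ) :
    extendedNormal Γ r η x = 0 := by
  by_cases hxT : x ∈ Metric.thickening r Γ
  · obtain ⟨⟨y, s⟩, ⟨hy, hs⟩, rfl⟩ := hr.2.surjOn hxT
    rw [hr.infDist_normalMap hα hk hΓ hy (abs_lt.2 hs)] at hx
    rw [extendedNormal_normalMap hr η hy (abs_lt.2 hs), hη.eq_zero s, zero_smul]
    exact fun h => absurd (abs_lt.2 h) (not_lt.2 hx)
  · rw [extendedNormal, if_neg hxT]

theorem norm_extendedNormal_le (hα : α ∈ Ioo (0 : ℝ) 1) (hk : 1 ≤ k)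
    (hΓ : Γ ∈ hypersurfaces n k α) (hr : IsTubularRadius Γ r) {η : ℝ → ℝ} (hη : IsCutoff r η)
    (x : EuclideanSpace ℝ (Fin n)) : ‖extendedNormal Γ r η x‖ ≤ 1 := by
  by_cases hxT : x ∈ Metric.thickening r Γ
  · obtain ⟨⟨y, s⟩, ⟨hy, hs⟩, rfl⟩ := hr.2.surjOn hxT
    rw [extendedNormal_normalMap hr η hy (abs_lt.2 hs), norm_smul, norm_normal hα hk hΓ hy, mul_one,
      Real.norm_of_nonneg (hη.range s).1]
    exact (hη.range s).2
  · rw [extendedNormal, if_neg hxT]; simp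

theorem extendedNormal_self (hr : IsTubularRadius Γ r) {η : ℝ → ℝ} (hη : IsCutoff r η)
    {y : EuclideanSpace ℝ (Fin n)} (hy : y ∈ Γ) : extendedNormal Γ r η y = normal Γ y := by
  have h := extendedNormal_normalMap hr η hy (s := 0) (by simpa using hr.1)
  rw [hη.eq_one 0 ⟨by linarith [hr.1], by linarith [hr.1]⟩, one_smul] at h
  simpa [normalMap] using h

theorem continuousOn_normalMap (hα : α ∈ Ioo (0 : ℝ) 1) (hk : 1 ≤ k)
    (hΓ : Γ ∈ hypersurfaces n k α) (I : Set ℝ) : ContinuousOn (normalMap Γ) (Γ ×ˢ I) :=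
  continuousOn_fst.add (continuousOn_snd.smul
    ((continuousOn_normal hα hk hΓ).comp continuousOn_fst fun _ hp => hp.1))

theorem isCompact_image_normalMap (hα : α ∈ Ioo (0 : ℝ) 1) (hk : 1 ≤ k)
    (hΓ : Γ ∈ hypersurfaces n k α) (a : ℝ) :
    IsCompact (normalMap Γ '' (Γ ×ˢ Icc (-a) a)) :=
  (hΓ.2.1.prod isCompact_Icc).image_of_continuousOn (continuousOn_normalMap hα hk hΓ _)

theorem mem_image_normalMap_of_infDist_le (hα : α ∈ Ioo (0 : ℝ) 1) (hk : 1 ≤ k)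
    (hΓ : Γ ∈ hypersurfaces n k α) {a : ℝ} {x : EuclideanSpace ℝ (Fin n)}
    (hx : Metric.infDist x Γ ≤ a) : x ∈ normalMap Γ '' (Γ ×ˢ Icc (-a) a) := by
  obtain ⟨y, hy, s, rfl, hs⟩ := exists_eq_normalMap hα hk hΓ x
  exact ⟨(y, s), ⟨hy, abs_le.1 (hs ▸ hx)⟩, rfl⟩

theorem hasCompactSupport_extendedNormal (hα : α ∈ Ioo (0 : ℝ) 1) (hk : 1 ≤ k)
    (hΓ : Γ ∈ hypersurfaces n k α) (hr : IsTubularRadius Γ r) {η : ℝ → ℝ} (hη : IsCutoff r η) :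
    HasCompactSupport (extendedNormal Γ r η) :=
  HasCompactSupport.intro (isCompact_image_normalMap hα hk hΓ (3 * r / 4)) fun x hx =>
    extendedNormal_eq_zero hα hk hΓ hr hη (by
      by_contra! h
      exact hx (mem_image_normalMap_of_infDist_le hα hk hΓ h.le))

/-- On a compact piece of the tube, preimages of closed sets under the field are images of compact
sets under `normalMap`, hence closed. The rest of space is a closed set on which the field vanishes.
-/
theorem continuous_extendedNormal (hα : α ∈ Ioo (0 : ℝ) 1) (hk : 1 ≤ k)
    (hΓ : Γ ∈ hypersurfaces n k α) (hr : IsTubularRadius Γ r) {η : ℝ → ℝ} (hη : IsCutoff r η) :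
    Continuous (extendedNormal Γ r η) := by
  have hr0 := hr.1
  -- Any value in `[3 * r / 4, r)` would do: below `r` for the formula on the tube, and at least `3
  -- * r / 4` for `S` and `T` to cover the space.
  set a := 7 * r / 8 with ha
  set K : Set (EuclideanSpace ℝ (Fin n) × ℝ) := Γ ×ˢ Icc (-a) a with hK
  set S := normalMap Γ '' K with hS
  set T := {x | 3 * r / 4 ≤ Metric.infDist x Γ} with hT
  have hKc : IsCompact K := hΓ.2.1.prod isCompact_Icc
  have hSc : IsCompact S := isCompact_image_normalMap hα hk hΓ a
  have hTc : IsClosed T := isClosed_le continuous_const (Metric.continuous_infDist_pt Γ)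
  have hcomp : ∀ p ∈ K, extendedNormal Γ r η (normalMap Γ p) = η p.2 • normal Γ p.1 := fun p hp =>
    extendedNormal_normalMap hr η hp.1 ((abs_le.2 hp.2).trans_lt (by linarith))
  have hcompc : ContinuousOn (fun p : EuclideanSpace ℝ (Fin n) × ℝ => η p.2 • normal Γ p.1) K :=
    (hη.contDiff.continuous.comp_continuousOn continuousOn_snd).smul
      ((continuousOn_normal hα hk hΓ).comp continuousOn_fst fun _ hp => hp.1)
  have h1 : ContinuousOn (extendedNormal Γ r η) S := by
    rw [continuousOn_iff_isClosed]
    intro t ht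
    refine ⟨normalMap Γ '' (K ∩ (fun p => η p.2 • normal Γ p.1) ⁻¹' t), ?_, ?_⟩
    · refine IsCompact.isClosed ?_
      refine IsCompact.image_of_continuousOn ?_
        ((continuousOn_normalMap hα hk hΓ _).mono inter_subset_left)
      exact hKc.of_isClosed_subset (hcompc.preimage_isClosed_of_isClosed hKc.isClosed ht)
        inter_subset_left
    · ext x
      constructor
      · rintro ⟨hx, p, hp, rfl⟩
        refine ⟨⟨p, ⟨hp, ?_⟩, rfl⟩, p, hp, rfl⟩
        rw [mem_preimage, ← hcomp p hp]
        exact hx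
      · rintro ⟨⟨p, ⟨hp, hpt⟩, rfl⟩, hx⟩
        refine ⟨?_, hx⟩
        rw [mem_preimage, hcomp p hp]
        exact hpt
  have h2 : ContinuousOn (extendedNormal Γ r η) T :=
    continuousOn_const.congr fun x hx => extendedNormal_eq_zero hα hk hΓ hr hη hx
  have hST : S ∪ T = univ := by
    refine eq_univ_of_forall fun x => ?_
    rcases le_or_gt (3 * r / 4) (Metric.infDist x Γ) with h | h
    · exact Or.inr h
    · exact Or.inl (mem_image_normalMap_of_infDist_le hα hk hΓ (by linarith))
  rw [← continuousOn_univ, ← hST]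
  exact h1.union_of_isClosed h2 hSc.isClosed hTc

/-- The open normal segments of length less than a tubular radius stay on one side. -/
theorem IsTubularRadius.sides (hr : IsTubularRadius Γ r) (hα : α ∈ Ioo (0 : ℝ) 1) (hk : 1 ≤ k)
    (hΓ : Γ ∈ hypersurfaces n k α) {y : EuclideanSpace ℝ (Fin n)} (hy : y ∈ Γ) {s : ℝ}
    (hs : s ∈ Ioo 0 r) :
    normalMap Γ (y, -s) ∈ region Γ ∧ normalMap Γ (y, s) ∉ closure (region Γ) := by
  have hΩ := isRegionOf_region hΓ
  have hout := (isOutwardUnitNormal_normal hα hk hΓ hy).outward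
  obtain ⟨t, ⟨ht1, ht2⟩, ht⟩ := (hout.and (Ioo_mem_nhdsGT hr.1)).exists
  -- The distance from `normalMap Γ (y, u)` to `Γ` is `|u|`, so both open half segments avoid `Γ`.
  have hne : ∀ u : ℝ, u ≠ 0 → |u| < r → normalMap Γ (y, u) ∉ Γ := by
    intro u hu hur hmem
    have h1 := hr.infDist_normalMap hα hk hΓ hy hur
    rw [Metric.infDist_zero_of_mem hmem] at h1
    exact hu (abs_eq_zero.1 h1.symm)
  have hcont : Continuous fun u : ℝ => normalMap Γ (y, u) := by
    exact (continuous_const (y := y)).add (continuous_id.smul (continuous_const (y := normal Γ y)))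
  have hS₁ : IsPreconnected ((fun u : ℝ => normalMap Γ (y, u)) '' Ioo 0 r) :=
    isPreconnected_Ioo.image _ hcont.continuousOn
  have hS₂ : IsPreconnected ((fun u : ℝ => normalMap Γ (y, u)) '' Ioo (-r) 0) :=
    isPreconnected_Ioo.image _ hcont.continuousOn
  constructor
  · rcases hΩ.subset_or_subset hS₂ (by
      rintro _ ⟨u, hu, rfl⟩
      exact hne u hu.2.ne (abs_lt.2 ⟨hu.1, hu.2.trans hr.1⟩)) with h | h
    · exact h ⟨-s, ⟨neg_lt_neg hs.2, neg_lt_zero.2 hs.1⟩, rfl⟩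
    · have h3 := h ⟨-t, ⟨neg_lt_neg ht.2, neg_lt_zero.2 ht.1⟩, rfl⟩
      refine absurd (subset_closure ?_) h3
      simpa [normalMap, sub_eq_add_neg] using ht1
  · rcases hΩ.subset_or_subset hS₁ (by
      rintro _ ⟨u, hu, rfl⟩
      exact hne u hu.1.ne' (abs_lt.2 ⟨by linarith [hu.1, hr.1], hu.2⟩)) with h | h
    · exact absurd (subset_closure (h ⟨t, ht, rfl⟩)) ht2
    · exact h ⟨s, hs, rfl⟩

end Tubular

/-! ### The regularized normal field -/

section Regularized

variable {n k : ℕ} {α : ℝ} {Γ : Set (EuclideanSpace ℝ (Fin n))} {r δ : ℝ} {η : ℝ → ℝ}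
  {ψ : EuclideanSpace ℝ (Fin n) → ℝ}

theorem contDiff_scaled (hψ : IsMollifier ψ) : ContDiff ℝ (⊤ : ℕ∞) (scaled ψ δ) :=
  contDiff_const.mul (hψ.contDiff.comp (contDiff_const_smul _))

theorem hasCompactSupport_scaled (hψ : IsMollifier ψ) (hδ : 0 < δ) :
    HasCompactSupport (scaled ψ δ) :=
  (hψ.hasCompactSupport.comp_homeomorph (Homeomorph.smulOfNeZero δ⁻¹ (by positivity))).mul_left

theorem scaled_nonneg (hψ : IsMollifier ψ) (hδ : 0 < δ) (x : EuclideanSpace ℝ (Fin n)) :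
    0 ≤ scaled ψ δ x :=
  mul_nonneg (by positivity) (hψ.nonneg _)

theorem integral_scaled (hψ : IsMollifier ψ) (hδ : 0 < δ) : ∫ x, scaled ψ δ x = 1 := by
  simp only [scaled]
  rw [integral_const_mul, Measure.integral_comp_smul, hψ.integral_eq_one]
  simp [abs_of_pos hδ, hδ.ne']

theorem exists_support_scaled_subset (hψ : IsMollifier ψ) :
    ∃ R > 0, ∀ δ > 0, Function.support (scaled ψ δ) ⊆ Metric.ball 0 (δ * R) := by
  obtain ⟨R, hR0, hR⟩ := hψ.hasCompactSupport.isCompact.isBounded.subset_ball_lt 0 0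
  refine ⟨R, hR0, fun δ hδ x hx => ?_⟩
  have h1 : ψ (δ⁻¹ • x) ≠ 0 := fun h => hx (by simp [scaled, h])
  have h2 := hR (subset_tsupport ψ h1)
  rw [mem_ball_zero_iff, norm_smul, Real.norm_of_nonneg (by positivity),
    inv_mul_lt_iff₀ hδ] at h2
  rwa [mem_ball_zero_iff]

theorem contDiff_regularizedNormal (hα : α ∈ Ioo (0 : ℝ) 1) (hk : 1 ≤ k)
    (hΓ : Γ ∈ hypersurfaces n k α) (hr : IsTubularRadius Γ r) (hη : IsCutoff r η)
    (hψ : IsMollifier ψ) (hδ : 0 < δ) : ContDiff ℝ (⊤ : ℕ∞) (regularizedNormal Γ r η ψ δ) :=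
  (hasCompactSupport_scaled hψ hδ).contDiff_convolution_left _ (contDiff_scaled hψ)
    (continuous_extendedNormal hα hk hΓ hr hη).locallyIntegrable

theorem hasCompactSupport_regularizedNormal (hα : α ∈ Ioo (0 : ℝ) 1) (hk : 1 ≤ k)
    (hΓ : Γ ∈ hypersurfaces n k α) (hr : IsTubularRadius Γ r) (hη : IsCutoff r η)
    (hψ : IsMollifier ψ) (hδ : 0 < δ) : HasCompactSupport (regularizedNormal Γ r η ψ δ) :=
  (hasCompactSupport_scaled hψ hδ).convolution _ (hasCompactSupport_extendedNormal hα hk hΓ hr hη)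

theorem norm_regularizedNormal_le (hα : α ∈ Ioo (0 : ℝ) 1) (hk : 1 ≤ k)
    (hΓ : Γ ∈ hypersurfaces n k α) (hr : IsTubularRadius Γ r) (hη : IsCutoff r η)
    (hψ : IsMollifier ψ) (hδ : 0 < δ) (x : EuclideanSpace ℝ (Fin n)) :
    ‖regularizedNormal Γ r η ψ δ x‖ ≤ 1 := by
  obtain ⟨R, -, hR⟩ := exists_support_scaled_subset hψ
  rw [← dist_zero_right]
  refine dist_convolution_le zero_le_one (hR δ hδ) (scaled_nonneg hψ hδ) (integral_scaled hψ hδ)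
    (continuous_extendedNormal hα hk hΓ hr hη).aestronglyMeasurable fun z _ => ?_
  rw [dist_zero_right]
  exact norm_extendedNormal_le hα hk hΓ hr hη z

/-- Near the hypersurface, the regularized normal is uniformly close to the normal. -/
theorem exists_forall_norm_regularizedNormal_sub_le (hα : α ∈ Ioo (0 : ℝ) 1) (hk : 1 ≤ k)
    (hΓ : Γ ∈ hypersurfaces n k α) (hr : IsTubularRadius Γ r) (hη : IsCutoff r η)
    (hψ : IsMollifier ψ) {c : ℝ} (hc : 0 < c) :
    ∃ d > 0, ∃ δ₀ > 0, ∀ δ ∈ Ioo 0 δ₀, ∀ y ∈ Γ, ∀ x, dist x y < d →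
      ‖regularizedNormal Γ r η ψ δ x - normal Γ y‖ ≤ c := by
  have hcont := continuous_extendedNormal hα hk hΓ hr hη
  obtain ⟨d, hd, hd'⟩ := Metric.uniformContinuous_iff.1
    ((hasCompactSupport_extendedNormal hα hk hΓ hr hη).uniformContinuous_of_continuous hcont) c hc
  obtain ⟨R, hR0, hR⟩ := exists_support_scaled_subset hψ
  -- The distance `d` of uniform continuity is shared between `dist x y` and the mollification
  -- radius `δ * R`.
  refine ⟨d / 2, by positivity, d / (2 * R), by positivity, fun δ hδ y hy x hxy => ?_⟩
  rw [← dist_eq_norm]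
  refine dist_convolution_le hc.le (hR δ hδ.1) (scaled_nonneg hψ hδ.1) (integral_scaled hψ hδ.1)
    hcont.aestronglyMeasurable fun z hz => ?_
  rw [← extendedNormal_self hr hη hy]
  refine (hd' ?_).le
  have h1 : δ * R < d / 2 := by
    have := (lt_div_iff₀ (by positivity)).1 hδ.2
    linarith
  calc dist z y ≤ dist z x + dist x y := dist_triangle _ _ _
    _ < d := by linarith [Metric.mem_ball.1 hz]

end Regularized

end NuGraph

end

noncomputable section


namespace NuGraph

/-! ### Closeness in the `C¹` distance -/

section DistC1

variable {n k j : ℕ} {α : ℝ} {Γ Γ' : Set (EuclideanSpace ℝ (Fin n))}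

theorem dist_toLp_prod (x y v w : EuclideanSpace ℝ (Fin n)) :
    dist x y ≤ dist (WithLp.toLp 2 (x, v)) (WithLp.toLp 2 (y, w)) ∧
      ‖v - w‖ ≤ dist (WithLp.toLp 2 (x, v)) (WithLp.toLp 2 (y, w)) := by
  rw [dist_eq_norm, dist_eq_norm]
  exact ⟨WithLp.norm_fst_le _ (WithLp.toLp 2 (x, v) - WithLp.toLp 2 (y, w)),
    WithLp.norm_snd_le _ (WithLp.toLp 2 (x, v) - WithLp.toLp 2 (y, w))⟩

theorem isBounded_normalGraph (hα : α ∈ Ioo (0 : ℝ) 1) (hk : 1 ≤ k)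
    (hΓ : Γ ∈ hypersurfaces n k α) : Bornology.IsBounded (normalGraph Γ) := by
  refine (hΓ.2.1.image_of_continuousOn ?_).isBounded
  exact (WithLp.prod_continuous_toLp 2 _ _).comp_continuousOn
    (continuousOn_id.prodMk (continuousOn_normal hα hk hΓ))

theorem exists_close_of_distC1_lt (hα : α ∈ Ioo (0 : ℝ) 1) (hk : 1 ≤ k) (hj : 1 ≤ j)
    (hΓ' : Γ' ∈ hypersurfaces n k α) (hΓ : Γ ∈ hypersurfaces n j α) {ε : ℝ}
    (h : distC1 Γ' Γ < ε) :
    (∀ x ∈ Γ', ∃ y ∈ Γ, dist x y < ε ∧ ‖normal Γ' x - normal Γ y‖ < ε) ∧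
      ∀ y ∈ Γ, ∃ x ∈ Γ', dist x y < ε := by
  -- The real-valued Hausdorff distance is `0` by default when the extended one is infinite;
  -- nonempty bounded normal graphs exclude this case.
  have hfin : Metric.hausdorffEDist (normalGraph Γ') (normalGraph Γ) ≠ ⊤ :=
    Metric.hausdorffEDist_ne_top_of_nonempty_of_bounded (hΓ'.1.image _) (hΓ.1.image _)
      (isBounded_normalGraph hα hk hΓ') (isBounded_normalGraph hα hj hΓ)
  constructor
  · intro x hx
    obtain ⟨_, ⟨y, hy, rfl⟩, hd⟩ :=
      Metric.exists_dist_lt_of_hausdorffDist_lt (mem_image_of_mem _ hx) h hfin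
    have h1 := dist_toLp_prod x y (normal Γ' x) (normal Γ y)
    exact ⟨y, hy, h1.1.trans_lt hd, h1.2.trans_lt hd⟩
  · intro y hy
    obtain ⟨_, ⟨x, hx, rfl⟩, hd⟩ :=
      Metric.exists_dist_lt_of_hausdorffDist_lt' (mem_image_of_mem _ hy) h hfin
    exact ⟨x, hx, (dist_toLp_prod x y (normal Γ' x) (normal Γ y)).1.trans_lt hd⟩

end DistC1

/-! ### Crossing of hypersurfaces by an almost normal flow -/

/-- `φ` is the global flow of a field `w` of norm at most one that is close to the normal of `Γ` at
the points of distance less than `d` to `Γ`. -/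
structure IsNormalFlow {n : ℕ} (Γ : Set (EuclideanSpace ℝ (Fin n)))
    (w : EuclideanSpace ℝ (Fin n) → EuclideanSpace ℝ (Fin n)) (d : ℝ)
    (φ : EuclideanSpace ℝ (Fin n) → ℝ → EuclideanSpace ℝ (Fin n)) : Prop where
  continuous : Continuous (Function.uncurry φ)
  apply_zero : ∀ x, φ x 0 = x
  hasDerivAt : ∀ x t, HasDerivAt (φ x) (w (φ x t)) t
  apply_apply : ∀ x s t, φ (φ x s) t = φ x (s + t)
  norm_le : ∀ x, ‖w x‖ ≤ 1
  norm_sub_le : ∀ y ∈ Γ, ∀ x, dist x y < d → ‖w x - normal Γ y‖ ≤ 1 / 8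

namespace IsNormalFlow

variable {n k j : ℕ} {α : ℝ} {Γ Γ' : Set (EuclideanSpace ℝ (Fin n))}
  {w : EuclideanSpace ℝ (Fin n) → EuclideanSpace ℝ (Fin n)} {d r : ℝ}
  {φ : EuclideanSpace ℝ (Fin n) → ℝ → EuclideanSpace ℝ (Fin n)}

theorem continuous_curve (h : IsNormalFlow Γ w d φ) (x : EuclideanSpace ℝ (Fin n)) :
    Continuous (φ x) :=
  h.continuous.comp (Continuous.prodMk_right x)

theorem continuous_time (h : IsNormalFlow Γ w d φ) (t : ℝ) : Continuous fun x => φ x t :=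
  h.continuous.comp (Continuous.prodMk_left t)

theorem dist_le (h : IsNormalFlow Γ w d φ) (x : EuclideanSpace ℝ (Fin n)) (t : ℝ) :
    dist (φ x t) x ≤ |t| := by
  have h1 := convex_univ.norm_image_sub_le_of_norm_hasDerivWithin_le (f := φ x) (C := 1)
    (fun s _ => (h.hasDerivAt x s).hasDerivWithinAt) (fun s _ => h.norm_le _) (mem_univ 0)
    (mem_univ t)
  rwa [h.apply_zero, one_mul, sub_zero, ← dist_eq_norm] at h1

theorem dist_add_smul_normal_le (h : IsNormalFlow Γ w d φ) {x y : EuclideanSpace ℝ (Fin n)}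
    (hy : y ∈ Γ) {t : ℝ} (ht : dist x y + |t| < d) :
    dist (φ x t) (x + t • normal Γ y) ≤ |t| / 8 := by
  have hder : ∀ s ∈ uIcc 0 t, HasDerivWithinAt (fun s => φ x s - s • normal Γ y)
      (w (φ x s) - normal Γ y) (uIcc 0 t) s := by
    intro s _
    have := (h.hasDerivAt x s).sub ((hasDerivAt_id s).smul_const (normal Γ y))
    rw [one_smul] at this
    exact this.hasDerivWithinAt
  have hb : ∀ s ∈ uIcc 0 t, ‖w (φ x s) - normal Γ y‖ ≤ 1 / 8 := by
    intro s hs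
    refine h.norm_sub_le y hy _ ?_
    have h1 : |s| ≤ |t| := by simpa using abs_sub_left_of_mem_uIcc hs
    linarith [dist_triangle (φ x s) x y, h.dist_le x s]
  have h1 := (convex_uIcc 0 t).norm_image_sub_le_of_norm_hasDerivWithin_le hder hb left_mem_uIcc
    right_mem_uIcc
  rw [h.apply_zero, zero_smul, sub_zero, sub_zero, Real.norm_eq_abs] at h1
  rw [dist_eq_norm, show φ x t - (x + t • normal Γ y) = φ x t - t • normal Γ y - x by abel]
  linarith

/-- The field differs from the unit normal of `Γ'` by at most `1/8 + 1/2 = 5/8 < 1`. -/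
theorem inner_normal_pos (h : IsNormalFlow Γ w d φ) (hα : α ∈ Ioo (0 : ℝ) 1) (hk : 1 ≤ k)
    (hΓ' : Γ' ∈ hypersurfaces n k α) {x y : EuclideanSpace ℝ (Fin n)} (hx : x ∈ Γ') (hy : y ∈ Γ)
    (hxy : dist x y < d) (hν : ‖normal Γ' x - normal Γ y‖ ≤ 1 / 2) :
    0 < inner ℝ (w x) (normal Γ' x) := by
  have h1 := norm_normal hα hk hΓ' hx
  have h2 : ‖w x - normal Γ' x‖ ≤ 5 / 8 := by
    calc ‖w x - normal Γ' x‖ = ‖(w x - normal Γ y) - (normal Γ' x - normal Γ y)‖ := by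
          congr 1; abel
      _ ≤ _ := (_root_.norm_sub_le _ _).trans (by linarith [h.norm_sub_le y hy x hxy])
  have h3 := abs_le.1 (abs_real_inner_le_norm (w x - normal Γ' x) (normal Γ' x))
  rw [inner_sub_left, real_inner_self_eq_norm_sq, h1] at h3
  linarith [h3.1]

theorem eq_of_mem (h : IsNormalFlow Γ w d φ) (hα : α ∈ Ioo (0 : ℝ) 1) (hk : 1 ≤ k)
    (hΓ' : Γ' ∈ hypersurfaces n k α) (hw : ∀ x ∈ Γ', 0 < inner ℝ (w x) (normal Γ' x))
    {x : EuclideanSpace ℝ (Fin n)} {t₁ t₂ : ℝ} (h₁ : φ x t₁ ∈ Γ') (h₂ : φ x t₂ ∈ Γ') : t₁ = t₂ :=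
  (isRegionOf_region hΓ').eq_of_crossing (h.continuous_curve x)
    (fun t ht => eventually_crossing hα hk hΓ' (h.hasDerivAt x t) ht (hw _ ht)) h₁ h₂

/-- Shortly before and after a crossing the trajectory is in the open region and in the open
exterior. Nearby trajectories are there at the same times, so they cross in between. -/
theorem eventually_exists_mem (h : IsNormalFlow Γ w d φ) (hα : α ∈ Ioo (0 : ℝ) 1) (hk : 1 ≤ k)
    (hΓ' : Γ' ∈ hypersurfaces n k α) (hw : ∀ x ∈ Γ', 0 < inner ℝ (w x) (normal Γ' x))
    {x : EuclideanSpace ℝ (Fin n)} {t a : ℝ} (ht : φ x t ∈ Γ') (ha : 0 < a) :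
    ∀ᶠ x' in 𝓝 x, ∃ t' ∈ Ioo (t - a) (t + a), φ x' t' ∈ Γ' := by
  have hΩ := isRegionOf_region hΓ'
  obtain ⟨h1, h2⟩ := eventually_crossing hα hk hΓ' (h.hasDerivAt x t) ht (hw _ ht)
  obtain ⟨s, hs, hs'⟩ := (h1.and (Ioo_mem_nhdsLT (by linarith : t - a < t))).exists
  obtain ⟨u, hu, hu'⟩ := (h2.and (Ioo_mem_nhdsGT (by linarith : t < t + a))).exists
  have h3 : ∀ᶠ x' in 𝓝 x, φ x' s ∈ region Γ' :=
    (h.continuous_time s).continuousAt.eventually (hΩ.isOpen.mem_nhds hs)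
  have h4 : ∀ᶠ x' in 𝓝 x, φ x' u ∉ closure (region Γ') :=
    (h.continuous_time u).continuousAt.eventually (isClosed_closure.isOpen_compl.mem_nhds hu)
  filter_upwards [h3, h4] with x' hx1 hx2
  obtain ⟨t', ht', hmem⟩ := hΩ.exists_mem_of_curve (h.continuous_curve x') hx1 hx2
    (hs'.2.trans hu'.1).le
  exact ⟨t', ⟨hs'.1.trans_le ht'.1, ht'.2.trans_lt hu'.2⟩, hmem⟩

/-- The ball of radius `s` about `normalMap Γ (y, ±s)` avoids `Γ`, so it lies on the side of its
center. It contains `φ x (±s)`, which is off center by at most `s / 8 + s / 2`. -/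
theorem sides (h : IsNormalFlow Γ w d φ) (hr : IsTubularRadius Γ r) (hα : α ∈ Ioo (0 : ℝ) 1)
    (hj : 1 ≤ j) (hΓ : Γ ∈ hypersurfaces n j α) {x y : EuclideanSpace ℝ (Fin n)} (hy : y ∈ Γ)
    {s : ℝ} (hs : s ∈ Ioo 0 r) (hxy : dist x y ≤ s / 2) (hd : dist x y + s < d) :
    φ x (-s) ∈ region Γ ∧ φ x s ∉ closure (region Γ) := by
  have hΩ := isRegionOf_region hΓ
  obtain ⟨h1, h2⟩ := hr.sides hα hj hΓ hy hs
  have hball : ∀ t : ℝ, |t| = s → (∀ z ∈ Metric.ball (normalMap Γ (y, t)) s, z ∉ Γ) ∧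
      φ x t ∈ Metric.ball (normalMap Γ (y, t)) s := by
    intro t ht
    constructor
    · intro z hz hzΓ
      have h3 := Metric.infDist_le_dist_of_mem (x := normalMap Γ (y, t)) hzΓ
      rw [hr.infDist_normalMap hα hj hΓ hy (ht ▸ hs.2), ht, dist_comm] at h3
      exact absurd (Metric.mem_ball.1 hz) (not_lt.2 h3)
    · have h3 := h.dist_add_smul_normal_le hy (t := t) (by rwa [ht])
      have h4 : dist (x + t • normal Γ y) (normalMap Γ (y, t)) = dist x y :=
        dist_add_right _ _ _
      rw [Metric.mem_ball]
      calc dist (φ x t) (normalMap Γ (y, t)) ≤ |t| / 8 + dist x y :=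
            (dist_triangle _ _ _).trans (add_le_add h3 h4.le)
        _ < s := by rw [ht]; linarith [hs.1]
  have hcenter : ∀ p : EuclideanSpace ℝ (Fin n), p ∈ Metric.ball p s :=
    fun p => Metric.mem_ball_self hs.1
  constructor
  · obtain ⟨h3, h4⟩ := hball (-s) (by rw [abs_neg, abs_of_pos hs.1])
    rcases hΩ.subset_or_subset (convex_ball _ _).isPreconnected h3 with h5 | h5
    · exact h5 h4
    · exact absurd (subset_closure h1) (h5 (hcenter _))
  · obtain ⟨h3, h4⟩ := hball s (abs_of_pos hs.1)
    rcases hΩ.subset_or_subset (convex_ball _ _).isPreconnected h3 with h5 | h5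
    · exact absurd (subset_closure (h5 (hcenter _))) h2
    · exact h5 h4

theorem exists_mem_Icc (h : IsNormalFlow Γ w d φ) (hr : IsTubularRadius Γ r)
    (hα : α ∈ Ioo (0 : ℝ) 1) (hj : 1 ≤ j) (hΓ : Γ ∈ hypersurfaces n j α)
    {x y : EuclideanSpace ℝ (Fin n)} (hy : y ∈ Γ) {s : ℝ} (hs : s ∈ Ioo 0 r)
    (hxy : dist x y ≤ s / 2) (hd : dist x y + s < d) : ∃ t ∈ Icc (-s) s, φ x t ∈ Γ := by
  obtain ⟨h1, h2⟩ := h.sides hr hα hj hΓ hy hs hxy hd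
  exact (isRegionOf_region hΓ).exists_mem_of_curve (h.continuous_curve x) h1 h2
    (by linarith [hs.1])

theorem inner_normal_self_pos (h : IsNormalFlow Γ w d φ) (hd : 0 < d) (hα : α ∈ Ioo (0 : ℝ) 1)
    (hj : 1 ≤ j) (hΓ : Γ ∈ hypersurfaces n j α) {x : EuclideanSpace ℝ (Fin n)} (hx : x ∈ Γ) :
    0 < inner ℝ (w x) (normal Γ x) :=
  h.inner_normal_pos hα hj hΓ hx hx (by simpa using hd) (by simp)

theorem apply_apply_neg (h : IsNormalFlow Γ w d φ) (x : EuclideanSpace ℝ (Fin n)) (t : ℝ) :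
    φ (φ x t) (-t) = x := by
  rw [h.apply_apply, add_neg_cancel, h.apply_zero]

/-- Two points of `Γ` flowing to the same point lie on one trajectory, which meets `Γ` only once. -/
theorem injOn (h : IsNormalFlow Γ w d φ) (hd : 0 < d) (hα : α ∈ Ioo (0 : ℝ) 1)
    (hj : 1 ≤ j) (hΓ : Γ ∈ hypersurfaces n j α) (I : Set ℝ) :
    InjOn (Function.uncurry φ) (Γ ×ˢ I) := by
  rintro ⟨y₁, s₁⟩ ⟨hy₁, -⟩ ⟨y₂, s₂⟩ ⟨hy₂, -⟩ heq
  simp only [Function.uncurry_apply_pair] at heq hy₁ hy₂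
  have h1 : φ y₁ (s₁ - s₂) = y₂ := by
    rw [sub_eq_add_neg, ← h.apply_apply, heq, h.apply_apply_neg]
  have h2 : s₁ - s₂ = 0 :=
    h.eq_of_mem hα hj hΓ (fun x hx => h.inner_normal_self_pos hd hα hj hΓ hx)
      (h1.symm ▸ hy₂) ((h.apply_zero y₁).symm ▸ hy₁)
  rw [h2, h.apply_zero] at h1
  rw [h1, sub_eq_zero.1 h2]

/-- The trajectory of `φ y s` meets `Γ` at time `-s`, and nearby starting points meet it at nearby
times. -/
theorem isOpen_image (h : IsNormalFlow Γ w d φ) (hd : 0 < d) (hα : α ∈ Ioo (0 : ℝ) 1)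
    (hj : 1 ≤ j) (hΓ : Γ ∈ hypersurfaces n j α) (a : ℝ) :
    IsOpen (Function.uncurry φ '' (Γ ×ˢ Ioo (-a) a)) := by
  rw [isOpen_iff_mem_nhds]
  rintro _ ⟨⟨y, s⟩, ⟨hy, hs⟩, rfl⟩
  have ha : 0 < a - |s| := sub_pos.2 (abs_lt.2 hs)
  filter_upwards [h.eventually_exists_mem hα hj hΓ
    (fun x hx => h.inner_normal_self_pos hd hα hj hΓ hx) (x := φ y s) (t := -s)
    ((h.apply_apply_neg y s).symm ▸ hy) ha] with x hx
  obtain ⟨t, ht, hmem⟩ := hx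
  refine ⟨(φ x t, -t), ⟨hmem, ?_⟩, h.apply_apply_neg x t⟩
  have h1 := le_abs_self s
  have h2 := neg_abs_le s
  constructor <;> simp only <;> linarith [ht.1, ht.2]

theorem image_subset_thickening (h : IsNormalFlow Γ w d φ) {a : ℝ} (har : a ≤ r) :
    Function.uncurry φ '' (Γ ×ˢ Ioo (-a) a) ⊆ Metric.thickening r Γ := by
  rintro _ ⟨⟨y, s⟩, ⟨hy, hs⟩, rfl⟩
  rw [Metric.mem_thickening_iff]
  exact ⟨y, hy, (h.dist_le y s).trans_lt ((abs_lt.2 hs).trans_le har)⟩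

/-- A hypersurface that is close to `Γ` and transverse to the field is a graph over `Γ`. -/
theorem exists_graph (h : IsNormalFlow Γ w d φ) (hr : IsTubularRadius Γ r)
    (hα : α ∈ Ioo (0 : ℝ) 1) (hj : 1 ≤ j) (hΓ : Γ ∈ hypersurfaces n j α) (hk : 1 ≤ k)
    (hΓ' : Γ' ∈ hypersurfaces n k α) (hw : ∀ x ∈ Γ', 0 < inner ℝ (w x) (normal Γ' x))
    {s l : ℝ} (hs : s ∈ Ioo 0 r) (hsd : 2 * s ≤ d) (hsl : 2 * s ≤ l)
    (hl : ∀ y ∈ Γ, ∃ C ⊆ Γ, IsPreconnected C ∧ Metric.ball y l ∩ Γ ⊆ C)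
    (h₁ : ∀ x ∈ Γ', ∃ y ∈ Γ, dist x y ≤ s / 2) (h₂ : ∀ y ∈ Γ, ∃ x ∈ Γ', dist x y ≤ s / 2) :
    ∃ ρ : Γ → ℝ, Continuous ρ ∧ (∀ y, |ρ y| ≤ s) ∧ (∀ y : Γ, φ y (ρ y) ∈ Γ') ∧
      Γ' = {x | ∃ y : Γ, x = φ y (ρ y)} := by
  have hs0 := hs.1
  have hd : 0 < d := by linarith
  have hwΓ : ∀ x ∈ Γ, 0 < inner ℝ (w x) (normal Γ x) := fun x hx =>
    h.inner_normal_self_pos hd hα hj hΓ hx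
  have hit : ∀ x ∈ Γ', ∃ t ∈ Icc (-s) s, φ x t ∈ Γ := by
    intro x hx
    obtain ⟨y, hy, hxy⟩ := h₁ x hx
    exact h.exists_mem_Icc hr hα hj hΓ hy hs hxy (by linarith)
  have hbound : ∀ y ∈ Γ, ∀ t, φ y t ∈ Γ' → t ∈ Icc (-s) s := by
    intro y hy t ht
    obtain ⟨u, hu, hmem⟩ := hit _ ht
    have h3 : u = -t := h.eq_of_mem hα hj hΓ hwΓ hmem ((h.apply_apply_neg y t).symm ▸ hy)
    rw [h3] at hu
    exact ⟨by linarith [hu.2], by linarith [hu.1]⟩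
  -- The points whose trajectory meets `Γ'` form a relatively clopen subset of `Γ`: closed as a
  -- projection of a compact set, open by stability of crossings, with `hbound` confining the times.
  set A := {y | y ∈ Γ ∧ ∃ t ∈ Icc (-s) s, φ y t ∈ Γ'} with hA
  have hAclosed : IsClosed A := by
    have h3 : IsCompact ((Γ ×ˢ Icc (-s) s) ∩ Function.uncurry φ ⁻¹' Γ') :=
      (hΓ.2.1.prod isCompact_Icc).inter_right (hΓ'.2.1.isClosed.preimage h.continuous)
    convert (h3.image continuous_fst).isClosed using 1
    ext y
    constructor
    · rintro ⟨hy, t, ht, hmem⟩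
      exact ⟨(y, t), ⟨⟨hy, ht⟩, hmem⟩, rfl⟩
    · rintro ⟨⟨y, t⟩, ⟨⟨hy, ht⟩, hmem⟩, rfl⟩
      exact ⟨hy, t, ht, hmem⟩
  have hAopen : ∀ y ∈ A, y ∈ interior {x | x ∈ Γ → x ∈ A} := by
    rintro y ⟨hy, t, ht, hmem⟩
    rw [mem_interior_iff_mem_nhds]
    filter_upwards [h.eventually_exists_mem hα hk hΓ' hw hmem one_pos] with x ⟨u, _, hu⟩ hx
    exact ⟨hx, u, hbound x hx u hu, hu⟩
  have hAll : ∀ y ∈ Γ, y ∈ A := by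
    intro y hy
    obtain ⟨x, hx, hxy⟩ := h₂ y hy
    obtain ⟨t, ht, hmem⟩ := hit x hx
    have hzA : φ x t ∈ A :=
      ⟨hmem, -t, ⟨neg_le_neg ht.2, by linarith [ht.1]⟩, (h.apply_apply_neg x t).symm ▸ hx⟩
    obtain ⟨C, hCΓ, hC, hbC⟩ := hl y hy
    -- The point `φ x t` of `A` is within `s + s / 2 < 2 * s ≤ l` of `y`, hence in the same
    -- connected piece `C`, which therefore lies in `A`.
    have hz : φ x t ∈ C := hbC ⟨by
      rw [Metric.mem_ball]
      linarith [dist_triangle (φ x t) x y, h.dist_le x t, abs_le.2 ht], hmem⟩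
    have hyC : y ∈ C := hbC ⟨Metric.mem_ball_self (by linarith), hy⟩
    rcases isPreconnected_iff_subset_of_disjoint.1 hC _ _ isOpen_interior hAclosed.isOpen_compl
      (fun x _ => (em (x ∈ A)).imp_left (hAopen x)) (by
        refine eq_empty_of_forall_notMem fun x hx => hx.2.2 ?_
        exact interior_subset hx.2.1 (hCΓ hx.1)) with h3 | h3
    · exact interior_subset (h3 hyC) hy
    · exact absurd hzA (h3 hz)
  choose ρ hρ using fun y : Γ => (hAll y y.2).2
  refine ⟨ρ, ?_, fun y => abs_le.2 (hρ y).1, fun y => (hρ y).2, ?_⟩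
  · rw [Metric.continuous_iff']
    intro y a ha
    have h3 := h.eventually_exists_mem hα hk hΓ' hw (hρ y).2 ha
    filter_upwards [continuous_subtype_val.continuousAt.eventually h3] with x ⟨t, ht, hmem⟩
    rw [h.eq_of_mem hα hk hΓ' hw (hρ x).2 hmem, Real.dist_eq, abs_lt]
    exact ⟨by linarith [ht.1], by linarith [ht.2]⟩
  · ext x
    constructor
    · intro hx
      obtain ⟨t, ht, hmem⟩ := hit x hx
      refine ⟨⟨φ x t, hmem⟩, ?_⟩
      have h3 : φ (φ x t) (-t) = x := h.apply_apply_neg x t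
      rw [← h.eq_of_mem hα hk hΓ' hw (h3.symm ▸ hx) (hρ ⟨φ x t, hmem⟩).2, h3]
    · rintro ⟨y, rfl⟩
      exact (hρ y).2

end IsNormalFlow

/-- The graph pieces over balls are connected; a Lebesgue number of their cover of `Γ` is a uniform
size. -/
theorem exists_preconnected_neighborhoods {n k : ℕ} {α : ℝ} {Γ : Set (EuclideanSpace ℝ (Fin n))}
    (hα : α ∈ Ioo (0 : ℝ) 1) (hk : 1 ≤ k) (hΓ : Γ ∈ hypersurfaces n k α) :
    ∃ l > 0, ∀ y ∈ Γ, ∃ C ⊆ Γ, IsPreconnected C ∧ Metric.ball y l ∩ Γ ⊆ C := by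
  choose! G U hG hU using fun y (hy : y ∈ Γ) => exists_isDefiningFunction_region hα hk hΓ hy
  obtain ⟨l, hl, hl'⟩ := lebesgue_number_lemma_of_metric (ι := Γ) (c := fun y => U y) hΓ.2.1
    (fun y => (hG y y.2).isOpen) fun y hy => mem_iUnion.2 ⟨⟨y, hy⟩, hU y hy⟩
  refine ⟨l, hl, fun y hy => ?_⟩
  obtain ⟨z, hz⟩ := hl' y hy
  exact ⟨Γ ∩ U z, inter_subset_left, (hG z z.2).isPreconnected, fun x hx => ⟨hx.2, hz hx.1⟩⟩

end NuGraph

end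

noncomputable section


namespace NuGraph

/-! ### The implicit function theorem in little Hölder classes -/

section Implicit

open Asymptotics

variable {E : Type} [NormedAddCommGroup E] [NormedSpace ℝ E] {α : ℝ}

/-- The derivative of the implicit function of an equation with derivative `L`. -/
def implicitDeriv (L : E × ℝ →L[ℝ] ℝ) : E →L[ℝ] ℝ :=
  -((L (0, 1))⁻¹ • L.comp (ContinuousLinearMap.inl ℝ E ℝ))

theorem contDiffOn_implicitDeriv {m : WithTop ℕ∞} :
    ContDiffOn ℝ m (implicitDeriv : (E × ℝ →L[ℝ] ℝ) → E →L[ℝ] ℝ) {L | L (0, 1) ≠ 0} := by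
  have h1 : ContDiff ℝ m fun L : E × ℝ →L[ℝ] ℝ => L (0, 1) :=
    (ContinuousLinearMap.apply ℝ ℝ ((0, 1) : E × ℝ)).contDiff
  have h2 : ContDiff ℝ m fun L : E × ℝ →L[ℝ] ℝ => L.comp (ContinuousLinearMap.inl ℝ E ℝ) :=
    ((ContinuousLinearMap.compL ℝ E (E × ℝ) ℝ).flip (ContinuousLinearMap.inl ℝ E ℝ)).contDiff
  exact ((h1.contDiffOn.inv fun L hL => hL).smul h2.contDiffOn).neg

theorem isOpen_setOf_apply_ne_zero : IsOpen {L : E × ℝ →L[ℝ] ℝ | L (0, 1) ≠ 0} :=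
  isOpen_ne_fun (ContinuousLinearMap.apply ℝ ℝ ((0, 1) : E × ℝ)).continuous continuous_const

theorem hasFDerivAt_of_implicit {F : E × ℝ → ℝ} {f : E → ℝ} {u : E} {L : E × ℝ →L[ℝ] ℝ}
    (hF : HasFDerivAt F L (u, f u)) (hL : L (0, 1) ≠ 0) (hf : ContinuousAt f u)
    (hFf : ∀ᶠ v in 𝓝 u, F (v, f v) = 0) : HasFDerivAt f (implicitDeriv L) u := by
  set c := L (0, 1) with hc
  have hLp : ∀ v s, L (v, s) = L (v, 0) + s * c := by
    intro v s
    rw [hc, ← smul_eq_mul, ← map_smul, ← map_add]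
    simp
  have hγ : Tendsto (fun v => (v, f v)) (𝓝 u) (𝓝 (u, f u)) := continuousAt_id.prodMk hf
  have h0 := hFf.self_of_nhds
  have h1 : (fun v => L (v - u, f v - f u)) =o[𝓝 u] fun v => ((v - u, f v - f u) : E × ℝ) := by
    have h2 := (hF.isLittleO.comp_tendsto hγ).neg_left
    refine h2.congr' ?_ (Eventually.of_forall fun v => rfl)
    filter_upwards [hFf] with v hv
    simp [hv, h0, -map_sub]
  have h2 : (fun v => f v - f u - implicitDeriv L (v - u)) =o[𝓝 u]
      fun v => ((v - u, f v - f u) : E × ℝ) := by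
    refine (h1.const_mul_left c⁻¹).congr_left fun v => ?_
    rw [hLp]
    simp only [implicitDeriv, neg_apply, smul_apply,
      ContinuousLinearMap.comp_apply, ContinuousLinearMap.inl_apply, smul_eq_mul, ← hc]
    field_simp
    ring
  -- The error is at most half of the pair `(v - u, f v - f u)`, so its part in `f v - f u` is
  -- absorbed, and `f` grows at most linearly at `u`.
  have h3 : (fun v => ((v - u, f v - f u) : E × ℝ)) =O[𝓝 u] fun v => v - u := by
    refine IsBigO.of_bound (2 * ‖implicitDeriv L‖ + 2) ?_
    filter_upwards [h2.bound (by norm_num : (0 : ℝ) < 1 / 2)] with v hv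
    have h4 := (implicitDeriv L).le_opNorm (v - u)
    have h5 : ‖f v - f u‖ ≤ ‖f v - f u - implicitDeriv L (v - u)‖ + ‖implicitDeriv L (v - u)‖ := by
      simpa using norm_add_le (f v - f u - implicitDeriv L (v - u)) (implicitDeriv L (v - u))
    have h6 : ‖((v - u, f v - f u) : E × ℝ)‖ ≤ ‖v - u‖ + ‖f v - f u‖ :=
      max_le (by simp) (by simp)
    have h7 : 0 ≤ ‖implicitDeriv L‖ * ‖v - u‖ := by positivity
    refine max_le ?_ ?_
    · simp only
      nlinarith [norm_nonneg (v - u)]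
    · simp only
      nlinarith [norm_nonneg (v - u)]
  exact .of_isLittleO (h2.trans_isBigO h3)

/-- The implicit function theorem for continuous solutions, in the local little Hölder classes. -/
theorem LocLittleHolder.implicit (hα : α ∈ Ioo (0 : ℝ) 1) {k : ℕ} (hk : 1 ≤ k) {F : E × ℝ → ℝ}
    {W : Set (E × ℝ)} (hW : IsOpen W) (hF : LocLittleHolder α k F W) {f : E → ℝ} {V : Set E}
    (hV : IsOpen V) (hf : ContinuousOn f V) (hfW : ∀ u ∈ V, (u, f u) ∈ W)
    (hFf : ∀ u ∈ V, F (u, f u) = 0) (hne : ∀ u ∈ V, fderiv ℝ F (u, f u) (0, 1) ≠ 0) :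
    LocLittleHolder α k f V := by
  obtain ⟨p, rfl⟩ : ∃ p, k = p + 1 := ⟨k - 1, by omega⟩
  have hd : ∀ u ∈ V, HasFDerivAt f (implicitDeriv (fderiv ℝ F (u, f u))) u := fun u hu =>
    hasFDerivAt_of_implicit (hF.1 _ (hfW u hu)).hasFDerivAt (hne u hu)
      (hf.continuousAt (hV.mem_nhds hu)) (Filter.mem_of_superset (hV.mem_nhds hu) hFf)
  have hγ : ContinuousOn (fun u => (u, f u)) V := continuousOn_id.prodMk hf
  have hfd : EqOn (fun u => implicitDeriv (fderiv ℝ F (u, f u))) (fderiv ℝ f) V :=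
    fun u hu => (hd u hu).fderiv.symm
  have hC1 : ContDiffOn ℝ 1 f V := by
    rw [← zero_add (1 : WithTop ℕ∞), contDiffOn_succ_iff_fderiv_of_isOpen hV]
    refine ⟨fun u hu => (hd u hu).differentiableAt.differentiableWithinAt, by simp,
      contDiffOn_zero.2 (ContinuousOn.congr ?_ hfd.symm)⟩
    exact (contDiffOn_implicitDeriv (E := E) (m := 0)).continuousOn.comp
      ((hF.2.continuousOn hα.1).comp hγ hfW) hne
  have hγ1 : ContDiffOn ℝ 1 (fun u => (u, f u)) V := contDiffOn_id.prodMk hC1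
  -- Bootstrapping: `f'` is a smooth function of `fderiv ℝ F` along the graph of `f`, so regularity
  -- of order `m` for `f` yields order `m + 1`. The `C¹` bound found above starts the induction and
  -- allows composition with `fderiv ℝ F` even at order zero.
  have key : ∀ m ≤ p + 1, LocLittleHolder α m f V := by
    intro m hm
    induction m with
    | zero => exact .of_contDiffOn hα.2 hV (by simpa using hC1)
    | succ m ih =>
      refine ⟨fun u hu => (hd u hu).differentiableAt, LocLittleHolder.congr hV ?_ hfd⟩
      have h1 : LocLittleHolder α m (fun u => (u, f u)) V :=
        .prodMk hα.1 hV (.of_contDiff hα.2 m hV contDiff_id) (ih (by omega))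
      have h2 : LocLittleHolder α m (fun u => fderiv ℝ F (u, f u)) V :=
        .comp hα hV hW (hF.2.of_le hα (by omega) hW) h1 hfW (Or.inr hγ1)
      exact .comp (g := implicitDeriv) (V := {L : E × ℝ →L[ℝ] ℝ | L (0, 1) ≠ 0}) hα hV
        isOpen_setOf_apply_ne_zero
        (.of_contDiffOn hα.2 isOpen_setOf_apply_ne_zero contDiffOn_implicitDeriv) h2 hne
        (Or.inl contDiffOn_implicitDeriv)
  exact key _ le_rfl

end Implicit

/-! ### Regularity of the graph function -/

theorem IsGraphChart.mono {n k m : ℕ} {α : ℝ} {Γ : Set (EuclideanSpace ℝ (Fin n))}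
    {e : EuclideanSpace ℝ (Fin n)} {O O' : Set (Submodule.span ℝ {e})ᗮ} {a b : ℝ}
    {g : (Submodule.span ℝ {e})ᗮ → ℝ} (h : IsGraphChart k α Γ e O a b g) (hO' : IsOpen O')
    (hOO' : O' ⊆ O) (hg : IsLittleHolder m α O' g) : IsGraphChart m α Γ e O' a b g :=
  ⟨h.norm_eq, hO', hg, h.mapsTo.mono_left hOO', fun u hu => h.graph u (hOO' hu)⟩

open Classical in
/-- The function of a transverse graph is as regular as the hypersurface. -/
theorem IsNormalFlow.isLittleHolderOn {n k j : ℕ} {α d : ℝ}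
    {Γ Γ' : Set (EuclideanSpace ℝ (Fin n))}
    {w : EuclideanSpace ℝ (Fin n) → EuclideanSpace ℝ (Fin n)}
    {φ : EuclideanSpace ℝ (Fin n) → ℝ → EuclideanSpace ℝ (Fin n)} (h : IsNormalFlow Γ w d φ)
    (hφ : ContDiff ℝ (⊤ : ℕ∞) (Function.uncurry φ)) (hα : α ∈ Ioo (0 : ℝ) 1) (hk : 1 ≤ k)
    (hkj : k ≤ j) (hΓ : Γ ∈ hypersurfaces n j α) (hΓ' : Γ' ∈ hypersurfaces n k α)
    (hw : ∀ x ∈ Γ', 0 < inner ℝ (w x) (normal Γ' x)) {ρ : Γ → ℝ} (hρ : Continuous ρ)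
    (hmem : ∀ y : Γ, φ y (ρ y) ∈ Γ') : IsLittleHolderOn k α Γ ρ := by
  intro y₀ hy₀
  obtain ⟨e, O, a, b, g, hg, u₀, hu₀, hy₀u⟩ := hΓ.2.2.1 y₀ hy₀
  set Y : (Submodule.span ℝ {e})ᗮ → EuclideanSpace ℝ (Fin n) := fun u =>
    (u : EuclideanSpace ℝ (Fin n)) + g u • e with hYdef
  have hO := hg.isOpen
  have hY : ∀ u ∈ O, Y u ∈ Γ := fun u hu => (hg.graph u hu _ (hg.mapsTo hu)).2 rfl
  have hgk : LocLittleHolder α k g O := (hg.littleHolder.locLittleHolder hO).of_le hα hkj hO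
  have hYk : LocLittleHolder α k Y O :=
    .add hα.1 hO (.of_contDiff hα.2 k hO (Submodule.subtypeL (Submodule.span ℝ {e})ᗮ).contDiff)
      (hgk.clm_comp hα.1 (ContinuousLinearMap.toSpanSingleton ℝ e) hO)
  have hYc : ContinuousOn Y O := hYk.continuousOn hα.1
  -- The value `0` is never taken by default on `O`, where `Y u ∈ Γ`.
  set f : (Submodule.span ℝ {e})ᗮ → ℝ := fun u => if hu : Y u ∈ Γ then ρ ⟨Y u, hu⟩ else 0 with hf
  have hfY : ∀ u (hu : Y u ∈ Γ), f u = ρ ⟨Y u, hu⟩ := fun u hu => dif_pos hu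
  have hfc : ContinuousOn f O := by
    rw [continuousOn_iff_continuous_domRestrict]
    have h1 : Continuous fun u : O => ρ ⟨Y u, hY u u.2⟩ :=
      hρ.comp ((continuousOn_iff_continuous_domRestrict.1 hYc).subtype_mk _)
    exact h1.congr fun u => (hfY u (hY u u.2)).symm
  obtain ⟨G, U, hG, hU⟩ := exists_isDefiningFunction_region hα hk hΓ' (hmem ⟨y₀, hy₀⟩)
  have hOW : IsOpen (O ×ˢ (univ : Set ℝ)) := hO.prod isOpen_univ
  have hΨ : LocLittleHolder α k
      (fun p : (Submodule.span ℝ {e})ᗮ × ℝ => Function.uncurry φ (Y p.1, p.2)) (O ×ˢ univ) := by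
    refine LocLittleHolder.comp_contDiff hα hOW hφ (.prodMk hα.1 hOW ?_ ?_)
    · exact .comp_of_pos hα hk hOW hO hYk (.of_contDiff hα.2 k hOW contDiff_fst) fun p hp => hp.1
    · exact .of_contDiff hα.2 k hOW contDiff_snd
  set W := (O ×ˢ (univ : Set ℝ)) ∩
    (fun p : (Submodule.span ℝ {e})ᗮ × ℝ => Function.uncurry φ (Y p.1, p.2)) ⁻¹' U with hWdef
  have hW : IsOpen W := (hΨ.continuousOn hα.1).isOpen_inter_preimage hOW hG.isOpen
  have hF : LocLittleHolder α k
      (fun p : (Submodule.span ℝ {e})ᗮ × ℝ => G (Function.uncurry φ (Y p.1, p.2))) W :=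
    .comp_of_pos hα hk hW hG.isOpen hG.locLittleHolder (hΨ.mono inter_subset_left)
      fun p hp => hp.2
  have hfc' : ContinuousOn (fun u => (u, f u)) O := continuousOn_id.prodMk hfc
  set V := O ∩ (fun u => (u, f u)) ⁻¹' W with hVdef
  have hV : IsOpen V := hfc'.isOpen_inter_preimage hO hW
  have hmem' : ∀ u ∈ O, φ (Y u) (f u) ∈ Γ' := fun u hu => by
    rw [hfY u (hY u hu)]; exact hmem ⟨Y u, hY u hu⟩
  have hu₀V : u₀ ∈ V := by
    refine ⟨hu₀, ⟨hu₀, mem_univ _⟩, ?_⟩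
    change φ (Y u₀) (f u₀) ∈ U
    have h1 : (⟨Y u₀, hY u₀ hu₀⟩ : Γ) = ⟨y₀, hy₀⟩ := Subtype.ext hy₀u.symm
    rw [hfY u₀ (hY u₀ hu₀), h1]
    have h2 : Y u₀ = y₀ := hy₀u.symm
    rwa [h2]
  have hfV : LocLittleHolder α k f V := by
    refine hF.implicit hα hk hW hV (hfc.mono inter_subset_left) (fun u hu => hu.2)
      (fun u hu => (hG.mem_iff _ hu.2.2).1 (hmem' u hu.1)) fun u hu => ?_
    have hFd : DifferentiableAt ℝ
        (fun p : (Submodule.span ℝ {e})ᗮ × ℝ => G (Function.uncurry φ (Y p.1, p.2))) (u, f u) := by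
      obtain ⟨p, rfl⟩ : ∃ p, k = p + 1 := ⟨k - 1, by omega⟩
      exact hF.1 _ hu.2
    have h1 : HasDerivAt (fun s : ℝ => ((u, s) : (Submodule.span ℝ {e})ᗮ × ℝ)) (0, 1) (f u) :=
      (hasDerivAt_const _ _).prodMk (hasDerivAt_id _)
    have h2 := hFd.hasFDerivAt.comp_hasDerivAt (f u) h1
    have hUφ : φ (Y u) (f u) ∈ U := hu.2.2
    have h3 := (hG.differentiableAt hk hUφ).hasFDerivAt.comp_hasDerivAt (f u)
      (h.hasDerivAt (Y u) (f u))
    -- The partial derivative in `s` is `dG(w)` at a point of `Γ'`, positive by transversality.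
    rw [h2.unique h3]
    exact (hG.fderiv_pos_of_inner_normal_pos hk hUφ (hmem' u hu.1) (hw _ (hmem' u hu.1))).ne'
  obtain ⟨κ₁, hκ₁, h₁⟩ := hgk.exists_isLittleHolder_ball hα hO hu₀
  obtain ⟨κ₂, hκ₂, h₂⟩ := hfV.exists_isLittleHolder_ball hα hV hu₀V
  obtain ⟨κ₃, hκ₃, h₃⟩ := Metric.isOpen_iff.1 hO u₀ hu₀
  set κ := min κ₁ (min κ₂ κ₃) with hκdef
  have hκ : 0 < κ := lt_min hκ₁ (lt_min hκ₂ hκ₃)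
  refine ⟨e, Metric.ball u₀ κ, a, b, g, hg.mono Metric.isOpen_ball
    ((Metric.ball_subset_ball ((min_le_right _ _).trans (min_le_right _ _))).trans h₃)
    (h₁ κ (min_le_left _ _)), ⟨u₀, Metric.mem_ball_self hκ, hy₀u⟩, f,
    h₂ κ ((min_le_right _ _).trans (min_le_left _ _)), fun u _ hu => (hfY u hu).symm⟩

end NuGraph

end

/-! ### Choice of the constants and conclusion -/

theorem mainTheorem6 {n : ℕ} {α : ℝ} (hα : α ∈ Ioo (0 : ℝ) 1) {j : ℕ} (hj : 2 ≤ j)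
    (Γ₀ : Set (EuclideanSpace ℝ (Fin n))) (hΓ₀ : Γ₀ ∈ NuGraph.hypersurfaces n j α) :
    (∃ r, NuGraph.IsTubularRadius Γ₀ r) ∧
    ∀ (r : ℝ) (η : ℝ → ℝ) (ψ : EuclideanSpace ℝ (Fin n) → ℝ),
      NuGraph.IsTubularRadius Γ₀ r → NuGraph.IsCutoff r η → NuGraph.IsMollifier ψ →
      ∃ δ₀ > 0, ∃ r₀ > 0, ∃ ε > 0, ∀ δ ∈ Ioo 0 δ₀,
        ∃ φ : EuclideanSpace ℝ (Fin n) → ℝ → EuclideanSpace ℝ (Fin n),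
          NuGraph.IsFlowOn (NuGraph.regularizedNormal Γ₀ r η ψ δ) Γ₀ r₀ φ ∧
          InjOn (Function.uncurry φ) (Γ₀ ×ˢ Ioo (-r₀) r₀) ∧
          IsOpen (Function.uncurry φ '' (Γ₀ ×ˢ Ioo (-r₀) r₀)) ∧
          Function.uncurry φ '' (Γ₀ ×ˢ Ioo (-r₀) r₀) ⊆ Metric.thickening r Γ₀ ∧
          ∀ k : ℕ, 1 ≤ k → k ≤ j → ∀ Γ ∈ NuGraph.hypersurfaces n k α,
            NuGraph.distC1 Γ Γ₀ < ε →
            ∃! ρ : Γ₀ → ℝ, NuGraph.IsLittleHolderOn k α Γ₀ ρ ∧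
              (∀ y, ρ y ∈ Ioo (-r₀) r₀) ∧
              Γ = {x | ∃ y : Γ₀, x = φ y (ρ y)} := by
  have hj1 : 1 ≤ j := by omega
  refine ⟨NuGraph.exists_isTubularRadius hα hj hΓ₀, fun r η ψ hr hη hψ => ?_⟩
  obtain ⟨d, hd, δ₀, hδ₀, hclose⟩ := NuGraph.exists_forall_norm_regularizedNormal_sub_le hα hj1 hΓ₀
    hr hη hψ (by norm_num : (0 : ℝ) < 1 / 8)
  obtain ⟨l, hl, hl'⟩ := NuGraph.exists_preconnected_neighborhoods hα hj1 hΓ₀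
  set r₀ := min r (min d (min l 1)) with hr₀def
  have hr₀ : 0 < r₀ := lt_min hr.1 (lt_min hd (lt_min hl one_pos))
  have hr₀r : r₀ ≤ r := min_le_left _ _
  have hr₀d : r₀ ≤ d := (min_le_right _ _).trans (min_le_left _ _)
  have hr₀l : r₀ ≤ l := (min_le_right _ _).trans ((min_le_right _ _).trans (min_le_left _ _))
  have hr₀1 : r₀ ≤ 1 := (min_le_right _ _).trans ((min_le_right _ _).trans (min_le_right _ _))
  -- The graph lemma is used with `s = r₀ / 2`, so `ε = r₀ / 4` is its `s / 2`, and `2 * s = r₀` is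
  -- at most `d` and `l`. The bound `r₀ ≤ 1` makes the normals differ by less than `1 / 2`, and `|ρ|
  -- ≤ r₀ / 2` stays strictly inside the interval.
  refine ⟨δ₀, hδ₀, r₀, hr₀, r₀ / 4, by positivity, fun δ hδ => ?_⟩
  have hwc := NuGraph.contDiff_regularizedNormal hα hj1 hΓ₀ hr hη hψ hδ.1
  have hws := NuGraph.hasCompactSupport_regularizedNormal hα hj1 hΓ₀ hr hη hψ hδ.1
  obtain ⟨φ, hφ, hφ0, hφ'⟩ := NuGraph.exists_contDiff_flow hwc hws
  obtain ⟨L, hL⟩ := hwc.lipschitzWith_of_hasCompactSupport hws (by simp)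
  have h : NuGraph.IsNormalFlow Γ₀ (NuGraph.regularizedNormal Γ₀ r η ψ δ) d φ :=
    ⟨hφ.continuous, hφ0, hφ', NuGraph.flow_flow hL hφ0 hφ',
      NuGraph.norm_regularizedNormal_le hα hj1 hΓ₀ hr hη hψ hδ.1, hclose δ hδ⟩
  refine ⟨φ, fun y _ => ⟨hφ0 y, fun s _ => hφ' y s⟩, h.injOn hd hα hj1 hΓ₀ _,
    h.isOpen_image hd hα hj1 hΓ₀ _, h.image_subset_thickening hr₀r, fun k hk hkj Γ hΓ hdist => ?_⟩
  obtain ⟨h₁, h₂⟩ := NuGraph.exists_close_of_distC1_lt hα hk hj1 hΓ hΓ₀ hdist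
  have hw : ∀ x ∈ Γ, 0 < inner ℝ (NuGraph.regularizedNormal Γ₀ r η ψ δ x) (NuGraph.normal Γ x) := by
    intro x hx
    obtain ⟨y, hy, hxy, hν⟩ := h₁ x hx
    exact h.inner_normal_pos hα hk hΓ hx hy (by linarith) (by linarith)
  obtain ⟨ρ, hρ, hρs, hρmem, hρΓ⟩ := h.exists_graph hr hα hj1 hΓ₀ hk hΓ hw (s := r₀ / 2) (l := l)
    ⟨by positivity, by linarith⟩ (by linarith) (by linarith) hl'
    (fun x hx => by
      obtain ⟨y, hy, hxy, -⟩ := h₁ x hx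
      exact ⟨y, hy, by linarith⟩)
    (fun y hy => by
      obtain ⟨x, hx, hxy⟩ := h₂ y hy
      exact ⟨x, hx, by linarith⟩)
  refine ⟨ρ, ⟨h.isLittleHolderOn hφ hα hk hkj hΓ₀ hΓ hw hρ hρmem,
    fun y => abs_lt.1 ((hρs y).trans_lt (by linarith)), hρΓ⟩, ?_⟩
  rintro ρ' ⟨-, -, hρ'⟩
  funext y
  refine h.eq_of_mem hα hk hΓ hw (x := y) ?_ (hρmem y)
  rw [hρ']
  exact ⟨y, rfl⟩
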